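/- **Transformation Theorem.** *Conventions.* A $*$-bialgebra $(\mathcal B,\Delta,\delta)$ is a complex unital $*$-algebra with a coalgebra structure whose comultiplication $\Delta$ and counit $\delta$ are unital $*$-homomorphisms; for linear maps $f,g$ from a coalgebra into a unital algebra with multiplication $M$, $f\star g=M\circ(f\otimes g)\circ\Delta$, with unit $b\mapsto\delta(b)\mathbf 1$. For a pre-Hilbert space $D$ let $\mathcal L^a(D)$ be the $*$-algebra of operators on $D$ having an adjoint defined on $D$. A Lévy process on $\mathcal B$ over $(D,\Omega)$, $\Omega\in D$ a unit vector, is a family $(j_{s,t})_{0\le s\le t<\infty}$ of unital $*$-homomorphisms $\mathcal B\to\mathcal L^a(D)$ such that, with $\varphi_{s,t}=\langle\Omega,j_{s,t}(\cdot)\Omega\rangle$: (i) for pairwise disjoint intervals $(s_i,t_i]$ one has $\langle\Omega,j_{s_1,t_1}(b_1)\cdots j_{s_n,t_n}(b_n)\Omega\rangle=\prod_i\varphi_{s_i,t_i}(b_i)$, and the ranges of $j_{s_i,t_i}$ and $j_{s_l,t_l}$ commute for $i\ne l$; (ii) $\varphi_{s,t}=\varphi_{0,t-s}$; (iii) $\varphi_{0,t}(b)\to\delta(b)$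 as $t\to0$; (iv) $j_{r,s}\star j_{s,t}=j_{r,t}$ and $j_{t,t}=\delta(\cdot)\mathbf 1$. It is cyclic if $D$ is spanned by the vectors $j_{t_0,t_1}(b_1)\cdots j_{t_{n-1},t_n}(b_n)\Omega$, $0=t_0\le\dots\le t_n$. It has generator $\psi$, a linear functional on $\mathcal B$, if $\varphi_{0,t}(b)=\sum_{n\ge0}\frac{t^n}{n!}\psi^{\star n}(b)$ for all $t\ge 0$, $b\in\mathcal B$. The partitions $\alpha=\{s=t_0<\dots<t_n=t\}$ of $[s,t]$ are directed by inclusion. Let $j$ be a cyclic Lévy process on a $*$-bialgebra $(\mathcal B,\Delta,\delta)$ over $(D_j,\Omega)$ with generator $\psi$, let $(\mathcal C,\Lambda,\lambda)$ be a $*$-bialgebra and $\varkappa:\mathcal C\to\mathcal B$ a unital $*$-homomorphism with $\delta\circ\varkappa=\lambda$. Let $\overline{D_j}$ be the completion of $D_j$ and $H_k\subset\overline{D_j}$ the closed span of all $j_{t_0,t_1}(\varkappa(c_1))\cdots j_{t_{n-1},t_n}(\varkappa(c_n))\Omega$ with $n\in\mathbb N$, $0\le t_0\le\dots\le t_n$,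 $c_i\in\mathcal C$. For a partition $\alpha$ of $[s,t]$ put $\Theta_\alpha(c)=\big((j_{t_0,t_1}\circ\varkappa)\star\cdots\star(j_{t_{n-1},t_n}\circ\varkappa)\big)(c)$, with the convolution of $\mathcal C$, and $\vartheta_\alpha(c)=\Theta_\alpha(c)\Omega$. 1. For all $c\in\mathcal C$ and $0\le s\le t$ the net $(\vartheta_\alpha(c))_\alpha$ converges in norm to an element of $H_k$. There are a linear subspace $D_k\subset H_k$ containing $\Omega$ and a cyclic Lévy process $k$ on $\mathcal C$ over $(D_k,\Omega)$ with $$k_{s,t}(c)\Omega=\lim_\alpha\vartheta_\alpha(c)\qquad(0\le s\le t,\ c\in\mathcal C)$$ and, more generally, $k_{t_0,t_1}(c_1)\cdots k_{t_{n-1},t_n}(c_n)\Omega=\lim_{\alpha_1,\dots,\alpha_n}\Theta_{\alpha_1}(c_1)\cdots\Theta_{\alpha_n}(c_n)\Omega$ for $0\le t_0\le\dots\le t_n$ and $c_i\in\mathcal C$, where $\alpha_i$ runs over the partitions of $[t_{i-1},t_i]$. The pair $(D_k,k)$ is uniquely determined by these properties. Its generator is $\psi\circ\varkappa$, and every cyclic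 Lévy process on $\mathcal C$ (over any pre-Hilbert space and unit vector) with generator $\psi\circ\varkappa$ is unitarily equivalent to $k$, by a unitary that respects the unit vectors. 2. Assume in addition that $\varkappa$ is surjective. Put $\mathcal B_0=\ker\delta$ and let $\mathcal T(\mathcal B_0)$ be the tensor $*$-algebra over $\mathcal B_0$; embed $\mathcal B=\mathbb C\mathbf 1\oplus\mathcal B_0\subset\mathcal T(\mathcal B_0)$, and let $\mathcal T(\Delta)$, $\mathcal T(\delta)$ be the comultiplication and counit of $\mathcal T(\mathcal B_0)$, that is, the algebra homomorphisms that extend $\Delta|_{\mathcal B_0}:\mathcal B_0\to\mathcal B\otimes\mathcal B\subset\mathcal T(\mathcal B_0)\otimes\mathcal T(\mathcal B_0)$ and $\delta|_{\mathcal B_0}=0$ (the induced tensor $*$-bialgebra). There are linear $*$-maps $\nu:\mathcal B_0\to\mathcal C$ with $\varkappa\circ\nu=\mathrm{id}_{\mathcal B_0}$. For each such $\nu$, with $\widetilde\varkappa=\mathcal T(\nu):\mathcal T(\mathcal B_0)\to\mathcal C$ the $*$-homomorphism extending $\nu$, and for all $b\in\mathcal B$ and $0\le s\le t$, the net $$\zeta_\alpha(b)=(k_{t_0,t_1}\circ\widetilde\varkappa)\star_{\mathcal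 T(\Delta)}\cdots\star_{\mathcal T(\Delta)}(k_{t_{n-1},t_n}\circ\widetilde\varkappa)(b)\,\Omega$$ over the partitions $\alpha$ of $[s,t]$ converges in norm to $j_{s,t}(b)\Omega$. Moreover $H_k=\overline{D_j}$, and $D_k$ is dense in $H_k$. -/

import Mathlib

open scoped NNReal TensorProduct
open Filter Topology

noncomputable section

namespace QLevy

/-- A `*`-bialgebra: a complex bialgebra which is a `*`-algebra, such that the comultiplication and
the counit are `*`-maps. The involution on `B ⊗ B` is `(a ⊗ b)* = a* ⊗ b*`. -/
class StarBialgebra (B : Type*) [Ring B] [StarRing B] [Bialgebra ℂ B] [StarModule ℂ B] :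
    Prop where
  comul_star : ∀ b : B,
    Coalgebra.comul (R := ℂ) (star b) = star (Coalgebra.comul (R := ℂ) b : B ⊗[ℂ] B)
  counit_star : ∀ b : B, Coalgebra.counit (R := ℂ) (star b) = star (Coalgebra.counit (R := ℂ) b)

section Adjointable

variable (D : Type*) [NormedAddCommGroup D] [InnerProductSpace ℂ D]

/-- The operators on the pre-Hilbert space `D` that possess an adjoint defined on all of `D`. -/
def adjointable : Subalgebra ℂ (Module.End ℂ D) where
  carrier := {T | ∃ S : Module.End ℂ D, ∀ x y, inner ℂ (T x) y = inner ℂ x (S y)}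
  mul_mem' := by
    rintro T T' ⟨S, hS⟩ ⟨S', hS'⟩
    exact ⟨S' * S, fun x y => by simp [hS, hS']⟩
  add_mem' := by
    rintro T T' ⟨S, hS⟩ ⟨S', hS'⟩
    exact ⟨S + S', fun x y => by
      rw [LinearMap.add_apply, LinearMap.add_apply, inner_add_left, inner_add_right, hS, hS']⟩
  algebraMap_mem' r := ⟨algebraMap ℂ _ (star r), fun x y => by
    simp [Module.algebraMap_end_apply, mul_comm]⟩

/-- The `*`-algebra `𝓛ᵃ(D)` of adjointable operators on the pre-Hilbert space `D`. -/
abbrev La : Type _ := ↥(adjointable D)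

variable {D}

lemma La.ext_inner {T S : La D} (h : ∀ x y, inner ℂ x (T.1 y) = inner ℂ x (S.1 y)) : T = S :=
  Subtype.ext (LinearMap.ext fun y => ext_inner_left ℂ fun x => h x y)

instance : Star (La D) where
  star T := ⟨T.2.choose, T.1, fun x y => by
    rw [← inner_conj_symm, ← T.2.choose_spec, inner_conj_symm]⟩

/-- The defining property of the adjoint. -/
lemma La.inner_star_right (T : La D) (x y : D) :
    inner ℂ x ((star T).1 y) = inner ℂ (T.1 x) y := (T.2.choose_spec x y).symm

lemma La.inner_star_left (T : La D) (x y : D) :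
    inner ℂ ((star T).1 x) y = inner ℂ x (T.1 y) := by
  rw [← inner_conj_symm, La.inner_star_right, inner_conj_symm]

instance : StarRing (La D) where
  star_involutive T := La.ext_inner fun x y => by
    rw [La.inner_star_right, La.inner_star_left]
  star_mul T S := La.ext_inner fun x y => by
    simp [La.inner_star_right]
  star_add T S := La.ext_inner fun x y => by
    simp [La.inner_star_right]

instance : StarModule ℂ (La D) where
  star_smul r T := La.ext_inner fun x y => by
    simp [La.inner_star_right, mul_comm]

/-- The vector state `T ↦ ⟨Ω, T Ω⟩` on `𝓛ᵃ(D)`. -/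
def vacuum (Ω : D) : La D →ₗ[ℂ] ℂ where
  toFun T := inner ℂ Ω (T.1 Ω)
  map_add' T S := by simp
  map_smul' r T := by simp

end Adjointable

section Partitions

/-- The partitions `s = t₀ < t₁ < ⋯ < tₙ = t` of `[s, t]`, each given by the finite set of its
points; they are ordered by inclusion (refinement). -/
abbrev IntervalPartition (s t : ℝ≥0) : Type :=
  {α : Finset ℝ≥0 // s ∈ α ∧ t ∈ α ∧ ∀ x ∈ α, s ≤ x ∧ x ≤ t}

/-- The list `(t₀, t₁), (t₁, t₂), …, (tₙ₋₁, tₙ)` of the consecutive intervals of a partition. -/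
def IntervalPartition.steps {s t : ℝ≥0} (α : IntervalPartition s t) : List (ℝ≥0 × ℝ≥0) :=
  (α.1.sort (· ≤ ·)).zip (α.1.sort (· ≤ ·)).tail

variable {C A : Type*} [AddCommGroup C] [Module ℂ C] [Coalgebra ℂ C] [Ring A] [Algebra ℂ A]

/-- The convolution product `F_{t₀,t₁} ⋆ F_{t₁,t₂} ⋆ ⋯ ⋆ F_{tₙ₋₁,tₙ}` over a partition, for a
family `F` of linear maps from a coalgebra `C` to an algebra `A`. (Mathlib's product on
`WithConv (C →ₗ[ℂ] A)` is the convolution `f ⋆ g = M ∘ (f ⊗ g) ∘ Δ`; the empty product is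
`c ↦ δ(c) 1`.) -/
def convProd (F : ℝ≥0 → ℝ≥0 → C →ₗ[ℂ] A) {s t : ℝ≥0} (α : IntervalPartition s t) :
    C →ₗ[ℂ] A :=
  ((α.steps.map fun p => WithConv.toConv (F p.1 p.2)).prod).ofConv

end Partitions

section Processes

variable {B : Type*} [Ring B] [StarRing B] [Bialgebra ℂ B] [StarModule ℂ B]
variable {C : Type*} [Ring C] [StarRing C] [Bialgebra ℂ C] [StarModule ℂ C]
variable {D : Type*} [NormedAddCommGroup D] [InnerProductSpace ℂ D]

/-- The linear map underlying a `*`-homomorphism. -/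
def lin {A A' : Type*} [Ring A] [Algebra ℂ A] [Star A] [Ring A'] [Algebra ℂ A'] [Star A']
    (f : A →⋆ₐ[ℂ] A') : A →ₗ[ℂ] A' := f.toAlgHom.toLinearMap

/-- The distribution `φ_{s,t} = ⟨Ω, j_{s,t}(·) Ω⟩`. -/
def distr (Ω : D) (j : ℝ≥0 → ℝ≥0 → B →⋆ₐ[ℂ] La D) (s t : ℝ≥0) : B →ₗ[ℂ] ℂ :=
  vacuum Ω ∘ₗ lin (j s t)

/-- A (stationary, concrete) quantum Lévy process on `B` over `(D, Ω)`. Only the values `j s t`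
with `s ≤ t` are meaningful. -/
structure IsLevyProcess (Ω : D) (j : ℝ≥0 → ℝ≥0 → B →⋆ₐ[ℂ] La D) : Prop where
  norm_vacuum : ‖Ω‖ = 1
  /-- increments over disjoint intervals factorize in the vacuum state -/
  factorizes : ∀ (n : ℕ) (s t : Fin n → ℝ≥0) (b : Fin n → B), (∀ i, s i ≤ t i) →
    (Pairwise fun i l => Disjoint (Set.Ioc (s i) (t i)) (Set.Ioc (s l) (t l))) →
    vacuum Ω (List.ofFn fun i => j (s i) (t i) (b i)).prod = ∏ i, distr Ω j (s i) (t i) (b i)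
  /-- increments over disjoint intervals commute -/
  commutes : ∀ s t s' t' : ℝ≥0, s ≤ t → s' ≤ t' → Disjoint (Set.Ioc s t) (Set.Ioc s' t') →
    ∀ b b' : B, Commute (j s t b) (j s' t' b')
  stationary : ∀ s t : ℝ≥0, s ≤ t → distr Ω j s t = distr Ω j 0 (t - s)
  continuous : ∀ b : B,
    Tendsto (fun t : ℝ≥0 => distr Ω j 0 t b) (𝓝 0) (𝓝 (Coalgebra.counit (R := ℂ) b))
  increments : ∀ r s t : ℝ≥0, r ≤ s → s ≤ t →
    WithConv.toConv (lin (j r s)) * WithConv.toConv (lin (j s t)) = WithConv.toConv (lin (j r t))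
  diagonal : ∀ (t : ℝ≥0) (b : B), j t t b = algebraMap ℂ (La D) (Coalgebra.counit (R := ℂ) b)

/-- The product `F_{t₀,t₁}(b₁) ⋯ F_{tₙ₋₁,tₙ}(bₙ)` for given `t₀, …, tₙ`. -/
def timeProd (F : ℝ≥0 → ℝ≥0 → B →ₗ[ℂ] La D) {n : ℕ} (t : Fin (n + 1) → ℝ≥0) (b : Fin n → B) :
    La D :=
  (List.ofFn fun i : Fin n => F (t i.castSucc) (t i.succ) (b i)).prod

/-- The algebra `𝓐_j`, the span of all `j_{t₀,t₁}(b₁) ⋯ j_{tₙ₋₁,tₙ}(bₙ)` with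
`0 = t₀ ≤ t₁ ≤ ⋯ ≤ tₙ`. -/
def processAlgebra (j : ℝ≥0 → ℝ≥0 → B →⋆ₐ[ℂ] La D) : Submodule ℂ (La D) :=
  Submodule.span ℂ {T | ∃ (n : ℕ) (t : Fin (n + 1) → ℝ≥0) (b : Fin n → B),
    Monotone t ∧ t 0 = 0 ∧ T = timeProd (fun u v => lin (j u v)) t b}

/-- The process is cyclic: `𝓐_j Ω = D`. -/
def IsCyclicProcess (Ω : D) (j : ℝ≥0 → ℝ≥0 → B →⋆ₐ[ℂ] La D) : Prop :=
  ∀ x : D, ∃ T ∈ processAlgebra j, T.1 Ω = x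

/-- `ψ` generates the convolution semigroup of `j`: `φ_{0,t} = e_⋆^{tψ}`, that is,
`φ_{0,t}(b) = ∑ₙ tⁿ/n! ψ^{⋆n}(b)` for all `t ≥ 0` and all `b`. -/
def HasGenerator (Ω : D) (j : ℝ≥0 → ℝ≥0 → B →⋆ₐ[ℂ] La D) (ψ : B →ₗ[ℂ] ℂ) : Prop :=
  ∀ (t : ℝ≥0) (b : B),
    HasSum (fun n : ℕ => (((t : ℝ) : ℂ) ^ n / (n.factorial : ℂ)) * (WithConv.toConv ψ ^ n) b)
      (distr Ω j 0 t b)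

/-- The Hilbert subspace `H_k` of the completion of `D`: the closed span of all vectors
`j_{t₀,t₁}(κ c₁) ⋯ j_{tₙ₋₁,tₙ}(κ cₙ) Ω` with `t₀ ≤ t₁ ≤ ⋯ ≤ tₙ`. -/
def transformSpace (Ω : D) (j : ℝ≥0 → ℝ≥0 → B →⋆ₐ[ℂ] La D) (κ : C →⋆ₐ[ℂ] B) :
    Submodule ℂ (UniformSpace.Completion D) :=
  (Submodule.span ℂ {v : UniformSpace.Completion D |
    ∃ (n : ℕ) (t : Fin (n + 1) → ℝ≥0) (c : Fin n → C), Monotone t ∧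
      v = ((timeProd (fun u v => lin (j u v) ∘ₗ lin κ) t c).1 Ω : D)}).topologicalClosure

/-- The operator `(j_{t₀,t₁} ∘ κ) ⋆ ⋯ ⋆ (j_{tₙ₋₁,tₙ} ∘ κ)(c)`, the convolution being that of `C`;
applied to `Ω` it gives `ϑ_α(c)`. -/
def transProd (j : ℝ≥0 → ℝ≥0 → B →⋆ₐ[ℂ] La D) (κ : C →⋆ₐ[ℂ] B) {s t : ℝ≥0}
    (α : IntervalPartition s t) : C →ₗ[ℂ] La D :=
  convProd (fun u v => lin (j u v) ∘ₗ lin κ) α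

/-- `k` is a cyclic Lévy process on `C` over `(Dk, Ω)`, where `Dk` is a subspace of the completion
of `D`, and it is given by the infinitesimal convolution products of `j ∘ κ`:
`k_{s,t}(c) Ω = lim_α ϑ_α(c)`, and, more generally,
`k_{t₀,t₁}(c₁) ⋯ k_{tₙ₋₁,tₙ}(cₙ) Ω` is the joint limit, over the partitions `αᵢ` of the
`[tᵢ₋₁, tᵢ]`, of the vectors obtained from `Ω` by the product of the convolution products
over `α₁, …, αₙ` (that is, of `ϑ_{α₁}(c₁) ⊗ ⋯ ⊗ ϑ_{αₙ}(cₙ)`). -/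
structure IsTransform (Ω : D) (j : ℝ≥0 → ℝ≥0 → B →⋆ₐ[ℂ] La D) (κ : C →⋆ₐ[ℂ] B)
    (Dk : Submodule ℂ (UniformSpace.Completion D)) (hΩ : (Ω : UniformSpace.Completion D) ∈ Dk)
    (k : ℝ≥0 → ℝ≥0 → C →⋆ₐ[ℂ] La Dk) : Prop where
  levy : IsLevyProcess (⟨Ω, hΩ⟩ : Dk) k
  cyclic : IsCyclicProcess (⟨Ω, hΩ⟩ : Dk) k
  limit : ∀ (s t : ℝ≥0) (c : C), s ≤ t →
    Tendsto (fun α : IntervalPartition s t =>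
        (((transProd j κ α c).1 Ω : D) : UniformSpace.Completion D))
      atTop (𝓝 ((k s t c).1 ⟨Ω, hΩ⟩ : Dk))
  limit_prod : ∀ (n : ℕ) (t : Fin (n + 1) → ℝ≥0) (c : Fin n → C), Monotone t →
    Tendsto (fun α : (i : Fin n) → IntervalPartition (t i.castSucc) (t i.succ) =>
        (((List.ofFn fun i => transProd j κ (α i) (c i)).prod.1 Ω : D) :
          UniformSpace.Completion D))
      atTop (𝓝 ((timeProd (fun u v => lin (k u v)) t c).1 ⟨Ω, hΩ⟩ : Dk))

end Processes

section TensorStar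

variable (V : Type*) [AddCommGroup V] [Module ℂ V]

/-- Auxiliary: the opposite of the tensor algebra with conjugate scalars. -/
def ConjOp : Type _ := (TensorAlgebra ℂ V)ᵐᵒᵖ

instance : Ring (ConjOp V) := inferInstanceAs (Ring (TensorAlgebra ℂ V)ᵐᵒᵖ)

instance : Algebra ℂ (ConjOp V) :=
  RingHom.toAlgebra' ((algebraMap ℂ (TensorAlgebra ℂ V)ᵐᵒᵖ).comp (starRingEnd ℂ))
    fun r x => Algebra.commutes (A := (TensorAlgebra ℂ V)ᵐᵒᵖ) (starRingEnd ℂ r) x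

lemma ConjOp.smul_def (r : ℂ) (x : ConjOp V) :
    r • x = MulOpposite.op (star r • MulOpposite.unop x) := by
  rw [Algebra.smul_def]
  exact (Algebra.smul_def (A := (TensorAlgebra ℂ V)ᵐᵒᵖ) (star r) x).symm

/-- Auxiliary: the involution of the tensor algebra as a homomorphism into `ConjOp V`. -/
def starHom [StarAddMonoid V] [StarModule ℂ V] : TensorAlgebra ℂ V →ₐ[ℂ] ConjOp V :=
  TensorAlgebra.lift ℂ
    { toFun := fun v => MulOpposite.op (TensorAlgebra.ι ℂ (star v))
      map_add' := fun v w => by rw [star_add, map_add]; rfl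
      map_smul' := fun r v => by
        rw [star_smul, map_smul]; exact (ConjOp.smul_def V r _).symm }

lemma starHom_ι [StarAddMonoid V] [StarModule ℂ V] (v : V) :
    starHom V (TensorAlgebra.ι ℂ v) = (MulOpposite.op (TensorAlgebra.ι ℂ (star v)) :) :=
  TensorAlgebra.lift_ι_apply _ v

end TensorStar

section InducedTensor

variable (B : Type*) [Ring B] [StarRing B] [Bialgebra ℂ B] [StarModule ℂ B] [StarBialgebra B]

/-- `B₀ = ker δ`. -/
def augIdeal (B : Type*) [Ring B] [Bialgebra ℂ B] : Submodule ℂ B :=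
  LinearMap.ker (Coalgebra.counit (R := ℂ) (A := B))

instance : StarAddMonoid (augIdeal B) where
  star b := ⟨star b.1, by
    have h : Coalgebra.counit (R := ℂ) b.1 = 0 := b.2
    change Coalgebra.counit (R := ℂ) (star b.1) = 0
    rw [StarBialgebra.counit_star, h, star_zero]⟩
  star_involutive b := Subtype.ext (star_star b.1)
  star_add a b := Subtype.ext (star_add a.1 b.1)

lemma augIdeal.coe_star (b : augIdeal B) : ((star b : augIdeal B) : B) = star (b : B) := rfl

instance : StarModule ℂ (augIdeal B) where
  star_smul r b := Subtype.ext (star_smul r b.1)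

/-- The tensor algebra `𝓣(B₀)`; below it is made into the induced tensor `*`-bialgebra of `B`. -/
def InducedTensor (B : Type*) [Ring B] [Bialgebra ℂ B] : Type _ := TensorAlgebra ℂ (augIdeal B)

namespace InducedTensor

instance (B : Type*) [Ring B] [Bialgebra ℂ B] : Ring (InducedTensor B) :=
  inferInstanceAs (Ring (TensorAlgebra ℂ (augIdeal B)))

instance (B : Type*) [Ring B] [Bialgebra ℂ B] : Algebra ℂ (InducedTensor B) :=
  inferInstanceAs (Algebra ℂ (TensorAlgebra ℂ (augIdeal B)))

section Coalg

variable {B : Type*} [Ring B] [Bialgebra ℂ B]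

/-- The inclusion `B₀ → 𝓣(B₀)`. -/
def ι : augIdeal B →ₗ[ℂ] InducedTensor B := TensorAlgebra.ι ℂ

/-- The algebra homomorphism `𝓣(f) : 𝓣(B₀) → A` extending a linear map `f : B₀ → A`. -/
def lift {A : Type*} [Ring A] [Algebra ℂ A] (f : augIdeal B →ₗ[ℂ] A) : InducedTensor B →ₐ[ℂ] A :=
  TensorAlgebra.lift ℂ f

@[simp] lemma lift_ι {A : Type*} [Ring A] [Algebra ℂ A] (f : augIdeal B →ₗ[ℂ] A)
    (b : augIdeal B) : lift f (ι b) = f b := TensorAlgebra.lift_ι_apply f b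

lemma hom_ext {A : Type*} [Ring A] [Algebra ℂ A] {f g : InducedTensor B →ₐ[ℂ] A}
    (h : ∀ b, f (ι b) = g (ι b)) : f = g := TensorAlgebra.hom_ext (LinearMap.ext h)

/-- The projection `b ↦ b - δ(b) 1` of `B` onto `B₀`. -/
def proj : B →ₗ[ℂ] augIdeal B where
  toFun b := ⟨b - algebraMap ℂ B (Coalgebra.counit (R := ℂ) b), by
    change Coalgebra.counit (R := ℂ) _ = 0
    simp⟩
  map_add' a b := Subtype.ext (by simp; abel)
  map_smul' r b := Subtype.ext (by simp [Algebra.smul_def, mul_sub])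

/-- The canonical embedding `B = ℂ1 ⊕ B₀ ⊂ 𝓣(B₀)`. -/
def incl : B →ₗ[ℂ] InducedTensor B :=
  Algebra.linearMap ℂ (InducedTensor B) ∘ₗ Coalgebra.counit + ι ∘ₗ proj

lemma incl_coe (b : augIdeal B) : incl (b : B) = ι b := by
  have h : Coalgebra.counit (R := ℂ) (b : B) = 0 := b.2
  have h' : proj (b : B) = b := Subtype.ext (by simp [proj, h])
  simp [incl, h, h']

lemma incl_one : incl (1 : B) = 1 := by
  have h' : proj (1 : B) = 0 := Subtype.ext (by simp [proj])
  simp [incl, h']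

lemma proj_decomp (b : B) :
    b = Coalgebra.counit (R := ℂ) b • (1 : B) + (proj b : B) := by
  simp [proj, Algebra.smul_def]

/-- `𝓣(Δ)`: the algebra homomorphism which is the comultiplication of `B` on `B₀`, where
`B ⊗ B ⊂ 𝓣(B₀) ⊗ 𝓣(B₀)`. -/
def comulHom : InducedTensor B →ₐ[ℂ] InducedTensor B ⊗[ℂ] InducedTensor B :=
  lift (TensorProduct.map incl incl ∘ₗ Coalgebra.comul ∘ₗ (augIdeal B).subtype)

/-- `𝓣(δ) = 𝓣(0)`: the algebra homomorphism vanishing on `B₀`. -/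
def counitHom : InducedTensor B →ₐ[ℂ] ℂ := lift 0

lemma comulHom_incl (b : B) :
    comulHom (incl b) = TensorProduct.map incl incl (Coalgebra.comul (R := ℂ) b) := by
  conv_lhs => rw [proj_decomp b]
  conv_rhs => rw [proj_decomp b]
  rw [map_add, map_add, map_smul, map_smul, incl_one, incl_coe, map_one, comulHom, lift_ι]
  simp [incl_one, Algebra.TensorProduct.one_def]

lemma counitHom_incl (b : B) : counitHom (incl b) = Coalgebra.counit (R := ℂ) b := by
  simp [incl, counitHom]

instance : Bialgebra ℂ (InducedTensor B) :=
  Bialgebra.ofAlgHom comulHom counitHom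
    (hom_ext fun b => by
      have key : ∀ x : B ⊗[ℂ] B,
          TensorProduct.assoc ℂ _ _ _ (TensorProduct.map comulHom.toLinearMap LinearMap.id
            (TensorProduct.map incl incl x)) =
          TensorProduct.map incl (TensorProduct.map incl incl) (TensorProduct.assoc ℂ _ _ _
            ((Coalgebra.comul (R := ℂ)).rTensor B x)) := by
        intro x
        induction x with
        | zero => simp
        | add x y hx hy => simp only [map_add, hx, hy]
        | tmul x y =>
          simp only [TensorProduct.map_tmul, AlgHom.toLinearMap_apply, comulHom_incl,
            LinearMap.id_apply, LinearMap.rTensor_tmul]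
          generalize (Coalgebra.comul (R := ℂ) x) = z
          induction z with
          | zero => simp
          | add z w hz hw => simp only [map_add, TensorProduct.add_tmul, hz, hw]
          | tmul z w => simp
      have key' : ∀ x : B ⊗[ℂ] B,
          TensorProduct.map LinearMap.id comulHom.toLinearMap (TensorProduct.map incl incl x) =
          TensorProduct.map incl (TensorProduct.map incl incl)
            ((Coalgebra.comul (R := ℂ)).lTensor B x) := by
        intro x
        induction x with
        | zero => simp
        | add x y hx hy => simp only [map_add, hx, hy]
        | tmul x y => simp [comulHom_incl]
      have h1 := key (Coalgebra.comul (R := ℂ) (b : B))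
      have h2 := key' (Coalgebra.comul (R := ℂ) (b : B))
      rw [Coalgebra.coassoc_apply, ← h2, ← comulHom_incl, incl_coe] at h1
      exact h1)
    (hom_ext fun b => by
      have key : ∀ x : B ⊗[ℂ] B,
          TensorProduct.map counitHom.toLinearMap LinearMap.id (TensorProduct.map incl incl x) =
          TensorProduct.map LinearMap.id incl ((Coalgebra.counit (R := ℂ)).rTensor B x) := by
        intro x
        induction x with
        | zero => simp
        | add x y hx hy => simp only [map_add, hx, hy]
        | tmul x y => simp [counitHom_incl]
      have h1 := key (Coalgebra.comul (R := ℂ) (b : B))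
      rw [Coalgebra.rTensor_counit_comul, ← comulHom_incl, incl_coe] at h1
      rw [TensorProduct.map_tmul, incl_coe] at h1
      exact h1)
    (hom_ext fun b => by
      have key : ∀ x : B ⊗[ℂ] B,
          TensorProduct.map LinearMap.id counitHom.toLinearMap (TensorProduct.map incl incl x) =
          TensorProduct.map incl LinearMap.id ((Coalgebra.counit (R := ℂ)).lTensor B x) := by
        intro x
        induction x with
        | zero => simp
        | add x y hx hy => simp only [map_add, hx, hy]
        | tmul x y => simp [counitHom_incl]
      have h1 := key (Coalgebra.comul (R := ℂ) (b : B))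
      rw [Coalgebra.lTensor_counit_comul, ← comulHom_incl, incl_coe] at h1
      rw [TensorProduct.map_tmul, incl_coe] at h1
      exact h1)

end Coalg

/-- The involution of `𝓣(B₀)`, the one extending that of `B₀`. -/
instance : Star (InducedTensor B) where
  star x := MulOpposite.unop (starHom (augIdeal B) x)

lemma star_ι (b : augIdeal B) : star (ι b : InducedTensor B) = ι (star b) :=
  congrArg MulOpposite.unop (starHom_ι (augIdeal B) b)

lemma star_algebraMap' (r : ℂ) :
    star (algebraMap ℂ (InducedTensor B) r) = algebraMap ℂ (InducedTensor B) (star r) :=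
  congrArg MulOpposite.unop ((starHom (augIdeal B)).commutes r)

lemma star_mul' (x y : InducedTensor B) : star (x * y) = star y * star x :=
  congrArg MulOpposite.unop (map_mul (starHom (augIdeal B)) x y)

lemma star_add' (x y : InducedTensor B) : star (x + y) = star x + star y :=
  congrArg MulOpposite.unop (map_add (starHom (augIdeal B)) x y)

lemma induct {B : Type*} [Ring B] [Bialgebra ℂ B] {P : InducedTensor B → Prop} (h0 : ∀ r, P (algebraMap ℂ _ r)) (h1 : ∀ b, P (ι b))
    (hm : ∀ x y, P x → P y → P (x * y)) (ha : ∀ x y, P x → P y → P (x + y)) (x) : P x :=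
  TensorAlgebra.induction h0 h1 hm ha x

instance : StarRing (InducedTensor B) where
  star_involutive x := by
    induction x using induct with
    | h0 r => rw [star_algebraMap', star_algebraMap', star_star]
    | h1 b => rw [star_ι, star_ι, star_star]
    | hm x y hx hy => rw [star_mul', star_mul', hx, hy]
    | ha x y hx hy => rw [star_add', star_add', hx, hy]
  star_mul := star_mul' B
  star_add := star_add' B

instance : StarModule ℂ (InducedTensor B) where
  star_smul r x := by
    rw [Algebra.smul_def, Algebra.smul_def, star_mul', star_algebraMap', Algebra.commutes]

lemma star_incl (b : B) : star (incl b : InducedTensor B) = incl (star b) := by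
  have h : star (proj b) = proj (star b) := Subtype.ext (by
    rw [augIdeal.coe_star]
    simp only [proj, LinearMap.coe_mk, AddHom.coe_mk, star_sub, StarBialgebra.counit_star,
      algebraMap_star_comm])
  simp only [incl, LinearMap.add_apply, LinearMap.comp_apply, Algebra.linearMap_apply, star_add',
    star_algebraMap', star_ι, h, StarBialgebra.counit_star]

instance : StarBialgebra (InducedTensor B) where
  comul_star x := by
    change comulHom (star x) = star (comulHom x)
    induction x using induct with
    | h0 r =>
      rw [star_algebraMap', AlgHom.commutes, AlgHom.commutes, Algebra.algebraMap_eq_smul_one,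
        Algebra.algebraMap_eq_smul_one, star_smul, star_one]
    | h1 b =>
      have key : ∀ x : B ⊗[ℂ] B, TensorProduct.map (incl (B := B)) (incl (B := B)) (star x) =
          star (TensorProduct.map (incl (B := B)) (incl (B := B)) x) := by
        intro x
        induction x with
        | zero => simp
        | add x y hx hy => simp only [map_add, star_add, hx, hy]
        | tmul x y => simp [star_incl]
      rw [star_ι, ← incl_coe, ← incl_coe, comulHom_incl, comulHom_incl, augIdeal.coe_star,
        StarBialgebra.comul_star, key]
    | hm x y hx hy => rw [star_mul, map_mul, map_mul, star_mul, hx, hy]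
    | ha x y hx hy => rw [star_add, map_add, map_add, star_add, hx, hy]
  counit_star x := by
    change counitHom (star x) = star (counitHom x)
    induction x using induct with
    | h0 r => rw [star_algebraMap', AlgHom.commutes, AlgHom.commutes]; rfl
    | h1 b => simp [star_ι, counitHom]
    | hm x y hx hy => rw [star_mul, map_mul, map_mul, star_mul, hx, hy]
    | ha x y hx hy => rw [star_add, map_add, map_add, star_add, hx, hy]

variable {B}

/-- The `*`-homomorphism `𝓣(ν) : 𝓣(B₀) → C` extending a linear `*`-map `ν : B₀ → C`. -/
def starLift {C : Type*} [Ring C] [Algebra ℂ C] [StarRing C] [StarModule ℂ C]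
    (ν : augIdeal B →ₗ[ℂ] C) (hν : ∀ b, ν (star b) = star (ν b)) : InducedTensor B →⋆ₐ[ℂ] C where
  toAlgHom := lift ν
  map_star' x := by
    change lift ν (star x) = star (lift ν x)
    induction x using induct with
    | h0 r => rw [star_algebraMap', AlgHom.commutes, AlgHom.commutes, algebraMap_star_comm]
    | h1 b => rw [star_ι, lift_ι, lift_ι, hν]
    | hm x y hx hy => rw [star_mul, map_mul, map_mul, star_mul, hx, hy]
    | ha x y hx hy => rw [star_add, map_add, map_add, star_add, hx, hy]

end InducedTensor

end InducedTensor

end QLevy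

end

open QLevy

/-!
The transform is built from the products `Θ_α(c)` of the increments `j ∘ κ` over partitions `α`.

*Estimates.* Every element of a coalgebra is a matrix coefficient of a finite-dimensional
representation of its convolution algebra of functionals (`exists_matrix_coefficients`), so a
convolution product of functionals `δ + hᵢ χ + O(hᵢ²)` differs from `e_⋆^{(∑ hᵢ) χ}` at a given
element by at most a multiple of `∑ hᵢ²` (`exists_convProd_bound`). Since increments of `j` over
disjoint intervals commute and are independent in the vacuum state, the vacuum expectations of
`Θ_α(c)`, of `j_{s,t}(b) Θ_α(c)` and of `Θ_α(c) Θ_β(c')` with `α ⊆ β` are convolution products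
of functionals of this kind, on `C`, `B ⊗ C` and `C ⊗ C`; for the last two, the commuting factors
over the steps are first paired up (`IsLocal.pairing_stepConv`). The limits are
`e_⋆^{(t-s) ψ ∘ κ}(c)`, `e_⋆^{(t-s) χ}(b ⊗ c)` with `χ(b ⊗ c) = ψ(b κ(c))`, and
`e_⋆^{(t-s) ψ ∘ κ}(c c')`. Expanding `‖Θ_α(c) Ω - Θ_β(c) Ω‖²` shows that the vectors `Θ_α(c) Ω`
form a Cauchy net (`cauchySeq_refined`).

*The limit process.* A finite set `γ` of times cuts out a partition of every interval, so all the
`Θ_α` become nets indexed by the same directed set of the finite sets `γ`, and they generate a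
`*`-algebra of nets of operators, `netAlgebra`. Modulo the nets which vanish eventually, the `Θ`
satisfy the flow property `Θ_{r,s} ⋆ Θ_{s,t} = Θ_{r,t}`; a flow with commuting increments
generates an algebra spanned by time-ordered products (`IsFlow.exists_mem_timeSpan_of_mem_adjoin`),
and the vectors which time-ordered products generate from `Ω` behave like elementary tensors.
Hence `T_γ Ω` converges for every net `T` of the algebra (`cauchySeq_netEval`). The limits `v(T)`
span `Dk`, the algebra acts by `π(T) v(T') = v(T T')`, and `k_{s,t}(c) = π(Θ_{s,t}(c))`. The
axioms of a Lévy process pass to the limit (`IsLimitRep.levy`).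

*Uniqueness.* For two cyclic Lévy processes with the same distributions, the pairs of their
increments form a flow in the product of the two operator algebras, and the two vacuum states agree
on the algebra it generates. So `T Ω₁ ↦ T' Ω₂` is a well-defined unitary
(`exists_linearIsometryEquiv`).

*The reverse transformation.* The composition of `κ` with `𝓣(ν)` is the projection `p` of the
induced tensor bialgebra onto `B`, a morphism of bialgebras. By the same estimates,
`‖ζ_α(b)‖²` and `⟨j_{s,t}(b) Ω, ζ_α(b)⟩` both tend to `e_⋆^{(t-s) ψ}(b* b) = ‖j_{s,t}(b) Ω‖²`
(`IsLimitRep.tendsto_stepConv`). Density of `Dk` follows by approximating the factors of a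
time-ordered product of increments of `j` one after the other.
-/

open WithConv

noncomputable section

namespace QLevy

/-! ### Convolution exponentials on coalgebras -/

section MatrixCoefficients

variable {K : Type*} [AddCommGroup K] [Module ℂ K] [Coalgebra ℂ K]

/-- The right translation `(id ⊗ f) ∘ Δ` of a coalgebra by a functional `f`. -/
def rightTranslate (f : K →ₗ[ℂ] ℂ) : K →ₗ[ℂ] K :=
  (TensorProduct.rid ℂ K).toLinearMap ∘ₗ f.lTensor K ∘ₗ Coalgebra.comul

lemma apply_rightTranslate (e f : K →ₗ[ℂ] ℂ) (x : K) :
    e (rightTranslate f x) = (toConv e * toConv f) x := by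
  simp only [rightTranslate, LinearMap.comp_apply, LinearMap.convMul_apply]
  generalize Coalgebra.comul (R := ℂ) x = z
  induction z with
  | zero => simp
  | add y z hy hz => simp only [map_add, hy, hz]
  | tmul y z => simp [mul_comm]

lemma convMul_apply_eq_left (e : K →ₗ[ℂ] ℂ) (x : K) :
    ∃ k : K, ∀ f : K →ₗ[ℂ] ℂ, (toConv e * toConv f) x = f k := by
  refine ⟨TensorProduct.lid ℂ K (e.rTensor K (Coalgebra.comul x)), fun f => ?_⟩
  simp only [LinearMap.convMul_apply]
  generalize Coalgebra.comul (R := ℂ) x = z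
  induction z with
  | zero => simp
  | add y z hy hz => simp only [map_add, hy, hz]
  | tmul y z => simp

/-- Local finiteness of coalgebras: every `x` is a matrix coefficient of a finite-dimensional
representation of the convolution algebra of functionals, whose entries are evaluations at
elements of the coalgebra. -/
lemma exists_matrix_coefficients {x : K} (hx : x ≠ 0) :
    ∃ (n : ℕ) (_ : Nonempty (Fin n)) (k : Fin n → Fin n → K)
      (M : WithConv (K →ₗ[ℂ] ℂ) →ₐ[ℂ] Matrix (Fin n) (Fin n) ℂ)
      (L : Matrix (Fin n) (Fin n) ℂ →ₗ[ℂ] ℂ),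
      (∀ f i j, M f i j = f (k i j)) ∧ ∀ f : WithConv (K →ₗ[ℂ] ℂ), f x = L (M f) := by
  classical
  -- the right coideal generated by `x`
  let R : (K →ₗ[ℂ] ℂ) →ₗ[ℂ] K :=
    { toFun := fun f => rightTranslate f x
      map_add' := fun f g => by simp [rightTranslate, LinearMap.lTensor_add]
      map_smul' := fun c f => by simp [rightTranslate, LinearMap.lTensor_smul] }
  let V := LinearMap.range R
  have hfin : FiniteDimensional ℂ V := by
    let r := Coalgebra.Repr.arbitrary ℂ x
    have hle : V ≤ Submodule.span ℂ ((r.index.image r.left : Finset K) : Set K) := by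
      rintro _ ⟨f, rfl⟩
      change rightTranslate f x ∈ _
      rw [rightTranslate, LinearMap.comp_apply, LinearMap.comp_apply, ← r.eq]
      simp only [map_sum, LinearMap.lTensor_tmul, LinearEquiv.coe_coe, TensorProduct.rid_tmul]
      exact Submodule.sum_mem _ fun i hi => Submodule.smul_mem _ _ (Submodule.subset_span
        (Finset.mem_coe.2 (Finset.mem_image_of_mem _ hi)))
    exact Submodule.finiteDimensional_of_le hle
  have hxV : x ∈ V := ⟨Coalgebra.counit, by
    change rightTranslate _ x = x
    simp [rightTranslate]⟩
  have hinv : ∀ (g : K →ₗ[ℂ] ℂ) (y : K), y ∈ V → rightTranslate g y ∈ V := by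
    rintro g _ ⟨f, rfl⟩
    refine ⟨(toConv g * toConv f).ofConv, ?_⟩
    change rightTranslate _ x = rightTranslate g (rightTranslate f x)
    rw [← sub_eq_zero]
    refine (Module.forall_dual_apply_eq_zero_iff ℂ _).1 fun e => ?_
    rw [map_sub, sub_eq_zero, apply_rightTranslate, apply_rightTranslate]
    have h2 := apply_rightTranslate (toConv e * toConv g).ofConv f x
    rw [toConv_ofConv, mul_assoc] at h2
    rw [toConv_ofConv, ← h2]
  have : Nontrivial V := ⟨⟨x, hxV⟩, 0, fun h => hx (congrArg Subtype.val h)⟩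
  let v := Module.finBasis ℂ V
  have hv : ∀ i, ∃ e : K →ₗ[ℂ] ℂ, e ∘ₗ V.subtype = v.coord i := fun i =>
    LinearMap.exists_extend (v.coord i)
  choose e he using hv
  have he' : ∀ i (y : V), e i y = v.repr y i := fun i y => by
    have := LinearMap.congr_fun (he i) y
    simpa using this
  have hexp : ∀ y : K, y ∈ V → y = ∑ l, e l y • (v l : K) := fun y hy => by
    have h1 := congrArg Subtype.val (v.sum_repr ⟨y, hy⟩)
    simp only [← he', Submodule.coe_sum, Submodule.coe_smul] at h1
    exact h1.symm
  choose k hk using fun i j => convMul_apply_eq_left (e i) (v j : K)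
  refine ⟨Module.finrank ℂ V, ⟨⟨0, Module.finrank_pos⟩⟩, k, AlgHom.ofLinearMap
    { toFun := fun f => Matrix.of fun i j => f (k i j)
      map_add' := fun f g => by ext; simp
      map_smul' := fun c f => by ext; simp } ?_ ?_,
    ∑ i, ∑ j, (Coalgebra.counit (R := ℂ) (v i : K) * e j x) • Matrix.entryLinearMap ℂ ℂ i j, ?_, ?_⟩
  · ext i j
    simp only [LinearMap.coe_mk, AddHom.coe_mk, Matrix.of_apply]
    have h1 := hk i j (1 : WithConv (K →ₗ[ℂ] ℂ)).ofConv
    rw [toConv_ofConv, mul_one] at h1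
    rw [← show _ = (1 : WithConv (K →ₗ[ℂ] ℂ)) (k i j) from h1, Matrix.one_apply]
    change e i (v j) = _
    rw [he', v.repr_self, Finsupp.single_apply]
    simp [eq_comm]
  · intro f g
    ext i j
    simp only [LinearMap.coe_mk, AddHom.coe_mk, Matrix.of_apply, Matrix.mul_apply]
    have h1 := hk i j (f * g).ofConv
    rw [toConv_ofConv, ← mul_assoc] at h1
    rw [← show _ = (f * g) (k i j) from h1]
    have h2 := apply_rightTranslate (toConv (e i) * f).ofConv g.ofConv (v j : K)
    rw [toConv_ofConv, toConv_ofConv] at h2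
    rw [← h2]
    have h3 := hexp _ (hinv g.ofConv _ (v j).2)
    rw [h3]
    simp only [map_sum, map_smul, smul_eq_mul]
    refine Finset.sum_congr rfl fun l _ => ?_
    rw [apply_rightTranslate, hk, mul_comm]
    congr 1
    exact hk i l f.ofConv
  · intro f i j
    rfl
  · intro f
    have h1 := apply_rightTranslate Coalgebra.counit f.ofConv x
    have h4 : toConv (Coalgebra.counit (R := ℂ) (A := K)) = (1 : WithConv (K →ₗ[ℂ] ℂ)) := rfl
    rw [h4, one_mul, toConv_ofConv] at h1
    rw [← h1]
    conv_lhs => rw [hexp _ (hinv f.ofConv _ hxV)]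
    simp only [map_sum, map_smul, smul_eq_mul, LinearMap.sum_apply, LinearMap.smul_apply]
    refine Finset.sum_congr rfl fun i _ => ?_
    have h5 : e i (rightTranslate f.ofConv x) = ∑ j, e j x * f (k i j) := by
      conv_lhs => rw [hexp x hxV]
      simp only [map_sum, map_smul, smul_eq_mul, apply_rightTranslate, hk]
    rw [h5, Finset.sum_mul]
    refine Finset.sum_congr rfl fun j _ => ?_
    simp only [Matrix.entryLinearMap_apply, AlgHom.ofLinearMap_apply, LinearMap.coe_mk,
      AddHom.coe_mk, Matrix.of_apply]
    ring

/-- The matrix coefficients of `exists_matrix_coefficients`, with the matrices regarded as a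
finite-dimensional Banach algebra `R`. -/
lemma exists_banach_representation {x : K} (hx : x ≠ 0) :
    ∃ (R : Type) (_ : NormedRing R) (_ : NormedAlgebra ℂ R) (_ : NormOneClass R)
      (_ : FiniteDimensional ℂ R) (ι : Type) (_ : Fintype ι) (k : ι → K) (v : Module.Basis ι ℂ R)
      (M : WithConv (K →ₗ[ℂ] ℂ) →ₐ[ℂ] R) (L : R →ₗ[ℂ] ℂ),
      (∀ f i, v.coord i (M f) = f (k i)) ∧ ∀ f : WithConv (K →ₗ[ℂ] ℂ), f x = L (M f) := by
  obtain ⟨n, _, k, M, L, hk, hL⟩ := exists_matrix_coefficients hx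
  refine ⟨Matrix (Fin n) (Fin n) ℂ, Matrix.linftyOpNormedRing, Matrix.linftyOpNormedAlgebra,
    Matrix.linfty_opNormOneClass, inferInstance, Fin n × Fin n, inferInstance,
    fun p => k p.1 p.2, Matrix.stdBasis ℂ (Fin n) (Fin n), M, L, fun f p => ?_, hL⟩
  rw [← hk]
  rfl

end MatrixCoefficients

section BanachAlgebra

variable {R : Type*} [NormedRing R] [NormedAlgebra ℂ R] [CompleteSpace R] [NormOneClass R]

lemma norm_exp_le_exp_norm (X : R) : ‖NormedSpace.exp X‖ ≤ Real.exp ‖X‖ := by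
  have h1 := NormedSpace.exp_series_hasSum_exp' (𝕂 := ℂ) X
  have h2 := NormedSpace.exp_series_hasSum_exp' (𝕂 := ℝ) ‖X‖
  rw [← Real.exp_eq_exp_ℝ] at h2
  refine h1.norm_le_of_bounded h2 fun n => ?_
  rw [norm_smul, norm_inv, smul_eq_mul]
  have := norm_pow_le X n
  simp only [RCLike.norm_natCast]
  gcongr

lemma norm_exp_sub_one_sub_le (X : R) :
    ‖NormedSpace.exp X - 1 - X‖ ≤ ‖X‖ ^ 2 * Real.exp ‖X‖ := by
  have h1 := NormedSpace.exp_series_hasSum_exp' (𝕂 := ℂ) X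
  have h2 := (NormedSpace.exp_series_hasSum_exp' (𝕂 := ℝ) ‖X‖).mul_left (‖X‖ ^ 2)
  rw [← Real.exp_eq_exp_ℝ] at h2
  have h3 := (hasSum_nat_add_iff' 2).2 h1
  simp only [Finset.sum_range_succ, Finset.sum_range_zero, zero_add, Nat.factorial_zero,
    Nat.factorial_one, Nat.cast_one, inv_one, one_smul, pow_zero, pow_one, ← sub_sub] at h3
  refine h3.norm_le_of_bounded h2 fun n => ?_
  rw [norm_smul, norm_inv, smul_eq_mul]
  have h4 := norm_pow_le X (n + 2)
  simp only [RCLike.norm_natCast]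
  have h5 : ((n + 2).factorial : ℝ)⁻¹ ≤ (n.factorial : ℝ)⁻¹ := by
    gcongr
    omega
  calc _ ≤ (n.factorial : ℝ)⁻¹ * ‖X‖ ^ (n + 2) := by gcongr
    _ = _ := by ring

/-- A product of factors which agree with `exp (h A)` up to `O(h ^ 2)` agrees with the exponential
of the total time up to a multiple of the sum of the squares. -/
lemma norm_list_prod_sub_exp_le (A : R) {c T : ℝ} (hc : 0 ≤ c) (l : List (ℝ × R))
    (hl : ∀ p ∈ l, 0 ≤ p.1 ∧ p.1 ≤ T ∧ ‖p.2 - NormedSpace.exp ((p.1 : ℂ) • A)‖ ≤ c * p.1 ^ 2) :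
    ‖(l.map (·.2)).prod‖ ≤ Real.exp ((‖A‖ + c * T) * (l.map (·.1)).sum) ∧
    ‖(l.map (·.2)).prod - NormedSpace.exp (((l.map (·.1)).sum : ℂ) • A)‖ ≤
      c * Real.exp ((‖A‖ + c * T) * (l.map (·.1)).sum) * (l.map (·.1 ^ 2)).sum := by
  induction l with
  | nil => simp
  | cons p l ih =>
    obtain ⟨ih1, ih2⟩ := ih fun q hq => hl q (List.mem_cons_of_mem _ hq)
    obtain ⟨h0, hT, hp⟩ := hl p List.mem_cons_self
    simp only [List.map_cons, List.prod_cons, List.sum_cons]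
    set S := (l.map (·.1)).sum
    set Q := (l.map (·.1 ^ 2)).sum
    set P := (l.map (·.2)).prod
    set m := ‖A‖ + c * T
    have hS : (((l.map fun p => (p.1 : ℂ)).sum : ℂ)) = (S : ℂ) := by
      simp only [S]
      clear * -
      induction l with
      | nil => simp
      | cons p l ih => simp [ih]
    have hQ : 0 ≤ Q := List.sum_nonneg fun y hy => by
      obtain ⟨q, _, rfl⟩ := List.mem_map.1 hy
      positivity
    have he : ‖NormedSpace.exp ((p.1 : ℂ) • A)‖ ≤ Real.exp (‖A‖ * p.1) := by
      refine (norm_exp_le_exp_norm _).trans (le_of_eq ?_)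
      rw [norm_smul, Complex.norm_real, Real.norm_of_nonneg h0, mul_comm]
    have hnn : 0 ≤ c * p.1 ^ 2 := by positivity
    -- hence every factor has norm at most `exp (m h)`, and the errors can be summed up
    have hf : Real.exp (‖A‖ * p.1) + c * p.1 ^ 2 ≤ Real.exp (m * p.1) := by
      have h1 : m * p.1 = ‖A‖ * p.1 + c * T * p.1 := by ring
      rw [h1, Real.exp_add]
      have h2 := Real.add_one_le_exp (c * T * p.1)
      have h3 : 1 ≤ Real.exp (‖A‖ * p.1) := Real.one_le_exp (by positivity)
      have h4 : c * p.1 ^ 2 ≤ c * T * p.1 := by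
        have : c * p.1 ^ 2 = c * p.1 * p.1 := by ring
        rw [this]; gcongr
      nlinarith
    have hpn : ‖p.2‖ ≤ Real.exp (m * p.1) := by
      have := norm_add_le (p.2 - NormedSpace.exp ((p.1 : ℂ) • A)) (NormedSpace.exp ((p.1 : ℂ) • A))
      rw [sub_add_cancel] at this
      linarith
    have hem : Real.exp (‖A‖ * p.1) ≤ Real.exp (m * p.1) := by linarith
    have h1m : 1 ≤ Real.exp (m * p.1) := (Real.one_le_exp (by positivity)).trans hem
    rw [mul_add, Real.exp_add]
    constructor
    · calc ‖p.2 * P‖ ≤ ‖p.2‖ * ‖P‖ := norm_mul_le _ _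
        _ ≤ _ := by gcongr
    · have hcomm : Commute ((p.1 : ℂ) • A) ((S : ℂ) • A) :=
        ((Commute.refl A).smul_left _).smul_right _
      let _ : NormedAlgebra ℚ R := NormedAlgebra.restrictScalars ℚ ℂ R
      rw [hS] at ih2 ⊢
      rw [add_smul, NormedSpace.exp_add_of_commute hcomm]
      have hdec : p.2 * P - NormedSpace.exp ((p.1 : ℂ) • A) * NormedSpace.exp ((S : ℂ) • A) =
          (p.2 - NormedSpace.exp ((p.1 : ℂ) • A)) * P +
            NormedSpace.exp ((p.1 : ℂ) • A) * (P - NormedSpace.exp ((S : ℂ) • A)) := by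
        noncomm_ring
      rw [hdec]
      calc _ ≤ ‖p.2 - NormedSpace.exp ((p.1 : ℂ) • A)‖ * ‖P‖ +
            ‖NormedSpace.exp ((p.1 : ℂ) • A)‖ * ‖P - NormedSpace.exp ((S : ℂ) • A)‖ :=
            (norm_add_le _ _).trans (add_le_add (norm_mul_le _ _) (norm_mul_le _ _))
        _ ≤ c * p.1 ^ 2 * Real.exp (m * S) +
            Real.exp (m * p.1) * (c * Real.exp (m * S) * Q) := by gcongr; exact he.trans hem
        _ ≤ c * p.1 ^ 2 * (Real.exp (m * p.1) * Real.exp (m * S)) +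
            Real.exp (m * p.1) * (c * Real.exp (m * S) * Q) := by
            gcongr
            exact le_mul_of_one_le_left (Real.exp_nonneg _) h1m
        _ = _ := by ring

end BanachAlgebra

section ConvExp

variable {K : Type*} [AddCommGroup K] [Module ℂ K] [Coalgebra ℂ K]

section Representation

variable {R : Type*} [NormedRing R] [NormedAlgebra ℂ R] [FiniteDimensional ℂ R]

/-- In a finite-dimensional representation the convolution exponential series becomes the ordinary
exponential series. -/
lemma hasSum_apply_exp (M : WithConv (K →ₗ[ℂ] ℂ) →ₐ[ℂ] R) (L : R →ₗ[ℂ] ℂ) (χ : K →ₗ[ℂ] ℂ)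
    (h : ℂ) :
    HasSum (fun m : ℕ => (h ^ m / (m.factorial : ℂ)) * L (M (toConv χ ^ m)))
      (L (NormedSpace.exp (h • M (toConv χ)))) := by
  have : CompleteSpace R := FiniteDimensional.complete ℂ R
  have h1 := NormedSpace.exp_series_hasSum_exp' (𝕂 := ℂ) (h • M (toConv χ))
  have h2 := h1.map L L.continuous_of_finiteDimensional
  convert h2 using 2 with m
  rw [Function.comp_apply, smul_pow, map_smul, map_smul, map_pow]
  simp only [smul_eq_mul]
  ring

end Representation

lemma summable_convExp (χ : K →ₗ[ℂ] ℂ) (h : ℂ) (x : K) :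
    Summable fun n : ℕ => (h ^ n / (n.factorial : ℂ)) * (toConv χ ^ n) x := by
  rcases eq_or_ne x 0 with rfl | hx
  · simp
  · obtain ⟨R, _, _, _, _, ι, _, k, v, M, L, hk, hL⟩ := exists_banach_representation hx
    simpa only [hL] using (hasSum_apply_exp M L χ h).summable

/-- The convolution exponential `e_⋆^{hχ}` of a functional on a coalgebra. The series converges
at every element, since the coalgebra is locally finite. -/
def convExp (χ : K →ₗ[ℂ] ℂ) (h : ℝ) : K →ₗ[ℂ] ℂ where
  toFun x := ∑' n : ℕ, ((h : ℂ) ^ n / (n.factorial : ℂ)) * (toConv χ ^ n) x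
  map_add' x y := by
    rw [← (summable_convExp χ h x).tsum_add (summable_convExp χ h y)]
    exact tsum_congr fun n => by rw [map_add, mul_add]
  map_smul' c x := by
    rw [RingHom.id_apply, smul_eq_mul, ← tsum_mul_left]
    exact tsum_congr fun n => by rw [map_smul, smul_eq_mul]; ring

lemma hasSum_convExp (χ : K →ₗ[ℂ] ℂ) (h : ℝ) (x : K) :
    HasSum (fun n : ℕ => ((h : ℂ) ^ n / (n.factorial : ℂ)) * (toConv χ ^ n) x) (convExp χ h x) :=
  (summable_convExp χ h x).hasSum

lemma apply_convExp {R : Type*} [NormedRing R] [NormedAlgebra ℂ R] [FiniteDimensional ℂ R]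
    {M : WithConv (K →ₗ[ℂ] ℂ) →ₐ[ℂ] R} {L : R →ₗ[ℂ] ℂ} {x : K}
    (hL : ∀ f : WithConv (K →ₗ[ℂ] ℂ), f x = L (M f)) (χ : K →ₗ[ℂ] ℂ) (h : ℝ) :
    convExp χ h x = L (NormedSpace.exp ((h : ℂ) • M (toConv χ))) := by
  have h1 := hasSum_convExp χ h x
  simp only [hL] at h1
  exact (hL (toConv (convExp χ h))).trans (h1.unique (hasSum_apply_exp M L χ h))

/-- `e_⋆^{hχ} = δ + hχ + O(h²)` pointwise. -/
lemma exists_convExp_bound (χ : K →ₗ[ℂ] ℂ) (T : ℝ) (x : K) :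
    ∃ c : ℝ, 0 ≤ c ∧ ∀ h : ℝ, 0 ≤ h → h ≤ T →
      ‖convExp χ h x - Coalgebra.counit (R := ℂ) x - h * χ x‖ ≤ c * h ^ 2 := by
  rcases eq_or_ne x 0 with rfl | hx
  · exact ⟨0, le_rfl, by simp⟩
  obtain ⟨R, _, _, _, _, ι, _, k, v, M, L, hk, hL⟩ := exists_banach_representation hx
  have : CompleteSpace R := FiniteDimensional.complete ℂ R
  let L' := LinearMap.toContinuousLinearMap L
  set A := M (toConv χ)
  refine ⟨‖L'‖ * (‖A‖ ^ 2 * Real.exp (T * ‖A‖)), by positivity, fun h h0 hT => ?_⟩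
  have h1 : Coalgebra.counit (R := ℂ) x = L 1 := by
    rw [← map_one M, ← hL]; rfl
  have h2 : χ x = L A := hL (toConv χ)
  have h3 : convExp χ h x - Coalgebra.counit (R := ℂ) x - h * χ x =
      L' (NormedSpace.exp ((h : ℂ) • A) - 1 - (h : ℂ) • A) := by
    rw [apply_convExp hL, h1, h2, map_sub, map_sub, map_smul, smul_eq_mul]
    rfl
  rw [h3]
  have hn : ‖(h : ℂ) • A‖ = h * ‖A‖ := by
    rw [norm_smul, Complex.norm_real, Real.norm_of_nonneg h0]
  calc _ ≤ ‖L'‖ * ‖NormedSpace.exp ((h : ℂ) • A) - 1 - (h : ℂ) • A‖ := L'.le_opNorm _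
    _ ≤ ‖L'‖ * ((h * ‖A‖) ^ 2 * Real.exp (h * ‖A‖)) := by
      gcongr
      exact (norm_exp_sub_one_sub_le _).trans (by rw [hn])
    _ ≤ ‖L'‖ * ((h * ‖A‖) ^ 2 * Real.exp (T * ‖A‖)) := by gcongr
    _ = _ := by ring

/-- Convolution products of functionals `f = δ + hχ + O(h²)` are approximated by `e_⋆^{hχ}` for the
total time `h`, uniformly in the functionals. -/
theorem exists_convProd_bound (χ : K →ₗ[ℂ] ℂ) (b : K → ℝ) (T : ℝ) (x : K) :
    ∃ c : ℝ, 0 ≤ c ∧ ∀ l : List (ℝ × (K →ₗ[ℂ] ℂ)),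
      (∀ p ∈ l, 0 ≤ p.1 ∧ ∀ y,
        ‖p.2 y - Coalgebra.counit (R := ℂ) y - p.1 * χ y‖ ≤ b y * p.1 ^ 2) →
      (l.map (·.1)).sum ≤ T →
      ‖(l.map fun p => toConv p.2).prod x - convExp χ (l.map (·.1)).sum x‖ ≤
        c * (l.map (·.1 ^ 2)).sum := by
  rcases eq_or_ne x 0 with rfl | hx
  · exact ⟨0, le_rfl, by simp⟩
  obtain ⟨R, _, _, _, _, ι, _, k, v, M, L, hk, hL⟩ := exists_banach_representation hx
  have : CompleteSpace R := FiniteDimensional.complete ℂ R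
  let L' := LinearMap.toContinuousLinearMap L
  set A := M (toConv χ) with hA
  choose d hd0 hd using fun y => exists_convExp_bound χ T y
  -- the entrywise bounds add up to a bound for the norms of the matrices
  let e : ℝ := ∑ i, ‖v i‖ * (|b (k i)| + d (k i))
  have he : 0 ≤ e := Finset.sum_nonneg fun i _ => mul_nonneg
    (norm_nonneg _) (add_nonneg (abs_nonneg _) (hd0 _))
  have hMexp : ∀ h : ℝ, M (toConv (convExp χ h)) = NormedSpace.exp ((h : ℂ) • A) := fun h => by
    refine v.ext_elem fun i => ?_
    rw [← v.coord_apply, ← v.coord_apply, hk]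
    exact apply_convExp (fun f => (hk f i).symm) χ h
  refine ⟨‖L'‖ * (e * Real.exp ((‖A‖ + e * T) * T)), by positivity, fun l hl hT => ?_⟩
  have hmem : ∀ p ∈ l, p.1 ≤ T := fun p hp =>
    (List.single_le_sum (by simpa using fun q f hq => (hl (q, f) hq).1) _
      (List.mem_map_of_mem hp)).trans hT
  have hS0 : 0 ≤ (l.map (·.1)).sum := List.sum_nonneg (by simpa using fun q f hq => (hl (q, f) hq).1)
  have hQ0 : 0 ≤ (l.map (·.1 ^ 2)).sum := List.sum_nonneg fun y hy => by
      obtain ⟨q, _, rfl⟩ := List.mem_map.1 hy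
      positivity
  have hT0 : 0 ≤ T := hS0.trans hT
  have key := (norm_list_prod_sub_exp_le A he (l.map fun p => (p.1, M (toConv p.2))) (T := T) (by
    intro q hq
    obtain ⟨p, hp, rfl⟩ := List.mem_map.1 hq
    refine ⟨(hl p hp).1, hmem p hp, ?_⟩
    simp only
    rw [← hMexp, ← map_sub, ← v.sum_repr (M (toConv p.2 - toConv (convExp χ p.1)))]
    refine (norm_sum_le _ _).trans ?_
    rw [Finset.sum_mul]
    refine Finset.sum_le_sum fun i _ => ?_
    rw [norm_smul, ← v.coord_apply, hk, mul_comm, mul_assoc]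
    gcongr
    have h2 := (hl p hp).2 (k i)
    have h3 := hd (k i) p.1 (hl p hp).1 (hmem p hp)
    have h4 : (toConv p.2 - toConv (convExp χ p.1)) (k i) =
      (p.2 (k i) - Coalgebra.counit (R := ℂ) (k i) - p.1 * χ (k i)) -
      (convExp χ p.1 (k i) - Coalgebra.counit (R := ℂ) (k i) - p.1 * χ (k i)) := by
      change p.2 _ - convExp χ p.1 _ = _
      ring
    rw [h4]
    refine (norm_sub_le _ _).trans ((add_le_add h2 h3).trans ?_)
    rw [add_mul]
    gcongr
    exact le_abs_self _)).2
  simp only [List.map_map, Function.comp_def] at key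
  have hprod : M (l.map fun p => toConv p.2).prod = (l.map fun p => M (toConv p.2)).prod := by
    rw [map_list_prod, List.map_map]; rfl
  have hsum : (l.map fun p => (p.1 : ℂ)).sum = ((l.map (·.1)).sum : ℝ) := by
    clear * -
    induction l with
    | nil => simp
    | cons p l ih => simp [ih]
  rw [hL, hprod, apply_convExp hL, ← map_sub]
  rw [hsum] at key
  calc _ ≤ ‖L'‖ * _ := L'.le_opNorm _
    _ ≤ ‖L'‖ * _ := mul_le_mul_of_nonneg_left key (norm_nonneg _)
    _ ≤ ‖L'‖ * (e * Real.exp ((‖A‖ + e * T) * T) * (l.map (·.1 ^ 2)).sum) := by gcongr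
    _ = _ := by ring

lemma tendsto_convExp_zero (χ : K →ₗ[ℂ] ℂ) (x : K) :
    Tendsto (fun t : ℝ≥0 => convExp χ t x) (𝓝 0) (𝓝 (Coalgebra.counit (R := ℂ) x)) := by
  obtain ⟨c, hc, h⟩ := exists_convExp_bound χ 1 x
  have h1 : Tendsto (fun t : ℝ≥0 => Coalgebra.counit (R := ℂ) x + ((t : ℝ) : ℂ) * χ x) (𝓝 0)
      (𝓝 (Coalgebra.counit (R := ℂ) x)) := by
    have : Continuous fun t : ℝ≥0 => Coalgebra.counit (R := ℂ) x + ((t : ℝ) : ℂ) * χ x := by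
      fun_prop
    simpa using this.tendsto 0
  have h2 : Tendsto (fun t : ℝ≥0 => c * (t : ℝ) ^ 2) (𝓝 0) (𝓝 0) := by
    have : Continuous fun t : ℝ≥0 => c * (t : ℝ) ^ 2 := by fun_prop
    simpa using this.tendsto 0
  have h3 : Tendsto (fun t : ℝ≥0 => convExp χ t x -
      (Coalgebra.counit (R := ℂ) x + ((t : ℝ) : ℂ) * χ x)) (𝓝 0) (𝓝 0) := by
    refine squeeze_zero_norm' ?_ h2
    filter_upwards [Iic_mem_nhds (zero_lt_one' ℝ≥0)] with t ht
    rw [← sub_sub]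
    exact h t t.2 (by exact_mod_cast ht)
  simpa using h3.add h1

/-- The convolution exponential is natural with respect to coalgebra morphisms. -/
lemma convExp_comp {K' : Type*} [AddCommGroup K'] [Module ℂ K'] [Coalgebra ℂ K']
    (q : K →ₗc[ℂ] K') (χ : K' →ₗ[ℂ] ℂ) (h : ℝ) (x : K) :
    convExp (χ ∘ₗ q.toLinearMap) h x = convExp χ h (q x) := by
  have h1 : ∀ n : ℕ, (toConv (χ ∘ₗ q.toLinearMap)) ^ n =
      toConv ((toConv χ ^ n).ofConv ∘ₗ q.toLinearMap) := fun n => by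
    induction n with
    | zero =>
      ext x
      simp
    | succ n ih =>
      rw [pow_succ, ih, pow_succ, LinearMap.convMul_comp_coalgHom_distrib]
  refine tsum_congr fun n => ?_
  rw [h1]
  rfl

end ConvExp

/-! ### Partitions of intervals -/

section PartitionCombinatorics

/-- `α` is (the set of points of) a partition of `[s, t]`. -/
def IsPartition (s t : ℝ≥0) (α : Finset ℝ≥0) : Prop := s ∈ α ∧ t ∈ α ∧ ∀ x ∈ α, s ≤ x ∧ x ≤ t

/-- The list of the pairs of consecutive points of a finite set of times. -/
def steps (α : Finset ℝ≥0) : List (ℝ≥0 × ℝ≥0) := (α.sort (· ≤ ·)).zip (α.sort (· ≤ ·)).tail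

lemma steps_singleton (s : ℝ≥0) : steps {s} = [] := by simp [steps]

lemma sort_eq_cons {r : ℝ≥0} {α : Finset ℝ≥0} (hr : r ∈ α) (h : ∀ x ∈ α, r ≤ x) :
    ∃ l, α.sort (· ≤ ·) = r :: l := by
  have h1 : α = insert r (α.erase r) := (Finset.insert_erase hr).symm
  rw [h1, Finset.sort_insert (· ≤ ·) (fun b hb => h b (Finset.mem_of_mem_erase hb))
    (Finset.notMem_erase r α)]
  exact ⟨_, rfl⟩

lemma steps_insert {s r : ℝ≥0} {α : Finset ℝ≥0} (hs : s < r) (hr : r ∈ α) (h : ∀ x ∈ α, r ≤ x) :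
    steps (insert s α) = (s, r) :: steps α := by
  obtain ⟨l, hl⟩ := sort_eq_cons hr h
  rw [steps, steps, Finset.sort_insert (· ≤ ·) (fun b hb => hs.le.trans (h b hb))
    (fun hmem => absurd (h s hmem) (not_le.2 hs)), hl]
  simp

lemma IsPartition.le {s t : ℝ≥0} {α : Finset ℝ≥0} (h : IsPartition s t α) : s ≤ t := (h.2.2 s h.1).2

/-- Partitions are built by adding points on the left. -/
lemma IsPartition.induct {t : ℝ≥0} {P : ℝ≥0 → Finset ℝ≥0 → Prop} (h0 : P t {t})
    (h1 : ∀ (s r : ℝ≥0) (α : Finset ℝ≥0), s < r → IsPartition r t α → P r α → P s (insert s α))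
    {s : ℝ≥0} {α : Finset ℝ≥0} (h : IsPartition s t α) : P s α := by
  induction α using Finset.induction_on_min generalizing s with
  | empty => simp [IsPartition] at h
  | insert a α ha ih =>
    have has : a = s := by
      refine le_antisymm ?_ (h.2.2 a (Finset.mem_insert_self _ _)).1
      rcases Finset.mem_insert.1 h.1 with rfl | hx
      · exact le_rfl
      · exact (ha s hx).le
    subst has
    rcases α.eq_empty_or_nonempty with rfl | hne
    · have : t = a := by simpa using h.2.1
      subst this
      simpa using h0
    · have htα : t ∈ α := by
        rcases Finset.mem_insert.1 h.2.1 with rfl | hx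
        · obtain ⟨x, hx⟩ := hne
          exact absurd (ha x hx) (not_lt.2 (h.2.2 x (Finset.mem_insert_of_mem hx)).2)
        · exact hx
      have hp : IsPartition (α.min' hne) t α :=
        ⟨α.min'_mem hne, htα, fun x hx => ⟨α.min'_le x hx,
          (h.2.2 x (Finset.mem_insert_of_mem hx)).2⟩⟩
      exact h1 a _ α (ha _ (α.min'_mem hne)) hp (ih hp)

lemma IsPartition.steps_insert {s r t : ℝ≥0} {α : Finset ℝ≥0} (hs : s < r)
    (h : IsPartition r t α) : steps (insert s α) = (s, r) :: steps α :=
  QLevy.steps_insert hs h.1 fun x hx => (h.2.2 x hx).1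

/-- A partition splits at each of its points. -/
lemma steps_split {s t r : ℝ≥0} {α : Finset ℝ≥0} (h : IsPartition s t α) (hr : r ∈ α) :
    steps α = steps (α.filter (· ≤ r)) ++ steps (α.filter (r ≤ ·)) := by
  revert hr
  refine IsPartition.induct (P := fun s α => r ∈ α → steps α =
    steps (α.filter (· ≤ r)) ++ steps (α.filter (r ≤ ·))) ?_ ?_ h
  · intro hr
    obtain rfl : r = t := by simpa using hr
    simp [Finset.filter_singleton, steps_singleton]
  · intro s q α hs hα ih hr
    have hsα : ∀ x ∈ α, s < x := fun x hx => hs.trans_le (hα.2.2 x hx).1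
    rcases Finset.mem_insert.1 hr with rfl | hr'
    · have h1 : (insert r α).filter (· ≤ r) = {r} := by
        ext x
        simp only [Finset.mem_filter, Finset.mem_insert, Finset.mem_singleton]
        exact ⟨fun hx => hx.1.elim id fun hx' => absurd (hsα x hx') (not_lt.2 hx.2),
          fun hx => ⟨Or.inl hx, hx.le⟩⟩
      have h2 : (insert r α).filter (r ≤ ·) = insert r α := by
        refine Finset.filter_true_of_mem fun x hx => ?_
        rcases Finset.mem_insert.1 hx with rfl | hx
        · exact le_rfl
        · exact (hsα x hx).le
      rw [h1, h2, steps_singleton, List.nil_append]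
    · have hsr : s < r := hsα r hr'
      have hqr : q ≤ r := (hα.2.2 r hr').1
      rw [Finset.filter_insert, if_pos hsr.le, Finset.filter_insert, if_neg (not_le.2 hsr),
        hα.steps_insert hs, QLevy.steps_insert (r := q) hs, ih hr', List.cons_append]
      · exact Finset.mem_filter.2 ⟨hα.1, hqr⟩
      · exact fun x hx => (hα.2.2 x (Finset.mem_filter.1 hx).1).1

/-- The partition of `[s, t]` cut out by a finite set of times. For `t < s` it is taken to be the
partition `{s}` of `[s, s]`. -/
def restr (γ : Finset ℝ≥0) (s t : ℝ≥0) : Finset ℝ≥0 :=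
  insert s (insert (max s t) (γ.filter fun x => s ≤ x ∧ x ≤ max s t))

lemma mem_restr {γ : Finset ℝ≥0} {s t x : ℝ≥0} (hst : s ≤ t) :
    x ∈ restr γ s t ↔ x = s ∨ x = t ∨ x ∈ γ ∧ s ≤ x ∧ x ≤ t := by
  simp [restr, max_eq_right hst]

lemma isPartition_restr (γ : Finset ℝ≥0) {s t : ℝ≥0} (hst : s ≤ t) :
    IsPartition s t (restr γ s t) := by
  refine ⟨(mem_restr hst).2 (Or.inl rfl), (mem_restr hst).2 (Or.inr (Or.inl rfl)), fun x hx => ?_⟩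
  rcases (mem_restr hst).1 hx with rfl | rfl | h
  · exact ⟨le_rfl, hst⟩
  · exact ⟨hst, le_rfl⟩
  · exact h.2

lemma restr_self (γ : Finset ℝ≥0) (s : ℝ≥0) : restr γ s s = {s} := by
  ext x
  rw [mem_restr le_rfl, Finset.mem_singleton]
  exact ⟨fun h => h.elim id fun h => h.elim id fun h => le_antisymm h.2.2 h.2.1, Or.inl⟩

lemma restr_of_lt (γ : Finset ℝ≥0) {s t : ℝ≥0} (h : t < s) : restr γ s t = {s} := by
  rw [← restr_self γ s, restr, restr, max_eq_left h.le, max_self]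

lemma IsPartition.restr_eq {s t : ℝ≥0} {α : Finset ℝ≥0} (h : IsPartition s t α) :
    restr α s t = α := by
  ext x
  rw [mem_restr h.le]
  constructor
  · rintro (rfl | rfl | h')
    exacts [h.1, h.2.1, h'.1]
  · exact fun hx => Or.inr (Or.inr ⟨hx, h.2.2 x hx⟩)

lemma steps_restr_split {γ : Finset ℝ≥0} {s r t : ℝ≥0} (hsr : s ≤ r) (hrt : r ≤ t) (hr : r ∈ γ) :
    steps (restr γ s t) = steps (restr γ s r) ++ steps (restr γ r t) := by
  have hst := hsr.trans hrt
  rw [steps_split (isPartition_restr γ hst) ((mem_restr hst).2 (Or.inr (Or.inr ⟨hr, hsr, hrt⟩)))]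
  congr 2
  · ext x
    rw [Finset.mem_filter, mem_restr hst, mem_restr hsr]
    constructor
    · rintro ⟨rfl | rfl | h, h'⟩
      exacts [Or.inl rfl, Or.inr (Or.inl (le_antisymm h' hrt)), Or.inr (Or.inr ⟨h.1, h.2.1, h'⟩)]
    · rintro (rfl | rfl | h)
      exacts [⟨Or.inl rfl, hsr⟩, ⟨Or.inr (Or.inr ⟨hr, hsr, hrt⟩), le_rfl⟩,
        ⟨Or.inr (Or.inr ⟨h.1, h.2.1, h.2.2.trans hrt⟩), h.2.2⟩]
  · ext x
    rw [Finset.mem_filter, mem_restr hst, mem_restr hrt]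
    constructor
    · rintro ⟨rfl | rfl | h, h'⟩
      exacts [Or.inl (le_antisymm hsr h'), Or.inr (Or.inl rfl), Or.inr (Or.inr ⟨h.1, h', h.2.2⟩)]
    · rintro (rfl | rfl | h)
      exacts [⟨Or.inr (Or.inr ⟨hr, hsr, hrt⟩), le_rfl⟩, ⟨Or.inr (Or.inl rfl), hrt⟩,
        ⟨Or.inr (Or.inr ⟨h.1, hsr.trans h.2.1, h.2.2⟩), h.2.1⟩]

/-- A partition refining `α` is composed of partitions of the steps of `α`. -/
lemma steps_restr_eq_flatMap {γ α : Finset ℝ≥0} {s t : ℝ≥0} (h : IsPartition s t α) (hα : α ⊆ γ) :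
    steps (restr γ s t) = (steps α).flatMap fun p => steps (restr γ p.1 p.2) := by
  revert hα
  refine IsPartition.induct (P := fun s α => α ⊆ γ →
    steps (restr γ s t) = (steps α).flatMap fun p => steps (restr γ p.1 p.2)) ?_ ?_ h
  · intro _
    rw [restr_self, steps_singleton, List.flatMap_nil]
  · intro s r α hs hα ih hsub
    have hsub' := (Finset.subset_insert _ _).trans hsub
    rw [hα.steps_insert hs, List.flatMap_cons, ← ih hsub',
      steps_restr_split hs.le hα.le (hsub' hα.1)]

lemma IsPartition.mem_steps {s t : ℝ≥0} {α : Finset ℝ≥0} (h : IsPartition s t α) :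
    ∀ p ∈ steps α, p.1 < p.2 ∧ s ≤ p.1 ∧ p.2 ≤ t ∧ ∀ x ∈ α, p.1 < x → p.2 ≤ x := by
  refine IsPartition.induct (P := fun s α => ∀ p ∈ steps α,
    p.1 < p.2 ∧ s ≤ p.1 ∧ p.2 ≤ t ∧ ∀ x ∈ α, p.1 < x → p.2 ≤ x) ?_ ?_ h
  · simp [steps_singleton]
  · intro s r α hs hα ih p hp
    rw [hα.steps_insert hs] at hp
    rcases List.mem_cons.1 hp with rfl | hp
    · refine ⟨hs, le_rfl, hα.le, fun x hx hx' => ?_⟩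
      rcases Finset.mem_insert.1 hx with rfl | hx
      · exact absurd hx' (lt_irrefl _)
      · exact (hα.2.2 x hx).1
    · obtain ⟨h1, h2, h3, h4⟩ := ih p hp
      refine ⟨h1, hs.le.trans h2, h3, fun x hx hx' => ?_⟩
      rcases Finset.mem_insert.1 hx with rfl | hx
      · exact absurd hx' (not_lt.2 (hs.le.trans h2))
      · exact h4 x hx hx'

lemma IsPartition.sum_steps {s t : ℝ≥0} {α : Finset ℝ≥0} (h : IsPartition s t α) :
    ((steps α).map fun p => (p.2 : ℝ) - p.1).sum = t - s := by
  refine IsPartition.induct (P := fun s α =>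
    ((steps α).map fun p => (p.2 : ℝ) - p.1).sum = t - s) ?_ ?_ h
  · simp [steps_singleton]
  · intro s r α hs hα ih
    rw [hα.steps_insert hs, List.map_cons, List.sum_cons, ih]
    ring

/-- The points of `γ` are `ε`-dense to the right in `[0, t)`. -/
def IsFine (ε : ℝ≥0) (t : ℝ≥0) (γ : Finset ℝ≥0) : Prop :=
  ∀ x < t, ∃ y ∈ γ, x < y ∧ y ≤ x + ε

lemma IsFine.mono {ε t : ℝ≥0} {γ γ' : Finset ℝ≥0} (h : γ ⊆ γ') (hγ : IsFine ε t γ) :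
    IsFine ε t γ' := fun x hx => by
  obtain ⟨y, hy, hxy⟩ := hγ x hx
  exact ⟨y, h hy, hxy⟩

lemma exists_isFine {ε : ℝ≥0} (hε : 0 < ε) (t : ℝ≥0) : ∃ γ, IsFine ε t γ := by
  refine ⟨(Finset.range (⌊t / ε⌋₊ + 2)).image fun k : ℕ => (k : ℝ≥0) * ε, fun x hx => ?_⟩
  refine ⟨((⌊x / ε⌋₊ + 1 : ℕ) : ℝ≥0) * ε, Finset.mem_image_of_mem _ (Finset.mem_range.2 ?_), ?_, ?_⟩
  · have : ⌊x / ε⌋₊ ≤ ⌊t / ε⌋₊ := Nat.floor_le_floor (by gcongr)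
    omega
  · rw [← div_lt_iff₀ hε]
    push_cast
    exact Nat.lt_floor_add_one _
  · push_cast
    rw [add_mul, one_mul]
    gcongr
    rw [← le_div_iff₀ hε]
    exact Nat.floor_le (by positivity)

lemma IsFine.sum_sq_steps_le {ε t : ℝ≥0} {γ : Finset ℝ≥0} (h : IsFine ε t γ) {s : ℝ≥0}
    (hst : s ≤ t) :
    ((steps (restr γ s t)).map fun p => ((p.2 : ℝ) - p.1) ^ 2).sum ≤ (ε : ℝ) * ((t : ℝ) - s) := by
  rw [← (isPartition_restr γ hst).sum_steps, ← List.sum_map_mul_left]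
  refine List.sum_le_sum fun p hp => ?_
  obtain ⟨h1, h2, h3, h4⟩ := (isPartition_restr γ hst).mem_steps p hp
  obtain ⟨y, hy, hy1, hy2⟩ := h p.1 (h1.trans_le h3)
  have h5 : p.2 ≤ p.1 + ε := by
    rcases le_total p.2 y with h6 | h6
    · exact h6.trans hy2
    · exact (h4 y ((mem_restr hst).2 (Or.inr (Or.inr ⟨hy, h2.trans hy1.le, h6.trans h3⟩)))
        hy1).trans hy2
  have h6 : (p.2 : ℝ) ≤ p.1 + ε := by exact_mod_cast h5
  have h7 : (p.1 : ℝ) < p.2 := by exact_mod_cast h1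
  rw [sq]
  exact mul_le_mul_of_nonneg_right (by linarith) (by linarith)

lemma IsPartition.sum_sq_steps_le {s t : ℝ≥0} {α : Finset ℝ≥0} (h : IsPartition s t α) :
    ((steps α).map fun p => ((p.2 : ℝ) - p.1) ^ 2).sum ≤ ((t : ℝ) - s) ^ 2 := by
  rw [sq ((t : ℝ) - s)]
  conv_rhs => rw [← h.sum_steps]
  rw [h.sum_steps, ← h.sum_steps, ← List.sum_map_mul_left, h.sum_steps]
  refine List.sum_le_sum fun p hp => ?_
  obtain ⟨h1, h2, h3, h4⟩ := h.mem_steps p hp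
  have h7 : (p.1 : ℝ) < p.2 := by exact_mod_cast h1
  have h2' : (s : ℝ) ≤ p.1 := by exact_mod_cast h2
  have h3' : (p.2 : ℝ) ≤ t := by exact_mod_cast h3
  rw [sq]
  exact mul_le_mul_of_nonneg_right (by linarith) (by linarith)

/-- The sum of the squared lengths of the steps tends to zero under refinement. -/
lemma tendsto_sum_sq_steps {s t : ℝ≥0} (hst : s ≤ t) :
    Tendsto (fun γ : Finset ℝ≥0 =>
      ((steps (restr γ s t)).map fun p => ((p.2 : ℝ) - p.1) ^ 2).sum) atTop (𝓝 0) := by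
  rw [Metric.tendsto_atTop]
  intro ε hε
  have h0 : (0 : ℝ) ≤ t - s := sub_nonneg.2 (by exact_mod_cast hst)
  have hη : 0 < Real.toNNReal (ε / ((t - s : ℝ) + 1)) := Real.toNNReal_pos.2 (by positivity)
  obtain ⟨γ₀, hγ₀⟩ := exists_isFine hη t
  refine ⟨γ₀, fun γ hγ => ?_⟩
  have h1 := (hγ₀.mono hγ).sum_sq_steps_le hst
  rw [Real.coe_toNNReal _ (by positivity)] at h1
  rw [Real.dist_eq, sub_zero, abs_of_nonneg]
  · refine h1.trans_lt ?_
    rw [div_mul_eq_mul_div, div_lt_iff₀ (by positivity)]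
    nlinarith
  · refine List.sum_nonneg fun y hy => ?_
    obtain ⟨q, _, rfl⟩ := List.mem_map.1 hy
    positivity

end PartitionCombinatorics

/-! ### Convolution products and time-ordered products -/

section Convolution

variable {C A A' : Type*} [AddCommGroup C] [Module ℂ C] [Coalgebra ℂ C] [Ring A] [Algebra ℂ A]
  [Ring A'] [Algebra ℂ A']

/-- A convolution product lies in a subspace as soon as the products of the values do. -/
lemma convMul_mem {V : Type*} [AddCommGroup V] [Module ℂ V] (P : Submodule ℂ V) (φ : A →ₗ[ℂ] V)
    {f g : C →ₗ[ℂ] A} (h : ∀ x y, φ (f x * g y) ∈ P) (c : C) :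
    φ ((toConv f * toConv g) c) ∈ P := by
  rw [LinearMap.convMul_apply]
  generalize Coalgebra.comul (R := ℂ) c = z
  induction z with
  | zero => simp
  | add y z hy hz => simpa only [map_add] using P.add_mem hy hz
  | tmul y z => simpa using h y z

lemma toConv_comp_convMul (π : A →ₐ[ℂ] A') (f g : WithConv (C →ₗ[ℂ] A)) :
    toConv (π.toLinearMap ∘ₗ (f * g).ofConv) =
      toConv (π.toLinearMap ∘ₗ f.ofConv) * toConv (π.toLinearMap ∘ₗ g.ofConv) := by
  rw [LinearMap.algHom_comp_convMul_distrib]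

lemma toConv_comp_convOne (π : A →ₐ[ℂ] A') :
    toConv (π.toLinearMap ∘ₗ (1 : WithConv (C →ₗ[ℂ] A)).ofConv) = 1 := by
  ext c
  simp

lemma toConv_comp_list_prod (π : A →ₐ[ℂ] A') (l : List (WithConv (C →ₗ[ℂ] A))) :
    toConv (π.toLinearMap ∘ₗ l.prod.ofConv) =
      (l.map fun f => toConv (π.toLinearMap ∘ₗ f.ofConv)).prod := by
  induction l with
  | nil => exact toConv_comp_convOne π
  | cons f l ih => rw [List.prod_cons, toConv_comp_convMul, ih, List.map_cons, List.prod_cons]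

end Convolution

section TimeOrdered

variable {C A : Type*} [AddCommGroup C] [Module ℂ C] [Ring A] [Algebra ℂ A]

/-- `x` is a time-ordered product `F_{t₀,t₁}(c₁) ⋯ F_{tₙ₋₁,tₙ}(cₙ)` with
`a = t₀ ≤ t₁ ≤ ⋯ ≤ tₙ ≤ e`. -/
inductive IsTimeOrdered (F : ℝ≥0 → ℝ≥0 → C →ₗ[ℂ] A) : ℝ≥0 → ℝ≥0 → A → Prop
  | one {a e : ℝ≥0} (h : a ≤ e) : IsTimeOrdered F a e 1
  | cons {a b e : ℝ≥0} {x : A} (h : a ≤ b) (c : C) (hx : IsTimeOrdered F b e x) :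
      IsTimeOrdered F a e (F a b c * x)

/-- The span of the time-ordered products over `[a, e]`. -/
def timeSpan (F : ℝ≥0 → ℝ≥0 → C →ₗ[ℂ] A) (a e : ℝ≥0) : Submodule ℂ A :=
  Submodule.span ℂ {x | IsTimeOrdered F a e x}

variable {F : ℝ≥0 → ℝ≥0 → C →ₗ[ℂ] A}

lemma IsTimeOrdered.le {a e : ℝ≥0} {x : A} (h : IsTimeOrdered F a e x) : a ≤ e := by
  induction h with
  | one h => exact h
  | cons h c hx ih => exact h.trans ih

lemma IsTimeOrdered.mem {a e : ℝ≥0} {x : A} (h : IsTimeOrdered F a e x) : x ∈ timeSpan F a e :=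
  Submodule.subset_span h

lemma one_mem_timeSpan {a e : ℝ≥0} (h : a ≤ e) : (1 : A) ∈ timeSpan F a e :=
  (IsTimeOrdered.one h).mem

lemma IsTimeOrdered.mono_right {a e e' : ℝ≥0} (he : e ≤ e') {x : A} (h : IsTimeOrdered F a e x) :
    IsTimeOrdered F a e' x := by
  induction h with
  | one h => exact .one (h.trans he)
  | cons h c hx ih => exact .cons h c (ih he)

lemma timeSpan_mono_right {a e e' : ℝ≥0} (he : e ≤ e') : timeSpan F a e ≤ timeSpan F a e' :=
  Submodule.span_mono fun _ hx => IsTimeOrdered.mono_right he hx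

lemma mul_mem_timeSpan_of_forall {P : Submodule ℂ A} {a e : ℝ≥0} {y : A}
    (h : ∀ x, IsTimeOrdered F a e x → y * x ∈ P) {x : A} (hx : x ∈ timeSpan F a e) : y * x ∈ P := by
  have : timeSpan F a e ≤ P.comap (LinearMap.mulLeft ℂ y) := Submodule.span_le.2 fun x hx => h x hx
  exact this hx

lemma cons_mem_timeSpan {a b e : ℝ≥0} (hab : a ≤ b) (c : C) {x : A} (hx : x ∈ timeSpan F b e) :
    F a b c * x ∈ timeSpan F a e :=
  mul_mem_timeSpan_of_forall (fun _ hx => (IsTimeOrdered.cons hab c hx).mem) hx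

lemma apply_mem_timeSpan {a b : ℝ≥0} (hab : a ≤ b) (c : C) : F a b c ∈ timeSpan F a b := by
  simpa using cons_mem_timeSpan hab c (one_mem_timeSpan (F := F) (le_refl b))

/-- The elements over disjoint intervals commute. -/
lemma commute_of_mem_timeSpan
    (hcomm : ∀ {r s t u : ℝ≥0}, r ≤ s → s ≤ t → t ≤ u → ∀ c c', Commute (F r s c) (F t u c'))
    {a b b' e : ℝ≥0} (hb : b ≤ b') {x y : A} (hx : x ∈ timeSpan F a b) (hy : y ∈ timeSpan F b' e) :
    Commute x y := by
  have key : ∀ x, IsTimeOrdered F a b x → ∀ y, IsTimeOrdered F b' e y → Commute x y := by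
    clear * - hcomm hb
    intro x hx y hy
    induction hx with
    | one h => exact Commute.one_left y
    | @cons a a₁ b x h c hx ih =>
      refine Commute.mul_left ?_ (ih hb)
      have h1 := hx.le.trans hb
      clear ih hx x hb
      induction hy with
      | one h => exact Commute.one_right _
      | @cons b' b'' e y h' c' hy ih' =>
        exact Commute.mul_right (hcomm h h1 h' c c') (ih' (h1.trans h'))
  have h1 : ∀ x, IsTimeOrdered F a b x → Commute x y := fun x hx => by
    induction hy using Submodule.span_induction with
    | mem y hy => exact key x hx y hy
    | zero => exact Commute.zero_right _
    | add y z _ _ hy hz => exact hy.add_right hz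
    | smul r y _ hy => exact hy.smul_right r
  induction hx using Submodule.span_induction with
  | mem x hx => exact h1 x hx
  | zero => exact Commute.zero_left _
  | add y z _ _ hy hz => exact hy.add_left hz
  | smul r y _ hy => exact hy.smul_left r

end TimeOrdered

section Flow

variable {C A : Type*} [Ring C] [Bialgebra ℂ C] [Ring A] [Algebra ℂ A]

/-- A family of algebra homomorphisms whose values over consecutive intervals commute. -/
structure IsIndependentFamily (F : ℝ≥0 → ℝ≥0 → C →ₗ[ℂ] A) : Prop where
  map_one : ∀ {s t}, s ≤ t → F s t 1 = 1
  map_mul : ∀ {s t}, s ≤ t → ∀ x y, F s t (x * y) = F s t x * F s t y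
  commute : ∀ {r s t u : ℝ≥0}, r ≤ s → s ≤ t → t ≤ u → ∀ c c', Commute (F r s c) (F t u c')

/-- A family of algebra homomorphisms with commuting increments which satisfies
`F_{r,s} ⋆ F_{s,t} = F_{r,t}`. -/
structure IsFlow (F : ℝ≥0 → ℝ≥0 → C →ₗ[ℂ] A) : Prop extends IsIndependentFamily F where
  increments : ∀ {r s t : ℝ≥0}, r ≤ s → s ≤ t → toConv (F r s) * toConv (F s t) = toConv (F r t)

variable {F : ℝ≥0 → ℝ≥0 → C →ₗ[ℂ] A}

/-- A factor `F_{a',a}(1) = 1` may be inserted in front. -/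
lemma IsIndependentFamily.mono_left (hF : IsIndependentFamily F) {a a' e : ℝ≥0} (ha : a' ≤ a) :
    timeSpan F a e ≤ timeSpan F a' e := fun x hx => by
  have := cons_mem_timeSpan ha 1 hx
  rwa [hF.map_one ha, one_mul] at this

lemma IsIndependentFamily.mono (hF : IsIndependentFamily F) {a a' e e' : ℝ≥0} (ha : a' ≤ a)
    (he : e ≤ e') : timeSpan F a e ≤ timeSpan F a' e' :=
  (hF.mono_left ha).trans (timeSpan_mono_right he)

lemma IsIndependentFamily.concat_mem (hF : IsIndependentFamily F) {a b e : ℝ≥0} {x y : A}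
    (hx : x ∈ timeSpan F a b) (hy : y ∈ timeSpan F b e) : x * y ∈ timeSpan F a e := by
  induction hx using Submodule.span_induction with
  | mem x hx =>
    replace hx : IsTimeOrdered F a b x := hx
    induction hx with
    | one h => rw [one_mul]; exact hF.mono_left h hy
    | cons h c hx ih => rw [mul_assoc]; exact cons_mem_timeSpan h c (ih hy)
  | zero => rw [zero_mul]; exact zero_mem _
  | add x z _ _ hx hz => rw [add_mul]; exact add_mem hx hz
  | smul r x _ hx => rw [smul_mul_assoc]; exact Submodule.smul_mem _ _ hx

/-- Left multiplication with an increment preserves the span of the time-ordered products: the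
intervals are cut at the common end points. -/
lemma IsFlow.apply_mul_mem (hF : IsFlow F) {a e s t : ℝ≥0} (has : a ≤ s) (hst : s ≤ t) (hte : t ≤ e)
    (c : C) {x : A} (hx : x ∈ timeSpan F a e) : F s t c * x ∈ timeSpan F a e := by
  refine mul_mem_timeSpan_of_forall (fun x hx => ?_) hx
  clear * - hF hx has hst hte
  induction hx generalizing s c with
  | @one a e h =>
    rw [mul_one]
    exact hF.mono has hte (apply_mem_timeSpan hst c)
  | @cons a b e y hab c' hy ih =>
    -- `[s, t]` lies to the right of the first interval `[a, b]`
    rcases le_total b s with hbs | hsb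
    · rw [← mul_assoc, ← (hF.commute hab hbs hst c' c).eq, mul_assoc]
      exact cons_mem_timeSpan hab c' (ih hbs hst hte c)
    -- `[s, t]` is contained in `[a, b]`, which is cut at `s` and `t`
    rcases le_total t b with htb | hbt
    · have h1 : F a b c' = (toConv (F a s) * (toConv (F s t) * toConv (F t b))).ofConv c' := by
        rw [hF.increments hst htb, hF.increments has (hst.trans htb)]
      rw [h1]
      refine convMul_mem (timeSpan F a e) (LinearMap.mulLeft ℂ (F s t c) ∘ₗ LinearMap.mulRight ℂ y)
        (fun c1 c2 => ?_) c'
      simp only [LinearMap.comp_apply, LinearMap.mulLeft_apply, LinearMap.mulRight_apply]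
      rw [← mul_assoc, ← mul_assoc, ← (hF.commute has le_rfl hst c1 c).eq, mul_assoc, mul_assoc]
      refine cons_mem_timeSpan has c1 ?_
      refine convMul_mem (timeSpan F s e) (LinearMap.mulLeft ℂ (F s t c) ∘ₗ LinearMap.mulRight ℂ y)
        (fun c2 c3 => ?_) c2
      simp only [LinearMap.comp_apply, LinearMap.mulLeft_apply, LinearMap.mulRight_apply]
      rw [← mul_assoc, ← mul_assoc, ← hF.map_mul hst, mul_assoc]
      exact cons_mem_timeSpan hst _ (cons_mem_timeSpan htb _ hy.mem)
    -- `[a, b]` and `[s, t]` overlap in `[s, b]`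
    · have h1 : F a b c' = (toConv (F a s) * toConv (F s b)).ofConv c' := by
        rw [hF.increments has hsb]
      have h2 : F s t c = (toConv (F s b) * toConv (F b t)).ofConv c := by
        rw [hF.increments hsb hbt]
      rw [h1, h2]
      refine convMul_mem (timeSpan F a e) (LinearMap.mulRight ℂ _) (fun c1 c2 => ?_) c
      rw [LinearMap.mulRight_apply]
      refine convMul_mem (timeSpan F a e)
        (LinearMap.mulLeft ℂ (F s b c1 * F b t c2) ∘ₗ LinearMap.mulRight ℂ y)
        (fun c3 c4 => ?_) c'
      simp only [LinearMap.comp_apply, LinearMap.mulLeft_apply, LinearMap.mulRight_apply]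
      have h3 : F s b c1 * F b t c2 * (F a s c3 * F s b c4 * y) =
          F a s c3 * (F s b (c1 * c4) * (F b t c2 * y)) := by
        have e1 := (hF.commute has hsb hbt c3 c2).eq
        have e2 := (hF.commute hsb le_rfl hbt c4 c2).eq
        have e3 := (hF.commute has le_rfl hsb c3 c1).eq
        calc _ = F s b c1 * (F b t c2 * F a s c3) * F s b c4 * y := by noncomm_ring
          _ = (F s b c1 * F a s c3) * (F b t c2 * F s b c4) * y := by rw [← e1]; noncomm_ring
          _ = _ := by rw [← e3, ← e2, hF.map_mul hsb]; noncomm_ring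
      rw [h3]
      exact cons_mem_timeSpan has _ (cons_mem_timeSpan hsb _ (ih le_rfl hbt hte c2))

/-- The time-ordered products of a flow span a subalgebra. -/
lemma IsFlow.mul_mem (hF : IsFlow F) {a e : ℝ≥0} {x y : A} (hx : x ∈ timeSpan F a e)
    (hy : y ∈ timeSpan F a e) : x * y ∈ timeSpan F a e := by
  have key : ∀ b x, IsTimeOrdered F b e x → a ≤ b → x * y ∈ timeSpan F a e := by
    clear * - hF hy
    intro b x hx hab
    induction hx with
    | one h => rwa [one_mul]
    | cons h c hx ih =>
      rw [mul_assoc]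
      exact hF.apply_mul_mem hab h hx.le c (ih hy (hab.trans h))
  induction hx using Submodule.span_induction with
  | mem x hx => exact key a x hx le_rfl
  | zero => rw [zero_mul]; exact zero_mem _
  | add x z _ _ hx hz => rw [add_mul]; exact add_mem hx hz
  | smul r x _ hx => rw [smul_mul_assoc]; exact Submodule.smul_mem _ _ hx

lemma IsFlow.apply_mem (hF : IsFlow F) {a e s t : ℝ≥0} (has : a ≤ s) (hst : s ≤ t) (hte : t ≤ e)
    (c : C) : F s t c ∈ timeSpan F a e :=
  hF.mono has hte (apply_mem_timeSpan hst c)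

lemma IsFlow.star_mem [StarRing A] [StarModule ℂ A] [StarRing C] (hF : IsFlow F)
    (hstar : ∀ {s t}, s ≤ t → ∀ c, F s t (star c) = star (F s t c)) {a e : ℝ≥0} {x : A}
    (hx : x ∈ timeSpan F a e) : star x ∈ timeSpan F a e := by
  induction hx using Submodule.span_induction with
  | mem x hx =>
    replace hx : IsTimeOrdered F a e x := hx
    induction hx with
    | one h => rw [star_one]; exact one_mem_timeSpan h
    | cons h c hx ih =>
      rw [star_mul, ← hstar h]
      exact hF.mul_mem (hF.mono_left h ih) (hF.apply_mem le_rfl h hx.le _)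
  | zero => rw [star_zero]; exact zero_mem _
  | add x z _ _ hx hz => rw [star_add]; exact add_mem hx hz
  | smul r x _ hx => rw [star_smul]; exact Submodule.smul_mem _ _ hx

/-- The elements generated by the increments are spanned by the time-ordered products. -/
lemma IsFlow.exists_mem_timeSpan_of_mem_adjoin (hF : IsFlow F) {x : A}
    (hx : x ∈ Algebra.adjoin ℂ {y | ∃ (s t : ℝ≥0) (c : C), s ≤ t ∧ y = F s t c}) :
    ∃ e, x ∈ timeSpan F 0 e := by
  induction hx using Algebra.adjoin_induction with
  | mem x hx =>
    obtain ⟨s, t, c, hst, rfl⟩ := hx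
    exact ⟨t, hF.apply_mem zero_le hst le_rfl c⟩
  | algebraMap r =>
    refine ⟨0, ?_⟩
    rw [Algebra.algebraMap_eq_smul_one]
    exact Submodule.smul_mem _ _ (one_mem_timeSpan le_rfl)
  | add x y _ _ hx hy =>
    obtain ⟨e, hx⟩ := hx
    obtain ⟨e', hy⟩ := hy
    exact ⟨max e e', add_mem (timeSpan_mono_right (le_max_left _ _) hx)
      (timeSpan_mono_right (le_max_right _ _) hy)⟩
  | mul x y _ _ hx hy =>
    obtain ⟨e, hx⟩ := hx
    obtain ⟨e', hy⟩ := hy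
    exact ⟨max e e', hF.mul_mem (timeSpan_mono_right (le_max_left _ _) hx)
      (timeSpan_mono_right (le_max_right _ _) hy)⟩

end Flow

/-! ### Independence of the increments of a Lévy process -/

section Independence

variable {B : Type*} [Ring B] [StarRing B] [Bialgebra ℂ B]
variable {D : Type*} [NormedAddCommGroup D] [InnerProductSpace ℂ D]

lemma vacuum_apply (Ω : D) (T : La D) : vacuum Ω T = inner ℂ Ω (T.1 Ω) := rfl

lemma La.mul_apply (T S : La D) (x : D) : (T * S).1 x = T.1 (S.1 x) := rfl

lemma vacuum_star_mul (Ω : D) (T S : La D) : vacuum Ω (star T * S) = inner ℂ (T.1 Ω) (S.1 Ω) := by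
  rw [vacuum_apply, La.mul_apply, La.inner_star_right]

lemma vacuum_one {Ω : D} (h : ‖Ω‖ = 1) : vacuum Ω 1 = 1 := by
  rw [vacuum_apply]
  change inner ℂ Ω Ω = 1
  rw [inner_self_eq_norm_sq_to_K, h]
  norm_num

@[simp] lemma lin_apply {A A' : Type*} [Ring A] [Algebra ℂ A] [Star A] [Ring A'] [Algebra ℂ A']
    [Star A'] (f : A →⋆ₐ[ℂ] A') (x : A) : lin f x = f x := rfl

variable {Ω : D} {j : ℝ≥0 → ℝ≥0 → B →⋆ₐ[ℂ] La D}

lemma disjoint_Ioc_of_le {s t u v : ℝ≥0} (h : t ≤ u) : Disjoint (Set.Ioc s t) (Set.Ioc u v) :=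
  Set.disjoint_left.2 fun _ hx hy => absurd (hx.2.trans h) (not_le.2 hy.1)

lemma IsLevyProcess.isFlow (hj : IsLevyProcess Ω j) : IsFlow fun s t => lin (j s t) where
  map_one _ := by simp
  map_mul _ x y := by simp
  commute h1 h2 h3 c c' := hj.commutes _ _ _ _ h1 h3 (disjoint_Ioc_of_le h2) c c'
  increments h1 h2 := hj.increments _ _ _ h1 h2

lemma IsLevyProcess.star_mem (hj : IsLevyProcess Ω j) {a e : ℝ≥0} {x : La D}
    (hx : x ∈ timeSpan (fun s t => lin (j s t)) a e) :
    star x ∈ timeSpan (fun s t => lin (j s t)) a e :=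
  hj.isFlow.star_mem (fun _ c => by simp [map_star]) hx

lemma list_map_eq_ofFn {X Y : Type*} (l : List X) (g : X → Y) :
    l.map g = List.ofFn fun i => g (l.get i) := by
  conv_lhs => rw [← List.ofFn_get l, List.map_ofFn]
  rfl

lemma IsLevyProcess.vacuum_list_prod (hj : IsLevyProcess Ω j) (l : List (ℝ≥0 × ℝ≥0 × B))
    (hl : ∀ p ∈ l, p.1 ≤ p.2.1)
    (hd : (l.map fun p => Set.Ioc p.1 p.2.1).Pairwise Disjoint) :
    vacuum Ω (l.map fun p => j p.1 p.2.1 p.2.2).prod =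
      (l.map fun p => vacuum Ω (j p.1 p.2.1 p.2.2)).prod := by
  have h1 := hj.factorizes l.length (fun i => (l.get i).1) (fun i => (l.get i).2.1)
    (fun i => (l.get i).2.2) (fun i => hl _ (List.get_mem _ _)) (by
      have h2 := List.pairwise_iff_get.1 (List.pairwise_map.1 hd)
      intro i k hik
      rcases lt_or_gt_of_ne hik with h | h
      · exact h2 i k h
      · exact (h2 k i h).symm)
  rw [list_map_eq_ofFn, h1, list_map_eq_ofFn, List.prod_ofFn]
  rfl

/-- A time-ordered product, as the list of its increments with their intervals. -/
lemma IsTimeOrdered.exists_list {a e : ℝ≥0} {x : La D}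
    (h : IsTimeOrdered (fun s t => lin (j s t)) a e x) :
    ∃ l : List (ℝ≥0 × ℝ≥0 × B), (∀ p ∈ l, p.1 ≤ p.2.1) ∧
      (∀ p ∈ l, Set.Ioc p.1 p.2.1 ⊆ Set.Ioc a e) ∧
      (l.map fun p => Set.Ioc p.1 p.2.1).Pairwise Disjoint ∧
      x = (l.map fun p => j p.1 p.2.1 p.2.2).prod := by
  induction h with
  | one h => exact ⟨[], by simp⟩
  | @cons a b e x hab c hx ih =>
    obtain ⟨l, h1, h2, h3, rfl⟩ := ih
    refine ⟨(a, b, c) :: l, ?_, ?_, ?_, by simp⟩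
    · simpa using ⟨hab, fun p q b h => h1 (p, q, b) h⟩
    · intro p hp
      rcases List.mem_cons.1 hp with rfl | hp
      · exact Set.Ioc_subset_Ioc_right hx.le
      · exact (h2 p hp).trans (Set.Ioc_subset_Ioc_left hab)
    · rw [List.map_cons, List.pairwise_cons]
      refine ⟨fun I hI => ?_, h3⟩
      obtain ⟨p, hp, rfl⟩ := List.mem_map.1 hI
      exact (disjoint_Ioc_of_le (le_refl b)).mono_right (h2 p hp)

/-- The vacuum state factorizes over elements which belong to pairwise disjoint intervals. -/
lemma IsLevyProcess.vacuum_prod_of_mem (hj : IsLevyProcess Ω j) (m : List (ℝ≥0 × ℝ≥0 × La D))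
    (hm : ∀ p ∈ m, p.2.2 ∈ timeSpan (fun s t => lin (j s t)) p.1 p.2.1)
    (hd : (m.map fun p => Set.Ioc p.1 p.2.1).Pairwise Disjoint) :
    vacuum Ω (m.map fun p => p.2.2).prod = (m.map fun p => vacuum Ω p.2.2).prod := by
  -- the elements of `m` are expanded one by one into increments, which are collected in `l`
  suffices h : ∀ l : List (ℝ≥0 × ℝ≥0 × B), (∀ p ∈ l, p.1 ≤ p.2.1) →
      ((l.map fun p => Set.Ioc p.1 p.2.1) ++ m.map fun p => Set.Ioc p.1 p.2.1).Pairwise Disjoint →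
      vacuum Ω ((l.map fun p => j p.1 p.2.1 p.2.2).prod * (m.map fun p => p.2.2).prod) =
        (l.map fun p => vacuum Ω (j p.1 p.2.1 p.2.2)).prod *
          (m.map fun p => vacuum Ω p.2.2).prod by
    simpa using h [] (by simp) (by simpa using hd)
  clear hd
  induction m with
  | nil => intro l hl hd; simpa using hj.vacuum_list_prod l hl (by simpa using hd)
  | cons p m ih =>
    intro l hl hd
    have hm' := fun q hq => hm q (List.mem_cons_of_mem _ hq)
    have hp := hm p List.mem_cons_self
    obtain ⟨s, t, x⟩ := p
    simp only [List.map_cons, List.prod_cons] at hp ⊢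
    induction hp using Submodule.span_induction with
    | mem x hx =>
      obtain ⟨l', h1, h2, h3, rfl⟩ := IsTimeOrdered.exists_list hx
      rw [List.map_cons] at hd
      have hd' := List.pairwise_append.1 hd
      have hd'' := List.pairwise_cons.1 hd'.2.1
      have h4 := ih hm' (l ++ l') (fun p hp => (List.mem_append.1 hp).elim (hl p) (h1 p)) (by
        rw [List.map_append, List.append_assoc, List.pairwise_append]
        refine ⟨hd'.1, List.pairwise_append.2 ⟨h3, hd''.2, fun I hI J hJ => ?_⟩,
          fun I hI J hJ => ?_⟩
        · obtain ⟨p, hp, rfl⟩ := List.mem_map.1 hI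
          exact (hd''.1 J hJ).mono_left (h2 p hp)
        · rcases List.mem_append.1 hJ with hJ | hJ
          · obtain ⟨p, hp, rfl⟩ := List.mem_map.1 hJ
            exact (hd'.2.2 I hI _ List.mem_cons_self).mono_right (h2 p hp)
          · exact hd'.2.2 I hI J (List.mem_cons_of_mem _ hJ))
      rw [List.map_append, List.prod_append, List.map_append, List.prod_append, mul_assoc,
        mul_assoc] at h4
      rw [h4, hj.vacuum_list_prod l' h1 h3]
    | zero => simp
    | add x y _ _ hx hy =>
      rw [add_mul, mul_add, map_add, hx, hy, map_add]
      · ring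
      · exact fun p hp => (List.mem_cons.1 hp).elim (fun h => by subst h; assumption) (hm' p)
      · simpa using hd
      · exact fun p hp => (List.mem_cons.1 hp).elim (fun h => by subst h; assumption) (hm' p)
      · simpa using hd
    | smul r x _ hx =>
      rw [smul_mul_assoc, mul_smul_comm, map_smul, hx, map_smul, smul_eq_mul, smul_eq_mul]
      · ring
      · exact fun p hp => (List.mem_cons.1 hp).elim (fun h => by subst h; assumption) (hm' p)
      · simpa using hd

lemma IsLevyProcess.vacuum_mul (hj : IsLevyProcess Ω j) {a b e : ℝ≥0} {x y : La D}
    (hx : x ∈ timeSpan (fun s t => lin (j s t)) a b)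
    (hy : y ∈ timeSpan (fun s t => lin (j s t)) b e) :
    vacuum Ω (x * y) = vacuum Ω x * vacuum Ω y := by
  simpa using hj.vacuum_prod_of_mem [(a, b, x), (b, e, y)] (by simp [hx, hy])
    (by simp)

lemma IsLevyProcess.commute_of_mem (hj : IsLevyProcess Ω j) {a b b' e : ℝ≥0} (hb : b ≤ b')
    {x y : La D} (hx : x ∈ timeSpan (fun s t => lin (j s t)) a b)
    (hy : y ∈ timeSpan (fun s t => lin (j s t)) b' e) : Commute x y :=
  commute_of_mem_timeSpan hj.isFlow.commute hb hx hy

/-- Vectors generated from the vacuum over consecutive intervals behave like tensor products. -/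
lemma IsLevyProcess.inner_mul_mul (hj : IsLevyProcess Ω j) {a b e : ℝ≥0} {x x' y y' : La D}
    (hx : x ∈ timeSpan (fun s t => lin (j s t)) a b)
    (hx' : x' ∈ timeSpan (fun s t => lin (j s t)) a b)
    (hy : y ∈ timeSpan (fun s t => lin (j s t)) b e)
    (hy' : y' ∈ timeSpan (fun s t => lin (j s t)) b e) :
    inner ℂ ((x * y).1 Ω) ((x' * y').1 Ω) =
      inner ℂ (x.1 Ω) (x'.1 Ω) * inner ℂ (y.1 Ω) (y'.1 Ω) := by
  simp only [← vacuum_star_mul, star_mul]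
  have h1 := (hj.commute_of_mem le_rfl (hj.isFlow.mul_mem (hj.star_mem hx) hx') (hj.star_mem hy)).eq
  rw [← hj.vacuum_mul (hj.isFlow.mul_mem (hj.star_mem hx) hx')
    (hj.isFlow.mul_mem (hj.star_mem hy) hy'), ← mul_assoc (star x * x'), h1]
  simp only [mul_assoc]

lemma IsLevyProcess.norm_mul (hj : IsLevyProcess Ω j) {a b e : ℝ≥0} {x y : La D}
    (hx : x ∈ timeSpan (fun s t => lin (j s t)) a b)
    (hy : y ∈ timeSpan (fun s t => lin (j s t)) b e) :
    ‖(x * y).1 Ω‖ = ‖x.1 Ω‖ * ‖y.1 Ω‖ := by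
  have h1 := hj.inner_mul_mul hx hx hy hy
  simp only [inner_self_eq_norm_sq_to_K] at h1
  norm_cast at h1
  rw [← mul_pow] at h1
  exact (pow_left_inj₀ (norm_nonneg _) (by positivity) two_ne_zero).1 h1

lemma IsLevyProcess.distr_eq (hj : IsLevyProcess Ω j) {ψ : B →ₗ[ℂ] ℂ} (hψ : HasGenerator Ω j ψ)
    {s t : ℝ≥0} (hst : s ≤ t) : distr Ω j s t = convExp ψ (t - s) := by
  rw [hj.stationary s t hst]
  ext b
  have h1 := hψ (t - s) b
  rw [NNReal.coe_sub hst] at h1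
  exact h1.unique (hasSum_convExp ψ _ b)

end Independence

section Pairing

variable {C C' A : Type*} [AddCommGroup C] [Module ℂ C] [AddCommGroup C'] [Module ℂ C'] [Ring A]
  [Algebra ℂ A]

/-- The map `x ⊗ y ↦ f(x) g(y)`. -/
def pairing (f : C →ₗ[ℂ] A) (g : C' →ₗ[ℂ] A) : C ⊗[ℂ] C' →ₗ[ℂ] A :=
  LinearMap.mul' ℂ A ∘ₗ TensorProduct.map f g

@[simp] lemma pairing_tmul (f : C →ₗ[ℂ] A) (g : C' →ₗ[ℂ] A) (x : C) (y : C') :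
    pairing f g (x ⊗ₜ y) = f x * g y := rfl

lemma pairing_mem {f : C →ₗ[ℂ] A} {g : C' →ₗ[ℂ] A} {P : Submodule ℂ A}
    (h : ∀ x y, f x * g y ∈ P) (z : C ⊗[ℂ] C') : pairing f g z ∈ P := by
  induction z with
  | zero => simp
  | add z w hz hw => simpa only [map_add] using add_mem hz hw
  | tmul x y => exact h x y

variable [Coalgebra ℂ C] [Coalgebra ℂ C']

lemma pairing_one :
    toConv (pairing (1 : WithConv (C →ₗ[ℂ] A)).ofConv (1 : WithConv (C' →ₗ[ℂ] A)).ofConv) = 1 := by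
  refine WithConv.ext (TensorProduct.ext' fun x y => ?_)
  simp [pairing, mul_comm]

/-- Convolution products with commuting factors are multiplied factor by factor. -/
lemma pairing_convMul {f₁ f₂ : C →ₗ[ℂ] A} {g₁ g₂ : C' →ₗ[ℂ] A}
    (h : ∀ x y, Commute (f₂ x) (g₁ y)) :
    toConv (pairing (toConv f₁ * toConv f₂).ofConv (toConv g₁ * toConv g₂).ofConv) =
      toConv (pairing f₁ g₁) * toConv (pairing f₂ g₂) := by
  refine WithConv.ext (TensorProduct.ext' fun x y => ?_)
  change (toConv f₁ * toConv f₂) x * (toConv g₁ * toConv g₂) y =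
    (toConv (pairing f₁ g₁) * toConv (pairing f₂ g₂)) (x ⊗ₜ y)
  simp only [LinearMap.convMul_apply, TensorProduct.comul_tmul]
  generalize Coalgebra.comul (R := ℂ) x = z
  generalize Coalgebra.comul (R := ℂ) y = w
  induction z with
  | zero => simp
  | add z z' hz hz' => simp only [map_add, TensorProduct.add_tmul, add_mul, hz, hz']
  | tmul z z' =>
    induction w with
    | zero => simp
    | add w w' hw hw' => simp only [map_add, TensorProduct.tmul_add, mul_add, hw, hw']
    | tmul w w' =>
      simp only [TensorProduct.map_tmul, LinearMap.mul'_apply,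
        TensorProduct.AlgebraTensorModule.tensorTensorTensorComm_tmul, pairing_tmul]
      rw [mul_assoc, ← mul_assoc (f₂ z'), (h z' w).eq]
      simp only [mul_assoc]

/-- A functional which factorizes over the values of `f` and `g` maps `f ⋆ g` to a convolution
product. -/
lemma comp_convMul_of_forall {φ : A →ₗ[ℂ] ℂ} {f g : C →ₗ[ℂ] A}
    (h : ∀ x y, φ (f x * g y) = φ (f x) * φ (g y)) :
    toConv (φ ∘ₗ (toConv f * toConv g).ofConv) = toConv (φ ∘ₗ f) * toConv (φ ∘ₗ g) := by
  ext c
  change φ ((toConv f * toConv g) c) = (toConv (φ ∘ₗ f) * toConv (φ ∘ₗ g)) c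
  simp only [LinearMap.convMul_apply]
  generalize Coalgebra.comul (R := ℂ) c = z
  induction z with
  | zero => simp
  | add y z hy hz => simp only [map_add, hy, hz]
  | tmul y z => simpa using h y z

/-- The convolution product of a family of linear maps over the steps of a partition. -/
def stepConv (F : ℝ≥0 → ℝ≥0 → C →ₗ[ℂ] A) (α : Finset ℝ≥0) : C →ₗ[ℂ] A :=
  ((steps α).map fun p => toConv (F p.1 p.2)).prod.ofConv

lemma toConv_stepConv (F : ℝ≥0 → ℝ≥0 → C →ₗ[ℂ] A) (α : Finset ℝ≥0) :
    toConv (stepConv F α) = ((steps α).map fun p => toConv (F p.1 p.2)).prod := rfl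

lemma stepConv_singleton (F : ℝ≥0 → ℝ≥0 → C →ₗ[ℂ] A) (s : ℝ≥0) :
    toConv (stepConv F {s}) = 1 := by
  rw [toConv_stepConv, steps_singleton]; rfl

lemma IsPartition.stepConv_insert (F : ℝ≥0 → ℝ≥0 → C →ₗ[ℂ] A) {s r t : ℝ≥0} {α : Finset ℝ≥0}
    (hs : s < r) (h : IsPartition r t α) :
    toConv (stepConv F (insert s α)) = toConv (F s r) * toConv (stepConv F α) := by
  rw [toConv_stepConv, h.steps_insert hs]; rfl

lemma stepConv_restr_split (F : ℝ≥0 → ℝ≥0 → C →ₗ[ℂ] A) {γ : Finset ℝ≥0} {s r t : ℝ≥0}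
    (hsr : s ≤ r) (hrt : r ≤ t) (hr : r ∈ γ) :
    toConv (stepConv F (restr γ s r)) * toConv (stepConv F (restr γ r t)) =
      toConv (stepConv F (restr γ s t)) := by
  rw [toConv_stepConv, toConv_stepConv, toConv_stepConv, steps_restr_split hsr hrt hr,
    List.map_append, List.prod_append]

/-- A convolution product over a refinement of `α` is a product over `α` of products. -/
lemma stepConv_restr_eq (F : ℝ≥0 → ℝ≥0 → C →ₗ[ℂ] A) {γ α : Finset ℝ≥0} {s t : ℝ≥0}
    (h : IsPartition s t α) (hα : α ⊆ γ) :
    stepConv F (restr γ s t) = stepConv (fun u v => stepConv F (restr γ u v)) α := by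
  refine congrArg ofConv ?_
  rw [steps_restr_eq_flatMap h hα, List.map_flatMap, List.flatMap_def, List.prod_flatten, List.map_map]
  rfl

end Pairing

/-! ### Convolution products over partitions -/

section StarHom

variable {C A : Type*} [Ring C] [StarRing C] [Bialgebra ℂ C] [StarModule ℂ C] [StarBialgebra C]
  [Ring A] [StarRing A] [Algebra ℂ A]

/-- The convolution product of `*`-homomorphisms with commuting ranges is a `*`-homomorphism. -/
lemma exists_starHom_convMul (f g : C →⋆ₐ[ℂ] A) (h : ∀ x y, Commute (f x) (g y)) :
    ∃ k : C →⋆ₐ[ℂ] A, toConv (lin k) = toConv (lin f) * toConv (lin g) := by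
  let L := Algebra.TensorProduct.lift f.toAlgHom g.toAlgHom h
  have hL : ∀ z : C ⊗[ℂ] C, L (star z) = star (L z) := fun z => by
    induction z with
    | zero => simp
    | add z w hz hw => rw [star_add, map_add, map_add, star_add, hz, hw]
    | tmul x y =>
      have h1 := (h (star x) (star y)).eq
      rw [map_star, map_star] at h1
      change f (star x) * g (star y) = star (f x * g y)
      rw [map_star, map_star, star_mul, h1]
  refine ⟨⟨L.comp (Bialgebra.comulAlgHom ℂ C), fun c => ?_⟩, ?_⟩
  · simp only [AlgHom.toRingHom_eq_coe, RingHom.toMonoidHom_eq_coe, OneHom.toFun_eq_coe,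
      MonoidHom.toOneHom_coe, MonoidHom.coe_coe, RingHom.coe_coe, AlgHom.comp_apply,
      Bialgebra.comulAlgHom_apply]
    rw [StarBialgebra.comul_star, hL]
  · ext c
    change L (Coalgebra.comul c) = (toConv (lin f) * toConv (lin g)) c
    rw [LinearMap.convMul_apply]
    generalize Coalgebra.comul (R := ℂ) c = z
    induction z with
    | zero => simp
    | add z w hz hw => rw [map_add, map_add, map_add, hz, hw]
    | tmul x y => rfl

lemma exists_starHom_convOne [StarModule ℂ A] :
    ∃ k : C →⋆ₐ[ℂ] A, toConv (lin k) = 1 :=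
  ⟨⟨(Algebra.ofId ℂ A).comp (Bialgebra.counitAlgHom ℂ C), fun c => by
    simp only [AlgHom.toRingHom_eq_coe, RingHom.toMonoidHom_eq_coe, OneHom.toFun_eq_coe,
      MonoidHom.toOneHom_coe, MonoidHom.coe_coe, RingHom.coe_coe, AlgHom.comp_apply,
      Bialgebra.counitAlgHom_apply, Algebra.ofId_apply, StarBialgebra.counit_star]
    exact algebraMap_star_comm _⟩, by
    ext c; rfl⟩

end StarHom

section Refinement

variable {C A : Type*} [AddCommGroup C] [Module ℂ C] [Coalgebra ℂ C] [Ring A] [Algebra ℂ A]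

/-- The family `F_{s,t}` replaced by its convolution products over the partitions of the intervals
`[s, t]` cut out by `γ`. -/
def refined (F : ℝ≥0 → ℝ≥0 → C →ₗ[ℂ] A) (γ : Finset ℝ≥0) (s t : ℝ≥0) : C →ₗ[ℂ] A :=
  stepConv F (restr γ s t)

lemma refined_increments (F : ℝ≥0 → ℝ≥0 → C →ₗ[ℂ] A) {γ : Finset ℝ≥0} {r s t : ℝ≥0} (hrs : r ≤ s)
    (hst : s ≤ t) (hs : s ∈ γ) :
    toConv (refined F γ r s) * toConv (refined F γ s t) = toConv (refined F γ r t) :=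
  stepConv_restr_split F hrs hst hs

lemma toConv_refined_self (F : ℝ≥0 → ℝ≥0 → C →ₗ[ℂ] A) (γ : Finset ℝ≥0) (s : ℝ≥0) :
    toConv (refined F γ s s) = 1 := by
  rw [refined, restr_self, stepConv_singleton]

lemma toConv_refined_of_lt (F : ℝ≥0 → ℝ≥0 → C →ₗ[ℂ] A) (γ : Finset ℝ≥0) {s t : ℝ≥0} (h : t < s) :
    toConv (refined F γ s t) = 1 := by
  rw [refined, restr_of_lt γ h, stepConv_singleton]

lemma IsPartition.stepConv_mem {f : ℝ≥0 → ℝ≥0 → C →ₗ[ℂ] A} {E : Type*} [Ring E] [Bialgebra ℂ E]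
    {F : ℝ≥0 → ℝ≥0 → E →ₗ[ℂ] A}
    (hF : IsIndependentFamily F) (hf : ∀ u v, u ≤ v → ∀ c, f u v c ∈ timeSpan F u v)
    {s t : ℝ≥0} {α : Finset ℝ≥0} (hα : IsPartition s t α) (c : C) :
    stepConv f α c ∈ timeSpan F s t := by
  revert c
  refine IsPartition.induct (P := fun s α => ∀ c, stepConv f α c ∈ timeSpan F s t) ?_ ?_ hα
  · intro c
    rw [show stepConv f {t} = (1 : WithConv (C →ₗ[ℂ] A)).ofConv from
      congrArg ofConv (stepConv_singleton f t), LinearMap.convOne_apply,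
      Algebra.algebraMap_eq_smul_one]
    exact Submodule.smul_mem _ _ (one_mem_timeSpan le_rfl)
  · intro s r α hs hα ih c
    rw [show stepConv f (insert s α) = (toConv (f s r) * toConv (stepConv f α)).ofConv from
      congrArg ofConv (hα.stepConv_insert f hs)]
    exact convMul_mem (timeSpan F s t) LinearMap.id
      (fun x y => hF.concat_mem (hf s r hs.le x) (ih y)) c

variable {B : Type*} [Ring B] [StarRing B] [Bialgebra ℂ B]
variable {D : Type*} [NormedAddCommGroup D] [InnerProductSpace ℂ D]
variable {Ω : D} {j : ℝ≥0 → ℝ≥0 → B →⋆ₐ[ℂ] La D}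

/-- The values of `f` over `[u, v]` are generated by the increments of `j` over subintervals
of `[u, v]`. -/
def IsLocal (j : ℝ≥0 → ℝ≥0 → B →⋆ₐ[ℂ] La D) (f : ℝ≥0 → ℝ≥0 → C →ₗ[ℂ] La D) : Prop :=
  ∀ ⦃u v : ℝ≥0⦄, u ≤ v → ∀ c, f u v c ∈ timeSpan (fun s t => lin (j s t)) u v

omit [Coalgebra ℂ C] in
lemma isLocal_comp (j : ℝ≥0 → ℝ≥0 → B →⋆ₐ[ℂ] La D) (κ : C →ₗ[ℂ] B) :
    IsLocal j fun s t => lin (j s t) ∘ₗ κ := fun _ _ huv c =>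
  apply_mem_timeSpan (F := fun s t => lin (j s t)) huv (κ c)

lemma isLocal_self (j : ℝ≥0 → ℝ≥0 → B →⋆ₐ[ℂ] La D) : IsLocal j fun s t => lin (j s t) :=
  isLocal_comp j LinearMap.id

lemma IsLocal.stepConv_mem (hj : IsLevyProcess Ω j) {f : ℝ≥0 → ℝ≥0 → C →ₗ[ℂ] La D}
    (hf : IsLocal j f) {s t : ℝ≥0} {α : Finset ℝ≥0} (hα : IsPartition s t α) (c : C) :
    stepConv f α c ∈ timeSpan (fun s t => lin (j s t)) s t :=
  hα.stepConv_mem hj.isFlow.toIsIndependentFamily hf c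

lemma IsLocal.refined (hj : IsLevyProcess Ω j) {f : ℝ≥0 → ℝ≥0 → C →ₗ[ℂ] La D}
    (hf : IsLocal j f) (γ : Finset ℝ≥0) : IsLocal j (refined f γ) := fun _ _ huv c =>
  hf.stepConv_mem hj (isPartition_restr γ huv) c

/-- By independence, the vacuum state turns convolution products over a partition into convolution
products of functionals. -/
lemma IsLocal.vacuum_stepConv (hj : IsLevyProcess Ω j) {f : ℝ≥0 → ℝ≥0 → C →ₗ[ℂ] La D}
    (hf : IsLocal j f) {s t : ℝ≥0} {α : Finset ℝ≥0} (hα : IsPartition s t α) :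
    vacuum Ω ∘ₗ stepConv f α = stepConv (fun u v => vacuum Ω ∘ₗ f u v) α := by
  refine toConv_injective (IsPartition.induct (P := fun s α => toConv (vacuum Ω ∘ₗ stepConv f α) =
    toConv (stepConv (fun u v => vacuum Ω ∘ₗ f u v) α)) ?_ ?_ hα)
  · rw [stepConv_singleton, show stepConv f {t} = (1 : WithConv (C →ₗ[ℂ] La D)).ofConv from
      congrArg ofConv (stepConv_singleton f t)]
    ext c
    simp [Algebra.algebraMap_eq_smul_one, vacuum_one hj.norm_vacuum]
  · intro s r α hs hα ih
    rw [hα.stepConv_insert _ hs, ← ih, show stepConv f (insert s α) =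
      (toConv (f s r) * toConv (stepConv f α)).ofConv from
      congrArg ofConv (hα.stepConv_insert f hs)]
    exact comp_convMul_of_forall fun x y =>
      hj.vacuum_mul (hf hs.le x) (hf.stepConv_mem hj hα y)

/-- As increments over different steps commute, a product of two convolution products over the same
partition is a convolution product on the tensor product of the coalgebras. -/
lemma IsLocal.pairing_stepConv (hj : IsLevyProcess Ω j) {C' : Type*} [AddCommGroup C']
    [Module ℂ C'] [Coalgebra ℂ C'] {f : ℝ≥0 → ℝ≥0 → C →ₗ[ℂ] La D} {g : ℝ≥0 → ℝ≥0 → C' →ₗ[ℂ] La D}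
    (hf : IsLocal j f) (hg : IsLocal j g) {s t : ℝ≥0} {α : Finset ℝ≥0} (hα : IsPartition s t α) :
    pairing (stepConv f α) (stepConv g α) = stepConv (fun u v => pairing (f u v) (g u v)) α := by
  refine toConv_injective (IsPartition.induct
    (P := fun s α => toConv (pairing (stepConv f α) (stepConv g α)) =
      toConv (stepConv (fun u v => pairing (f u v) (g u v)) α)) ?_ ?_ hα)
  · rw [stepConv_singleton, ← pairing_one, ← stepConv_singleton f t, ← stepConv_singleton g t]
  · intro s r α hs hα ih
    rw [hα.stepConv_insert _ hs, ← ih]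
    refine Eq.trans ?_ (pairing_convMul fun x y =>
      (hj.commute_of_mem le_rfl (hg hs.le y) (hf.stepConv_mem hj hα x)).symm)
    rw [← hα.stepConv_insert f hs, ← hα.stepConv_insert g hs]

omit [Coalgebra ℂ C] in
lemma IsLocal.pairing (hj : IsLevyProcess Ω j) {C' : Type*} [AddCommGroup C']
    [Module ℂ C'] {f : ℝ≥0 → ℝ≥0 → C →ₗ[ℂ] La D} {g : ℝ≥0 → ℝ≥0 → C' →ₗ[ℂ] La D}
    (hf : IsLocal j f) (hg : IsLocal j g) : IsLocal j fun u v => pairing (f u v) (g u v) :=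
  fun _ _ huv => pairing_mem fun x y => hj.isFlow.mul_mem (hf huv x) (hg huv y)

lemma IsLevyProcess.stepConv_eq (hj : IsLevyProcess Ω j) {s t : ℝ≥0} {α : Finset ℝ≥0}
    (hα : IsPartition s t α) : stepConv (fun u v => lin (j u v)) α = lin (j s t) := by
  refine toConv_injective (IsPartition.induct
    (P := fun s α => toConv (stepConv (fun u v => lin (j u v)) α) = toConv (lin (j s t))) ?_ ?_ hα)
  · rw [stepConv_singleton]
    exact WithConv.ext (LinearMap.ext fun b => (hj.diagonal t b).symm)
  · intro s r α hs hα ih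
    rw [hα.stepConv_insert _ hs, ih, hj.increments s r t hs.le hα.le]

/-- The estimate of `exists_convProd_bound` for the steps of a partition. -/
lemma exists_stepConv_bound (χ : C →ₗ[ℂ] ℂ) (b : C → ℝ) (T : ℝ≥0) (x : C) :
    ∃ c : ℝ, 0 ≤ c ∧ ∀ (f : ℝ≥0 → ℝ≥0 → C →ₗ[ℂ] ℂ) (s t : ℝ≥0) (α : Finset ℝ≥0),
      IsPartition s t α → t ≤ T →
      (∀ u v : ℝ≥0, u ≤ v → v ≤ T → ∀ y, ‖f u v y - Coalgebra.counit (R := ℂ) y -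
        ((v - u : ℝ) : ℂ) * χ y‖ ≤ b y * (v - u : ℝ) ^ 2) →
      ‖stepConv f α x - convExp χ (t - s) x‖ ≤
        c * ((steps α).map fun p => ((p.2 : ℝ) - p.1) ^ 2).sum := by
  obtain ⟨c, hc, h⟩ := exists_convProd_bound χ b T x
  refine ⟨c, hc, fun f s t α hα htT hf => ?_⟩
  have h1 := h ((steps α).map fun p => ((p.2 : ℝ) - p.1, f p.1 p.2)) (fun q hq => by
      obtain ⟨p, hp, rfl⟩ := List.mem_map.1 hq
      obtain ⟨h1, h2, h3, h4⟩ := hα.mem_steps p hp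
      exact ⟨sub_nonneg.2 (by exact_mod_cast h1.le), hf p.1 p.2 h1.le (h3.trans htT)⟩) (by
      rw [List.map_map]
      refine le_trans (le_of_eq hα.sum_steps) ?_
      have h2 : (t : ℝ) ≤ T := by exact_mod_cast htT
      linarith [s.2])
  simp only [List.map_map, Function.comp_def] at h1
  rw [hα.sum_steps] at h1
  exact h1

end Refinement

/-! ### Vacuum expectations of the transformed increments -/

section Bounds

lemma counit_pairing {B X : Type*} [Ring B] [Bialgebra ℂ B] [AddCommGroup X] [Module ℂ X]
    [Coalgebra ℂ X] (f : X →ₗ[ℂ] B)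
    (hf : ∀ c, Coalgebra.counit (R := ℂ) (f c) = Coalgebra.counit (R := ℂ) c)
    (z : B ⊗[ℂ] X) :
    Coalgebra.counit (R := ℂ) (pairing LinearMap.id f z) = Coalgebra.counit (R := ℂ) z := by
  induction z with
  | zero => simp
  | add z w hz hw => simp only [map_add, hz, hw]
  | tmul b c => simp [hf, mul_comm]

variable {B : Type*} [Ring B] [StarRing B] [Bialgebra ℂ B]
variable {C : Type*} [Ring C] [StarRing C] [Bialgebra ℂ C] [StarModule ℂ C] [StarBialgebra C]
variable {D : Type*} [NormedAddCommGroup D] [InnerProductSpace ℂ D]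
variable {Ω : D} {j : ℝ≥0 → ℝ≥0 → B →⋆ₐ[ℂ] La D} {ψ : B →ₗ[ℂ] ℂ}

/-- The family `j_{s,t} ∘ κ`. -/
def transFamily (j : ℝ≥0 → ℝ≥0 → B →⋆ₐ[ℂ] La D) (κ : C →⋆ₐ[ℂ] B) (s t : ℝ≥0) : C →ₗ[ℂ] La D :=
  lin (j s t) ∘ₗ lin κ

omit [StarModule ℂ C] [StarBialgebra C] in
lemma isLocal_transFamily (j : ℝ≥0 → ℝ≥0 → B →⋆ₐ[ℂ] La D) (κ : C →⋆ₐ[ℂ] B) :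
    IsLocal j (transFamily j κ) := isLocal_comp j (lin κ)

/-- Over the partitions cut out by `γ`, the products of the `j ∘ κ` are `*`-homomorphisms. -/
lemma exists_refinedHom (hj : IsLevyProcess Ω j) (κ : C →⋆ₐ[ℂ] B) (γ : Finset ℝ≥0) (s t : ℝ≥0) :
    ∃ k : C →⋆ₐ[ℂ] La D, lin k = refined (transFamily j κ) γ s t := by
  suffices h : ∃ k : C →⋆ₐ[ℂ] La D, toConv (lin k) = toConv (refined (transFamily j κ) γ s t) by
    obtain ⟨k, hk⟩ := h
    exact ⟨k, toConv_injective hk⟩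
  rcases lt_or_ge t s with h | hst
  · rw [toConv_refined_of_lt _ _ h]
    exact exists_starHom_convOne
  · refine IsPartition.induct (P := fun s α => ∃ k : C →⋆ₐ[ℂ] La D,
      toConv (lin k) = toConv (stepConv (transFamily j κ) α)) ?_ ?_ (isPartition_restr γ hst)
    · rw [stepConv_singleton]
      exact exists_starHom_convOne
    · rintro s r α hs hα ⟨k, hk⟩
      rw [hα.stepConv_insert _ hs, ← hk]
      refine exists_starHom_convMul ((j s r).comp κ) k fun x y => ?_
      have h1 := (isLocal_transFamily j κ).stepConv_mem hj hα y
      rw [← toConv_injective hk] at h1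
      exact hj.commute_of_mem le_rfl (isLocal_transFamily j κ hs.le x) h1

/-- The `*`-homomorphism `Θ_α` for the partition `α` of `[s, t]` cut out by `γ`. -/
def refinedHom (hj : IsLevyProcess Ω j) (κ : C →⋆ₐ[ℂ] B) (γ : Finset ℝ≥0) (s t : ℝ≥0) :
    C →⋆ₐ[ℂ] La D := (exists_refinedHom hj κ γ s t).choose

lemma lin_refinedHom (hj : IsLevyProcess Ω j) (κ : C →⋆ₐ[ℂ] B) (γ : Finset ℝ≥0) (s t : ℝ≥0) :
    lin (refinedHom hj κ γ s t) = refined (transFamily j κ) γ s t :=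
  (exists_refinedHom hj κ γ s t).choose_spec

lemma refinedHom_apply (hj : IsLevyProcess Ω j) (κ : C →⋆ₐ[ℂ] B) (γ : Finset ℝ≥0) (s t : ℝ≥0)
    (c : C) : refinedHom hj κ γ s t c = refined (transFamily j κ) γ s t c := by
  rw [← lin_refinedHom hj, lin_apply]

omit [StarModule ℂ C] [StarBialgebra C] in
/-- `⟨Ω, Θ_α(c) Ω⟩` is close to `e_⋆^{(t-s)ψ∘κ}(c)`. -/
lemma exists_vacuum_refined_bound (hj : IsLevyProcess Ω j) (hψ : HasGenerator Ω j ψ)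
    (κ : C →⋆ₐ[ℂ] B) (hκ : ∀ c, Coalgebra.counit (R := ℂ) (κ c) = Coalgebra.counit (R := ℂ) c)
    (T : ℝ≥0) (x : C) :
    ∃ c : ℝ, 0 ≤ c ∧ ∀ (γ : Finset ℝ≥0) (s t : ℝ≥0), s ≤ t → t ≤ T →
      ‖vacuum Ω (refined (transFamily j κ) γ s t x) - convExp (ψ ∘ₗ lin κ) (t - s) x‖ ≤
        c * ((steps (restr γ s t)).map fun p => ((p.2 : ℝ) - p.1) ^ 2).sum := by
  choose b hb0 hb using fun y : C => exists_convExp_bound ψ T (κ y)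
  obtain ⟨c, hc, h⟩ := exists_stepConv_bound (ψ ∘ₗ lin κ) b T x
  refine ⟨c, hc, fun γ s t hst htT => ?_⟩
  have h1 := h (fun u v => vacuum Ω ∘ₗ transFamily j κ u v) s t _ (isPartition_restr γ hst) htT
    (fun u v huv hv y => by
      have h2 := hb y (v - u) (sub_nonneg.2 (by exact_mod_cast huv)) (by
        have : (v : ℝ) ≤ T := by exact_mod_cast hv
        linarith [u.2])
      rw [← hj.distr_eq hψ huv, hκ] at h2
      exact h2)
  rw [← (isLocal_transFamily j κ).vacuum_stepConv hj (isPartition_restr γ hst)] at h1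
  exact h1

omit [StarModule ℂ C] [StarBialgebra C] in
/-- `⟨Ω, j_{s,t}(b) Θ_α(c) Ω⟩ = δ(b) λ(c) + (t - s) ψ(b κ(c)) + O((t - s)²)`, uniformly in the
partition `α` of `[s, t]`. -/
lemma exists_vacuum_pairing_bound (hj : IsLevyProcess Ω j) (hψ : HasGenerator Ω j ψ)
    (κ : C →⋆ₐ[ℂ] B) (hκ : ∀ c, Coalgebra.counit (R := ℂ) (κ c) = Coalgebra.counit (R := ℂ) c)
    (T : ℝ≥0) (z : B ⊗[ℂ] C) :
    ∃ c : ℝ, 0 ≤ c ∧ ∀ (γ : Finset ℝ≥0) (s t : ℝ≥0), s ≤ t → t ≤ T →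
      ‖vacuum Ω (pairing (lin (j s t)) (refined (transFamily j κ) γ s t) z) -
        Coalgebra.counit (R := ℂ) z - ((t - s : ℝ) : ℂ) * ψ (pairing LinearMap.id (lin κ) z)‖ ≤
        c * (t - s : ℝ) ^ 2 := by
  let χ : B ⊗[ℂ] C →ₗ[ℂ] ℂ := ψ ∘ₗ pairing LinearMap.id (lin κ)
  have hc := counit_pairing (lin κ) hκ
  choose b hb0 hb using fun y : B ⊗[ℂ] C =>
    exists_convExp_bound ψ T (pairing LinearMap.id (lin κ) y)
  obtain ⟨c, hc0, h⟩ := exists_stepConv_bound χ b T z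
  obtain ⟨c', hc0', h'⟩ := exists_convExp_bound χ T z
  refine ⟨c + c', by positivity, fun γ s t hst htT => ?_⟩
  have hsub : ∀ {u v : ℝ≥0}, u ≤ v → v ≤ T → (0 : ℝ) ≤ v - u ∧ (v - u : ℝ) ≤ T := by
    intro u v huv hv
    have : (v : ℝ) ≤ T := by exact_mod_cast hv
    exact ⟨sub_nonneg.2 (by exact_mod_cast huv), by linarith [u.2]⟩
  have hα := isPartition_restr γ hst
  have h1 := h (fun u v => vacuum Ω ∘ₗ pairing (lin (j u v)) (transFamily j κ u v)) s t _ hα htT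
    (fun u v huv hv y => by
      have h2 := hb y (v - u) (hsub huv hv).1 (hsub huv hv).2
      rw [← hj.distr_eq hψ huv, hc] at h2
      have h3 : pairing (lin (j u v)) (transFamily j κ u v) y =
          j u v (pairing LinearMap.id (lin κ) y) := by
        clear * -
        induction y with
        | zero => simp
        | add z w hz hw => simp only [map_add, hz, hw]
        | tmul b c => simp [transFamily]
      rw [LinearMap.comp_apply, h3]
      exact h2)
  rw [← ((isLocal_self j).pairing hj (isLocal_transFamily j κ)).vacuum_stepConv hj hα,
    ← (isLocal_self j).pairing_stepConv hj (isLocal_transFamily j κ) hα, hj.stepConv_eq hα] at h1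
  have h4 := h' (t - s) (hsub hst htT).1 (hsub hst htT).2
  have h5 : ∀ w e d r : ℂ, w - d - r = (w - e) + (e - d - r) := fun w e d r => by ring
  rw [h5 _ (convExp χ (t - s) z)]
  refine (norm_add_le _ _).trans ((add_le_add h1 h4).trans ?_)
  rw [add_mul]
  gcongr
  exact hα.sum_sq_steps_le

omit [StarModule ℂ C] [StarBialgebra C] in
/-- For partitions `α ⊆ β`, `⟨Ω, Θ_α(x) Θ_β(y) Ω⟩` is close to `e_⋆^{(t-s)ψ∘κ}(xy)`. -/
lemma exists_vacuum_refined_mul_refined_bound (hj : IsLevyProcess Ω j) (hψ : HasGenerator Ω j ψ)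
    (κ : C →⋆ₐ[ℂ] B) (hκ : ∀ c, Coalgebra.counit (R := ℂ) (κ c) = Coalgebra.counit (R := ℂ) c)
    (T : ℝ≥0) (x y : C) :
    ∃ c : ℝ, 0 ≤ c ∧ ∀ (γ γ' : Finset ℝ≥0) (s t : ℝ≥0), s ≤ t → t ≤ T → restr γ s t ⊆ γ' →
      ‖vacuum Ω (refined (transFamily j κ) γ s t x * refined (transFamily j κ) γ' s t y) -
        convExp (ψ ∘ₗ lin κ) (t - s) (x * y)‖ ≤
        c * ((steps (restr γ s t)).map fun p => ((p.2 : ℝ) - p.1) ^ 2).sum := by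
  let q : C ⊗[ℂ] C →ₗ[ℂ] B ⊗[ℂ] C := TensorProduct.map (lin κ) LinearMap.id
  have hq : ∀ z, Coalgebra.counit (R := ℂ) (q z) = Coalgebra.counit (R := ℂ) z := fun z => by
    induction z with
    | zero => simp
    | add z w hz hw => simp only [map_add, hz, hw]
    | tmul b c => simp [q, hκ]
  have hχ : ∀ z, ψ (pairing LinearMap.id (lin κ) (q z)) =
      ((ψ ∘ₗ lin κ) ∘ₗ (Bialgebra.mulCoalgHom ℂ C).toLinearMap) z := fun z => by
    induction z with
    | zero => simp
    | add z w hz hw => simp only [map_add, hz, hw]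
    | tmul b c => simp [q]
  choose b hb0 hb using fun z : C ⊗[ℂ] C => exists_vacuum_pairing_bound hj hψ κ hκ T (q z)
  obtain ⟨c, hc0, h⟩ := exists_stepConv_bound
    ((ψ ∘ₗ lin κ) ∘ₗ (Bialgebra.mulCoalgHom ℂ C).toLinearMap) b T (x ⊗ₜ y)
  refine ⟨c, hc0, fun γ γ' s t hst htT hγ => ?_⟩
  have hα := isPartition_restr γ hst
  have h1 := h (fun u v => vacuum Ω ∘ₗ
      pairing (transFamily j κ u v) (refined (transFamily j κ) γ' u v)) s t _ hα htT
    (fun u v huv hv z => by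
      have h2 := hb z γ' u v huv hv
      rw [hq, hχ] at h2
      have h3 : pairing (lin (j u v)) (refined (transFamily j κ) γ' u v) (q z) =
          pairing (transFamily j κ u v) (refined (transFamily j κ) γ' u v) z := by
        clear * -
        induction z with
        | zero => simp
        | add z w hz hw => simp only [map_add, hz, hw]
        | tmul b c => simp [transFamily, q]
      rw [h3] at h2
      exact h2)
  have hl := isLocal_transFamily j κ
  rw [convExp_comp, ← (hl.pairing hj (hl.refined hj γ')).vacuum_stepConv hj hα,
    ← hl.pairing_stepConv hj (hl.refined hj γ') hα] at h1
  rw [refined, refined, stepConv_restr_eq (transFamily j κ) hα hγ]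
  exact h1

/-- The vectors `Θ_α(c) Ω` form a Cauchy net. -/
lemma cauchySeq_refined (hj : IsLevyProcess Ω j) (hψ : HasGenerator Ω j ψ)
    (κ : C →⋆ₐ[ℂ] B) (hκ : ∀ c, Coalgebra.counit (R := ℂ) (κ c) = Coalgebra.counit (R := ℂ) c)
    {s t : ℝ≥0} (hst : s ≤ t) (x : C) :
    CauchySeq fun γ : Finset ℝ≥0 => (refined (transFamily j κ) γ s t x).1 Ω := by
  obtain ⟨c, hc, h⟩ := exists_vacuum_refined_bound hj hψ κ hκ t (star x * x)
  obtain ⟨c', hc', h'⟩ := exists_vacuum_refined_mul_refined_bound hj hψ κ hκ t (star x) x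
  rw [Metric.cauchySeq_iff']
  intro ε hε
  have hlim := (tendsto_sum_sq_steps hst).const_mul (2 * c + 2 * c')
  rw [mul_zero] at hlim
  obtain ⟨γ₀, hγ₀⟩ := eventually_atTop.1 (hlim.eventually (gt_mem_nhds (pow_pos hε 2)))
  refine ⟨insert s (insert t γ₀), fun γ hγ => ?_⟩
  set γ₁ := insert s (insert t γ₀) with hγ₁
  let Q := fun γ => ((steps (restr γ s t)).map fun p => ((p.2 : ℝ) - p.1) ^ 2).sum
  have hsub₁ : γ₀ ⊆ γ₁ := (Finset.subset_insert _ _).trans (Finset.subset_insert _ _)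
  have hQ : (2 * c + 2 * c') * max (Q γ) (Q γ₁) < ε ^ 2 := by
    rcases max_choice (Q γ) (Q γ₁) with h | h <;> rw [h]
    exacts [hγ₀ γ (hsub₁.trans hγ), hγ₀ γ₁ hsub₁]
  have hsub : restr γ₁ s t ⊆ γ := fun y hy => by
    rcases (mem_restr hst).1 hy with rfl | rfl | h
    · exact hγ (by simp [hγ₁])
    · exact hγ (by simp [hγ₁])
    · exact hγ h.1
  let Y := fun γ => (refined (transFamily j κ) γ s t x).1 Ω
  have hin : ∀ γ γ', inner ℂ (Y γ) (Y γ') =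
      vacuum Ω (refined (transFamily j κ) γ s t (star x) *
        refined (transFamily j κ) γ' s t x) := fun γ γ' => by
    rw [← vacuum_star_mul]
    simp only [← refinedHom_apply hj, map_star]
  have hin' : ∀ γ, inner ℂ (Y γ) (Y γ) =
      vacuum Ω (refined (transFamily j κ) γ s t (star x * x)) := fun γ => by
    rw [hin]
    simp only [← refinedHom_apply hj, map_mul]
  set E := convExp (ψ ∘ₗ lin κ) (t - s) (star x * x)
  have hd : ∀ γ', |‖Y γ'‖ ^ 2 - E.re| ≤ c * Q γ' := fun γ' => by
    rw [norm_sq_eq_re_inner (𝕜 := ℂ), hin']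
    exact (Complex.abs_re_le_norm _).trans (h γ' s t hst le_rfl)
  have hx : |(inner ℂ (Y γ₁) (Y γ)).re - E.re| ≤ c' * Q γ₁ := by
    rw [hin]
    exact (Complex.abs_re_le_norm _).trans (h' γ₁ γ s t hst le_rfl hsub)
  have h3 : dist (Y γ) (Y γ₁) ^ 2 < ε ^ 2 := by
    rw [dist_comm, dist_eq_norm, @norm_sub_sq ℂ]
    have e1 := abs_le.1 (hd γ)
    have e2 := abs_le.1 (hd γ₁)
    have e3 := abs_le.1 hx
    change ‖Y γ₁‖ ^ 2 - 2 * (inner ℂ (Y γ₁) (Y γ)).re + ‖Y γ‖ ^ 2 < ε ^ 2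
    have m1 := mul_le_mul_of_nonneg_left (le_max_left (Q γ) (Q γ₁)) hc
    have m2 := mul_le_mul_of_nonneg_left (le_max_right (Q γ) (Q γ₁)) hc
    have m3 := mul_le_mul_of_nonneg_left (le_max_right (Q γ) (Q γ₁)) hc'
    linarith
  exact lt_of_pow_lt_pow_left₀ 2 hε.le h3

end Bounds

/-! ### The algebra of nets of convolution products -/

section Gram

variable {ι E : Type*} [SemilatticeSup ι] [NormedAddCommGroup E]
  [InnerProductSpace ℂ E]

/-- A net is Cauchy as soon as its Gram matrix converges. -/
lemma cauchySeq_of_tendsto_inner [Nonempty ι] {u : ι → E} {L : ℂ}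
    (h : Tendsto (fun p : ι × ι => inner ℂ (u p.1) (u p.2)) atTop (𝓝 L)) : CauchySeq u := by
  rw [cauchySeq_iff_tendsto_dist_atTop_0]
  have hre := (Complex.continuous_re.tendsto L).comp h
  have h1 : Tendsto (fun p : ι × ι => (p.1, p.1)) atTop atTop := by
    rw [← prod_atTop_atTop_eq]
    exact tendsto_fst.prodMk tendsto_fst
  have h2 : Tendsto (fun p : ι × ι => (p.2, p.2)) atTop atTop := by
    rw [← prod_atTop_atTop_eq]
    exact tendsto_snd.prodMk tendsto_snd
  have h3 := ((hre.comp h1).sub (hre.const_mul 2)).add (hre.comp h2)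
  have h4 : Tendsto (fun p : ι × ι => dist (u p.1) (u p.2) ^ 2) atTop (𝓝 0) := by
    convert h3 using 2 with p
    · rw [dist_eq_norm, @norm_sub_sq ℂ, norm_sq_eq_re_inner (𝕜 := ℂ), norm_sq_eq_re_inner (𝕜 := ℂ)]
      rfl
    · ring
  have h5 := h4.sqrt
  simpa [Real.sqrt_sq] using h5

omit [InnerProductSpace ℂ E] in
lemma exists_tendsto_completion [Nonempty ι] {u : ι → E} (h : CauchySeq u) :
    ∃ v : UniformSpace.Completion E,
      Tendsto (fun i => (u i : UniformSpace.Completion E)) atTop (𝓝 v) :=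
  cauchySeq_tendsto_of_complete
    (h.map (UniformSpace.Completion.uniformContinuous_coe E))

lemma exists_tendsto_inner_of_cauchySeq [Nonempty ι] {u : ι → E} (h : CauchySeq u) :
    ∃ L : ℂ, Tendsto (fun p : ι × ι => inner ℂ (u p.1) (u p.2)) atTop (𝓝 L) := by
  obtain ⟨v, hv⟩ := exists_tendsto_completion h
  refine ⟨inner ℂ v v, ?_⟩
  rw [← prod_atTop_atTop_eq]
  have h1 := (hv.comp tendsto_fst).inner (𝕜 := ℂ) (hv.comp (tendsto_snd (f := atTop)))
  simpa [Function.comp_def, UniformSpace.Completion.inner_coe] using h1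

end Gram

section Gns

variable {S H : Type*} [Ring S] [StarRing S] [Algebra ℂ S] [NormedAddCommGroup H]
  [InnerProductSpace ℂ H]

/-- If the left multiplication of a `*`-algebra is compatible with the sesquilinear form induced by
a linear map into a Hilbert space, then it acts on the range of that map by adjointable
operators. -/
theorem exists_starHom_range (v : S →ₗ[ℂ] H)
    (hv : ∀ x y z, inner ℂ (v (x * y)) (v z) = inner ℂ (v y) (v (star x * z))) :
    ∃ π : S →⋆ₐ[ℂ] La (LinearMap.range v), ∀ x y,
      (π x).1 (v.rangeRestrict y) = v.rangeRestrict (x * y) := by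
  have hker : ∀ x y, v y = 0 → v (x * y) = 0 := fun x y hy => by
    rw [← inner_self_eq_zero (𝕜 := ℂ), hv, hy, inner_zero_left]
  have hsurj : ∀ ξ : LinearMap.range v, ∃ y, v.rangeRestrict y = ξ :=
    fun ξ => v.surjective_rangeRestrict ξ
  let op : S → Module.End ℂ (LinearMap.range v) := fun x =>
    (v.quotKerEquivRange.toLinearMap ∘ₗ (LinearMap.ker v).mapQ (LinearMap.ker v)
      (LinearMap.mulLeft ℂ x) (fun y hy => hker x y hy)) ∘ₗ v.quotKerEquivRange.symm.toLinearMap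
  have hop : ∀ x y, op x (v.rangeRestrict y) = v.rangeRestrict (x * y) := fun x y => by
    have h1 : v.quotKerEquivRange.symm (v.rangeRestrict y) = (LinearMap.ker v).mkQ y :=
      v.quotKerEquivRange_symm_apply_image y _
    simp only [op, LinearMap.comp_apply, LinearEquiv.coe_coe, h1]
    rfl
  have hinner : ∀ x (ξ η : LinearMap.range v),
      inner ℂ (op x ξ) η = inner ℂ ξ (op (star x) η) := fun x ξ η => by
    obtain ⟨y, rfl⟩ := hsurj ξ
    obtain ⟨z, rfl⟩ := hsurj η
    rw [hop, hop]
    exact hv x y z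
  let π : S → La (LinearMap.range v) := fun x => ⟨op x, op (star x), hinner x⟩
  have hπ : ∀ x y, (π x).1 (v.rangeRestrict y) = v.rangeRestrict (x * y) := hop
  have hext : ∀ T T' : La (LinearMap.range v),
      (∀ y, T.1 (v.rangeRestrict y) = T'.1 (v.rangeRestrict y)) → T = T' := fun T T' h =>
    Subtype.ext (LinearMap.ext fun ξ => by
      obtain ⟨y, rfl⟩ := hsurj ξ
      exact h y)
  refine ⟨{ toFun := π
            map_one' := hext _ _ fun y => by rw [hπ, one_mul]; rfl
            map_mul' := fun x z => hext _ _ fun y => by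
              rw [hπ, mul_assoc, ← hπ, ← hπ]; rfl
            map_zero' := hext _ _ fun y => by rw [hπ, zero_mul, map_zero]; rfl
            map_add' := fun x z => hext _ _ fun y => by
              rw [hπ, add_mul, map_add, ← hπ, ← hπ]; rfl
            commutes' := fun r => hext _ _ fun y => by
              rw [hπ, ← Algebra.smul_def, map_smul]; rfl
            map_star' := fun x => La.ext_inner fun ξ η => by
              rw [La.inner_star_right]
              exact (hinner x ξ η).symm }, hπ⟩

end Gns

section NetAlgebra

variable {B : Type*} [Ring B] [StarRing B] [Bialgebra ℂ B]
variable {C : Type*} [Ring C] [StarRing C] [Bialgebra ℂ C] [StarModule ℂ C] [StarBialgebra C]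
variable {D : Type*} [NormedAddCommGroup D] [InnerProductSpace ℂ D]
variable {Ω : D} {j : ℝ≥0 → ℝ≥0 → B →⋆ₐ[ℂ] La D} {ψ : B →ₗ[ℂ] ℂ}

/-- The net of the `*`-homomorphisms `Θ_α`, as a `*`-homomorphism into the nets of operators. -/
def netHom (hj : IsLevyProcess Ω j) (κ : C →⋆ₐ[ℂ] B) (s t : ℝ≥0) :
    C →⋆ₐ[ℂ] (Finset ℝ≥0 → La D) where
  toFun c γ := refinedHom hj κ γ s t c
  map_one' := by ext1 γ; simp
  map_mul' x y := by ext1 γ; simp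
  map_zero' := by ext1 γ; simp
  map_add' x y := by ext1 γ; simp
  commutes' r := by ext1 γ; simp [AlgHomClass.commutes]
  map_star' x := by ext1 γ; simp [map_star]

/-- The `*`-algebra of nets of operators which is generated by the nets `Θ_α(c)`. -/
def netAlgebra (hj : IsLevyProcess Ω j) (κ : C →⋆ₐ[ℂ] B) :
    StarSubalgebra ℂ (Finset ℝ≥0 → La D) where
  toSubalgebra := Algebra.adjoin ℂ {T | ∃ s t c, T = netHom hj κ s t c}
  star_mem' := by
    intro T hT
    change star T ∈ Algebra.adjoin ℂ {T | ∃ s t c, T = netHom hj κ s t c}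
    induction hT using Algebra.adjoin_induction with
    | mem T hT =>
      obtain ⟨s, t, c, rfl⟩ := hT
      exact Algebra.subset_adjoin ⟨s, t, star c, (map_star _ _).symm⟩
    | algebraMap r =>
      rw [← algebraMap_star_comm]
      exact Subalgebra.algebraMap_mem _ _
    | add x y _ _ hx hy => rw [star_add]; exact add_mem hx hy
    | mul x y _ _ hx hy => rw [star_mul]; exact mul_mem hy hx

/-- The type of the elements of `netAlgebra`. It is a separate definition so that instances on it
are found without unfolding the algebra of all nets. -/
def NetAlg (hj : IsLevyProcess Ω j) (κ : C →⋆ₐ[ℂ] B) : Type _ := netAlgebra hj κ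

instance (hj : IsLevyProcess Ω j) (κ : C →⋆ₐ[ℂ] B) : Ring (NetAlg hj κ) :=
  inferInstanceAs (Ring (netAlgebra hj κ))

instance (hj : IsLevyProcess Ω j) (κ : C →⋆ₐ[ℂ] B) : StarRing (NetAlg hj κ) :=
  inferInstanceAs (StarRing (netAlgebra hj κ))

instance (hj : IsLevyProcess Ω j) (κ : C →⋆ₐ[ℂ] B) : Algebra ℂ (NetAlg hj κ) :=
  inferInstanceAs (Algebra ℂ (netAlgebra hj κ))

/-- The `*`-homomorphisms `netHom` with values in `netAlgebra`. -/
def netAlgebraHom (hj : IsLevyProcess Ω j) (κ : C →⋆ₐ[ℂ] B) (s t : ℝ≥0) :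
    C →⋆ₐ[ℂ] NetAlg hj κ :=
  (netHom hj κ s t).codRestrict _ fun c => Algebra.subset_adjoin ⟨s, t, c, rfl⟩

/-- The evaluation of the nets at `γ`. -/
def netEval (hj : IsLevyProcess Ω j) (κ : C →⋆ₐ[ℂ] B) (γ : Finset ℝ≥0) :
    NetAlg hj κ →ₐ[ℂ] La D :=
  (Pi.evalAlgHom ℂ (fun _ : Finset ℝ≥0 => La D) γ).comp (netAlgebra hj κ).subtype.toAlgHom

lemma netEval_netAlgebraHom (hj : IsLevyProcess Ω j) (κ : C →⋆ₐ[ℂ] B) (γ : Finset ℝ≥0)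
    (s t : ℝ≥0) (c : C) :
    netEval hj κ γ (netAlgebraHom hj κ s t c) = refined (transFamily j κ) γ s t c :=
  refinedHom_apply hj κ γ s t c

lemma netEval_star (hj : IsLevyProcess Ω j) (κ : C →⋆ₐ[ℂ] B) (γ : Finset ℝ≥0)
    (T : NetAlg hj κ) : netEval hj κ γ (star T) = star (netEval hj κ γ T) := rfl

lemma netAlgebra_ext {hj : IsLevyProcess Ω j} {κ : C →⋆ₐ[ℂ] B} {T T' : NetAlg hj κ}
    (h : ∀ γ, netEval hj κ γ T = netEval hj κ γ T') : T = T' :=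
  Subtype.ext (funext h)

/-- The nets which vanish eventually. -/
def netIdeal (hj : IsLevyProcess Ω j) (κ : C →⋆ₐ[ℂ] B) : Ideal (NetAlg hj κ) where
  carrier := {T | ∀ᶠ γ in atTop, netEval hj κ γ T = 0}
  add_mem' := by
    intro a b ha hb
    filter_upwards [ha, hb] with γ ha hb
    rw [map_add, ha, hb, add_zero]
  zero_mem' := by simp
  smul_mem' := by
    intro a b hb
    filter_upwards [hb] with γ hb
    rw [smul_eq_mul, map_mul, hb, mul_zero]

instance (hj : IsLevyProcess Ω j) (κ : C →⋆ₐ[ℂ] B) : (netIdeal hj κ).IsTwoSided where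
  mul_mem_of_left := by
    intro a b ha
    change ∀ᶠ γ in atTop, netEval hj κ γ (a * b) = 0
    filter_upwards [show ∀ᶠ γ in atTop, netEval hj κ γ a = 0 from ha] with γ ha
    rw [map_mul, ha, zero_mul]

/-- The flow property of the `Θ_α` holds for those `α` which contain the intermediate time. -/
lemma eventually_increments (hj : IsLevyProcess Ω j) (κ : C →⋆ₐ[ℂ] B) {r s t : ℝ≥0} (hrs : r ≤ s)
    (hst : s ≤ t) (c : C) :
    ∀ᶠ γ in atTop, netEval hj κ γ ((toConv (lin (netAlgebraHom hj κ r s)) *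
      toConv (lin (netAlgebraHom hj κ s t))) c) =
      netEval hj κ γ (netAlgebraHom hj κ r t c) := by
  filter_upwards [eventually_ge_atTop {s}] with γ hγ
  have hs : s ∈ γ := hγ (Finset.mem_singleton_self s)
  have h1 : ∀ u v, (netEval hj κ γ).toLinearMap ∘ₗ lin (netAlgebraHom hj κ u v) =
      refined (transFamily j κ) γ u v := fun u v =>
    LinearMap.ext fun c => netEval_netAlgebraHom hj κ γ u v c
  have h2 := toConv_comp_convMul (netEval hj κ γ) (toConv (lin (netAlgebraHom hj κ r s)))
    (toConv (lin (netAlgebraHom hj κ s t)))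
  simp only [h1] at h2
  rw [refined_increments _ hrs hst hs] at h2
  rw [netEval_netAlgebraHom]
  exact LinearMap.congr_fun (toConv_injective h2) c

/-- Modulo the nets which vanish eventually, the nets `Θ_α` have the flow property. -/
lemma isFlow_mk_netAlgebraHom (hj : IsLevyProcess Ω j) (κ : C →⋆ₐ[ℂ] B) :
    IsFlow fun s t => (Ideal.Quotient.mkₐ ℂ (netIdeal hj κ)).toLinearMap ∘ₗ
      lin (netAlgebraHom hj κ s t) where
  map_one _ := by simp
  map_mul _ x y := by simp
  commute {r s t u} h1 h2 h3 c c' := by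
    refine Commute.map (f := Ideal.Quotient.mkₐ ℂ (netIdeal hj κ)) ?_
    refine netAlgebra_ext fun γ => ?_
    rw [map_mul, map_mul, lin_apply, lin_apply, netEval_netAlgebraHom, netEval_netAlgebraHom]
    exact hj.commute_of_mem h2 ((isLocal_transFamily j κ).refined hj γ h1 c)
      ((isLocal_transFamily j κ).refined hj γ h3 c')
  increments {r s t} hrs hst := by
    have h2 := toConv_comp_convMul (Ideal.Quotient.mkₐ ℂ (netIdeal hj κ))
      (toConv (lin (netAlgebraHom hj κ r s))) (toConv (lin (netAlgebraHom hj κ s t)))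
    refine h2.symm.trans (WithConv.ext (LinearMap.ext fun c => ?_))
    refine Ideal.Quotient.eq.2 ?_
    change ∀ᶠ γ in atTop, netEval hj κ γ _ = 0
    filter_upwards [eventually_increments hj κ hrs hst c] with γ hγ
    rw [map_sub, sub_eq_zero]
    exact hγ

lemma IsTimeOrdered.exists_of_comp {C A A' : Type*} [AddCommGroup C] [Module ℂ C] [Ring A]
    [Algebra ℂ A] [Ring A'] [Algebra ℂ A'] {F : ℝ≥0 → ℝ≥0 → C →ₗ[ℂ] A} {π : A →ₐ[ℂ] A'} {a e : ℝ≥0}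
    {y : A'} (h : IsTimeOrdered (fun s t => π.toLinearMap ∘ₗ F s t) a e y) :
    ∃ x, IsTimeOrdered F a e x ∧ π x = y := by
  induction h with
  | one h => exact ⟨1, .one h, map_one π⟩
  | cons h c hx ih =>
    obtain ⟨x, hx', rfl⟩ := ih
    exact ⟨_, .cons h c hx', by simp⟩

lemma IsTimeOrdered.map {C A A' : Type*} [AddCommGroup C] [Module ℂ C] [Ring A]
    [Algebra ℂ A] [Ring A'] [Algebra ℂ A'] {F : ℝ≥0 → ℝ≥0 → C →ₗ[ℂ] A} (π : A →ₐ[ℂ] A') {a e : ℝ≥0}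
    {x : A} (h : IsTimeOrdered F a e x) :
    IsTimeOrdered (fun s t => π.toLinearMap ∘ₗ F s t) a e (π x) := by
  induction h with
  | one h => rw [map_one]; exact .one h
  | cons h c hx ih => rw [map_mul]; exact .cons (F := fun s t => π.toLinearMap ∘ₗ F s t) h c ih

lemma map_timeSpan {C A A' : Type*} [AddCommGroup C] [Module ℂ C] [Ring A]
    [Algebra ℂ A] [Ring A'] [Algebra ℂ A'] (F : ℝ≥0 → ℝ≥0 → C →ₗ[ℂ] A) (π : A →ₐ[ℂ] A') (a e : ℝ≥0) :
    (timeSpan F a e).map π.toLinearMap = timeSpan (fun s t => π.toLinearMap ∘ₗ F s t) a e := by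
  rw [timeSpan, Submodule.map_span, timeSpan]
  congr 1
  ext y
  constructor
  · rintro ⟨x, hx, rfl⟩
    exact IsTimeOrdered.map π hx
  · intro hy
    obtain ⟨x, hx, rfl⟩ := IsTimeOrdered.exists_of_comp hy
    exact ⟨x, hx, rfl⟩

/-- Up to nets which vanish eventually, `netAlgebra` is spanned by time-ordered products. -/
lemma exists_timeSpan_eventuallyEq (hj : IsLevyProcess Ω j) (κ : C →⋆ₐ[ℂ] B)
    (T : NetAlg hj κ) :
    ∃ e, ∃ T' ∈ timeSpan (fun s t => lin (netAlgebraHom hj κ s t)) 0 e,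
      ∀ᶠ γ in atTop, netEval hj κ γ T = netEval hj κ γ T' := by
  let q := Ideal.Quotient.mkₐ ℂ (netIdeal hj κ)
  have hq : ∀ T : NetAlg hj κ, q T ∈ Algebra.adjoin ℂ {y | ∃ (s t : ℝ≥0) (c : C), s ≤ t ∧
      y = (q.toLinearMap ∘ₗ lin (netAlgebraHom hj κ s t)) c} := by
    rintro ⟨T, hT⟩
    induction hT using Algebra.adjoin_induction with
    | mem T hT =>
      obtain ⟨s, t, c, rfl⟩ := hT
      rcases le_total s t with hst | hst
      · exact Algebra.subset_adjoin ⟨s, t, c, hst, rfl⟩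
      · refine Algebra.subset_adjoin ⟨s, s, c, le_rfl, congrArg q (netAlgebra_ext fun γ => ?_)⟩
        change netEval hj κ γ (netAlgebraHom hj κ s t c) = netEval hj κ γ (netAlgebraHom hj κ s s c)
        rw [netEval_netAlgebraHom, netEval_netAlgebraHom, refined, refined, restr, restr,
          max_eq_left hst, max_self]
    | algebraMap r => exact Subalgebra.algebraMap_mem _ r
    | add x y hx' hy' hx hy => exact add_mem hx hy
    | mul x y hx' hy' hx hy => exact mul_mem hx hy
  obtain ⟨e, he⟩ := (isFlow_mk_netAlgebraHom hj κ).exists_mem_timeSpan_of_mem_adjoin (hq T)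
  rw [← map_timeSpan (fun s t => lin (netAlgebraHom hj κ s t)) q] at he
  obtain ⟨T', hT', h⟩ := he
  refine ⟨e, T', hT', ?_⟩
  have h1 : ∀ᶠ γ in atTop, netEval hj κ γ (T' - T) = 0 := Ideal.Quotient.eq.1 h
  filter_upwards [h1] with γ hγ
  rw [map_sub, sub_eq_zero] at hγ
  exact hγ.symm

omit [StarModule ℂ C] [StarBialgebra C] in
lemma IsLevyProcess.isIndependentFamily_transFamily (hj : IsLevyProcess Ω j) (κ : C →⋆ₐ[ℂ] B) :
    IsIndependentFamily (transFamily j κ) where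
  map_one {s t} _ := (congrArg (j s t) (map_one κ)).trans (map_one (j s t))
  map_mul {s t} _ x y := (congrArg (j s t) (map_mul κ x y)).trans (map_mul (j s t) _ _)
  commute {r s t u} h1 h2 h3 c c' :=
    hj.commutes r s t u h1 h3 (disjoint_Ioc_of_le h2) (κ c) (κ c')

lemma netEval_mem (hj : IsLevyProcess Ω j) (κ : C →⋆ₐ[ℂ] B) {a e : ℝ≥0} {T : NetAlg hj κ}
    (hT : T ∈ timeSpan (fun s t => lin (netAlgebraHom hj κ s t)) a e) (γ : Finset ℝ≥0) :
    netEval hj κ γ T ∈ timeSpan (transFamily j κ) a e := by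
  induction hT using Submodule.span_induction with
  | mem x hx =>
    replace hx : IsTimeOrdered _ a e x := hx
    have hF := hj.isIndependentFamily_transFamily κ
    induction hx with
    | one h => rw [map_one]; exact one_mem_timeSpan h
    | @cons a b e x h c hx ih =>
      rw [map_mul, lin_apply, netEval_netAlgebraHom]
      exact hF.concat_mem ((isPartition_restr γ h).stepConv_mem hF
        (fun u v huv c => apply_mem_timeSpan huv c) c) ih
  | zero => rw [map_zero]; exact zero_mem _
  | add x y _ _ hx hy => rw [map_add]; exact add_mem hx hy
  | smul r x _ hx => rw [map_smul]; exact Submodule.smul_mem _ _ hx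

omit [StarModule ℂ C] [StarBialgebra C] in
lemma timeSpan_transFamily_le (j : ℝ≥0 → ℝ≥0 → B →⋆ₐ[ℂ] La D) (κ : C →⋆ₐ[ℂ] B) (a e : ℝ≥0) :
    timeSpan (transFamily j κ) a e ≤ timeSpan (fun s t => lin (j s t)) a e := by
  refine Submodule.span_mono fun x hx => ?_
  replace hx : IsTimeOrdered _ a e x := hx
  induction hx with
  | one h => exact .one h
  | cons h c hx ih => exact .cons h (κ c) ih

/-- The nets of vectors `T_γ Ω` converge for all `T` in `netAlgebra`: for time-ordered products
the Gram matrix is a product of Gram matrices of the `Θ_α(c) Ω`. -/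
lemma cauchySeq_netEval (hj : IsLevyProcess Ω j) (hψ : HasGenerator Ω j ψ)
    (κ : C →⋆ₐ[ℂ] B) (hκ : ∀ c, Coalgebra.counit (R := ℂ) (κ c) = Coalgebra.counit (R := ℂ) c)
    (T : NetAlg hj κ) : CauchySeq fun γ => (netEval hj κ γ T).1 Ω := by
  have key : ∀ a e T, IsTimeOrdered (fun s t => lin (netAlgebraHom hj κ s t)) a e T →
      CauchySeq fun γ => (netEval hj κ γ T).1 Ω := by
    intro a e T hT
    induction hT with
    | one h =>
      simp only [map_one]
      exact cauchySeq_const _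
    | @cons a b e x h c hx ih =>
      obtain ⟨L, hL⟩ := exists_tendsto_inner_of_cauchySeq ih
      obtain ⟨L', hL'⟩ := exists_tendsto_inner_of_cauchySeq (cauchySeq_refined hj hψ κ hκ h c)
      refine cauchySeq_of_tendsto_inner (L := L' * L) ((hL'.mul hL).congr fun p => ?_)
      have hl := (isLocal_transFamily j κ).refined hj
      rw [map_mul, map_mul, lin_apply, netEval_netAlgebraHom, netEval_netAlgebraHom,
        hj.inner_mul_mul (hl p.1 h c) (hl p.2 h c)
          (timeSpan_transFamily_le j κ _ _ (netEval_mem hj κ hx.mem p.1))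
          (timeSpan_transFamily_le j κ _ _ (netEval_mem hj κ hx.mem p.2))]
  obtain ⟨e, T', hT', hev⟩ := exists_timeSpan_eventuallyEq hj κ T
  have h1 : CauchySeq fun γ => (netEval hj κ γ T').1 Ω := by
    clear hev
    induction hT' using Submodule.span_induction with
    | mem x hx => exact key _ _ x hx
    | zero =>
      simp only [map_zero]
      exact cauchySeq_const _
    | add x y _ _ hx hy =>
      simp only [map_add]
      exact hx.add hy
    | smul r x _ hx =>
      simp only [map_smul]
      exact (uniformContinuous_const_smul r).comp_cauchySeq hx
  have h2 : (fun γ => (netEval hj κ γ T).1 Ω) =ᶠ[atTop] fun γ => (netEval hj κ γ T').1 Ω := by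
    filter_upwards [hev] with γ hγ
    rw [hγ]
  rw [CauchySeq, map_congr h2]
  exact h1

end NetAlgebra

/-! ### Time-ordered products and nets of partitions -/

section TimeProd

variable {C : Type*} [Ring C] [StarRing C] [Bialgebra ℂ C]
variable {D : Type*} [NormedAddCommGroup D] [InnerProductSpace ℂ D]

lemma isTimeOrdered_timeProd {C : Type*} [Ring C] [Bialgebra ℂ C]
    (F : ℝ≥0 → ℝ≥0 → C →ₗ[ℂ] La D) {n : ℕ} (t : Fin (n + 1) → ℝ≥0)
    (c : Fin n → C) (ht : Monotone t) :
    IsTimeOrdered F (t 0) (t (Fin.last n)) (timeProd F t c) := by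
  induction n with
  | zero => exact .one le_rfl
  | succ n ih =>
    have h1 := ih (fun i => t i.succ) (fun i => c i.succ)
      (fun i k hik => ht (Fin.succ_le_succ_iff.2 hik))
    rw [timeProd, List.ofFn_succ, List.prod_cons]
    exact .cons (ht (Fin.zero_le _)) (c 0) h1

lemma IsTimeOrdered.exists_timeProd {C : Type*} [Ring C] [Bialgebra ℂ C]
    {F : ℝ≥0 → ℝ≥0 → C →ₗ[ℂ] La D} {a e : ℝ≥0} {x : La D}
    (h : IsTimeOrdered F a e x) :
    ∃ (n : ℕ) (t : Fin (n + 1) → ℝ≥0) (c : Fin n → C),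
      Monotone t ∧ t 0 = a ∧ x = timeProd F t c := by
  induction h with
  | @one a e h => exact ⟨0, fun _ => a, Fin.elim0, monotone_const, rfl, rfl⟩
  | @cons a b e x h c hx ih =>
    obtain ⟨n, t, c', ht, rfl, rfl⟩ := ih
    refine ⟨n + 1, Fin.cons a t, Fin.cons c c', ?_, rfl, ?_⟩
    · refine Fin.monotone_iff_le_succ.2 fun i => ?_
      refine Fin.cases ?_ (fun i => ?_) i
      · exact h
      · exact ht (Fin.castSucc_lt_succ (i := i)).le
    · rw [timeProd, timeProd, List.ofFn_succ, List.prod_cons]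
      rfl

lemma mem_processAlgebra_iff {k : ℝ≥0 → ℝ≥0 → C →⋆ₐ[ℂ] La D} {x : La D} :
    x ∈ processAlgebra k ↔ ∃ e, x ∈ timeSpan (fun s t => lin (k s t)) 0 e := by
  constructor
  · intro hx
    induction hx using Submodule.span_induction with
    | mem x hx =>
      obtain ⟨n, t, c, ht, h0, rfl⟩ := hx
      have h1 := (isTimeOrdered_timeProd (fun s t => lin (k s t)) t c ht).mem
      rw [h0] at h1
      exact ⟨_, h1⟩
    | zero => exact ⟨0, zero_mem _⟩
    | add x y _ _ hx hy =>
      obtain ⟨e, hx⟩ := hx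
      obtain ⟨e', hy⟩ := hy
      exact ⟨max e e', add_mem (timeSpan_mono_right (le_max_left _ _) hx)
        (timeSpan_mono_right (le_max_right _ _) hy)⟩
    | smul r x _ hx =>
      obtain ⟨e, hx⟩ := hx
      exact ⟨e, Submodule.smul_mem _ _ hx⟩
  · rintro ⟨e, he⟩
    refine Submodule.span_mono (fun x hx => ?_) he
    exact IsTimeOrdered.exists_timeProd hx

lemma coe_mem_transformSpace {B : Type*} [Ring B] [StarRing B] [Bialgebra ℂ B] {Ω : D}
    {j : ℝ≥0 → ℝ≥0 → B →⋆ₐ[ℂ] La D} {κ : C →⋆ₐ[ℂ] B} {a e : ℝ≥0} {x : La D}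
    (hx : x ∈ timeSpan (transFamily j κ) a e) :
    ((x.1 Ω : D) : UniformSpace.Completion D) ∈ transformSpace Ω j κ := by
  refine Submodule.le_topologicalClosure _ ?_
  induction hx using Submodule.span_induction with
  | mem x hx =>
    obtain ⟨n, t, c, ht, -, rfl⟩ := IsTimeOrdered.exists_timeProd hx
    exact Submodule.subset_span ⟨n, t, c, ht, rfl⟩
  | zero => exact zero_mem _
  | add x y _ _ hx hy =>
    have := add_mem hx hy
    rwa [← UniformSpace.Completion.coe_add] at this
  | smul r x _ hx =>
    have := Submodule.smul_mem _ r hx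
    rwa [← UniformSpace.Completion.coe_smul] at this

end TimeProd

section Nets

variable {X : Type*}

instance (s t : ℝ≥0) : IsDirectedOrder (IntervalPartition s t) where
  directed α β := ⟨⟨α.1 ∪ β.1, Finset.mem_union_left _ α.2.1, Finset.mem_union_left _ α.2.2.1,
    fun x hx => (Finset.mem_union.1 hx).elim (α.2.2.2 x) (β.2.2.2 x)⟩,
    Finset.subset_union_left, Finset.subset_union_right⟩

lemma IntervalPartition.nonempty {s t : ℝ≥0} (hst : s ≤ t) : Nonempty (IntervalPartition s t) :=
  ⟨{s, t}, by simp, by simp, by simp [hst]⟩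

lemma neBot_atTop_intervalPartition {s t : ℝ≥0} (hst : s ≤ t) :
    (atTop : Filter (IntervalPartition s t)).NeBot :=
  have := IntervalPartition.nonempty hst
  inferInstance

lemma neBot_atTop_pi_intervalPartition {n : ℕ} {t : Fin (n + 1) → ℝ≥0} (ht : Monotone t) :
    (atTop : Filter ((i : Fin n) → IntervalPartition (t i.castSucc) (t i.succ))).NeBot :=
  have := fun i : Fin n => IntervalPartition.nonempty (ht (Fin.castSucc_lt_succ (i := i)).le)
  have : IsDirectedOrder ((i : Fin n) → IntervalPartition (t i.castSucc) (t i.succ)) :=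
    ⟨fun α β => by
      choose γ h1 h2 using fun i => exists_ge_ge (α i) (β i)
      exact ⟨γ, h1, h2⟩⟩
  inferInstance

lemma IntervalPartition.isPartition {s t : ℝ≥0} (α : IntervalPartition s t) :
    IsPartition s t α.1 := α.2

lemma IsPartition.restr_union_eq {s t : ℝ≥0} {α γ : Finset ℝ≥0} (hα : IsPartition s t α)
    (h : ∀ x ∈ γ, s ≤ x → x ≤ t → x ∈ α) : restr (γ ∪ α) s t = α := by
  ext x
  rw [mem_restr hα.le, Finset.mem_union]
  constructor
  · rintro (rfl | rfl | ⟨hx | hx, h1, h2⟩)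
    exacts [hα.1, hα.2.1, h x hx h1 h2, hx]
  · exact fun hx => Or.inr (Or.inr ⟨Or.inr hx, hα.2.2 x hx⟩)

/-- Limits along the finite subsets of `ℝ≥0` are limits along the partitions of an interval. -/
lemma tendsto_intervalPartition {s t : ℝ≥0} (hst : s ≤ t) {f : Finset ℝ≥0 → X} {l : Filter X}
    (hf : Tendsto f atTop l) {g : IntervalPartition s t → X}
    (hfg : ∀ γ α, restr γ s t = α.1 → f γ = g α) : Tendsto g atTop l := by
  intro U hU
  obtain ⟨γ₀, hγ₀⟩ := mem_atTop_sets.1 (hf hU)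
  let α₀ : IntervalPartition s t := ⟨restr γ₀ s t, isPartition_restr γ₀ hst⟩
  refine mem_map.2 <| mem_of_superset (Ici_mem_atTop α₀) fun α hα => ?_
  replace hα : restr γ₀ s t ⊆ α.1 := hα
  have h1 : restr (γ₀ ∪ α.1) s t = α.1 := α.isPartition.restr_union_eq fun x hx h1 h2 =>
    hα ((mem_restr hst).2 (by tauto))
  change g α ∈ U
  rw [← hfg _ α h1]
  exact hγ₀ _ Finset.subset_union_left

/-- Limits along the finite subsets of `ℝ≥0` are joint limits along the partitions of consecutive
intervals. -/
lemma tendsto_pi_intervalPartition {n : ℕ} {t : Fin (n + 1) → ℝ≥0} (ht : Monotone t)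
    {f : Finset ℝ≥0 → X} {l : Filter X} (hf : Tendsto f atTop l)
    {g : ((i : Fin n) → IntervalPartition (t i.castSucc) (t i.succ)) → X}
    (hfg : ∀ γ α, (∀ i, restr γ (t i.castSucc) (t i.succ) = (α i).1) → f γ = g α) :
    Tendsto g atTop l := by
  have hle : ∀ i : Fin n, t i.castSucc ≤ t i.succ := fun i => ht (Fin.castSucc_lt_succ (i := i)).le
  intro U hU
  obtain ⟨γ₀, hγ₀⟩ := mem_atTop_sets.1 (hf hU)
  let α₀ : (i : Fin n) → IntervalPartition (t i.castSucc) (t i.succ) :=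
    fun i => ⟨restr γ₀ _ _, isPartition_restr γ₀ (hle i)⟩
  refine mem_map.2 <| mem_of_superset (Ici_mem_atTop α₀) fun α hα => ?_
  replace hα : ∀ i, restr γ₀ _ _ ⊆ (α i).1 := hα
  let γ := γ₀ ∪ Finset.univ.biUnion fun i => (α i).1
  have h1 : ∀ i, restr γ (t i.castSucc) (t i.succ) = (α i).1 := fun i => by
    have h2 : γ = γ ∪ (α i).1 := (Finset.union_eq_left.2 (Finset.subset_union_right.trans'
      (Finset.subset_biUnion_of_mem (fun i => (α i).1) (Finset.mem_univ i)))).symm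
    rw [h2]
    refine (α i).isPartition.restr_union_eq fun x hx hx1 hx2 => ?_
    rcases Finset.mem_union.1 hx with hx | hx
    · exact hα i ((mem_restr (hle i)).2 (by tauto))
    · obtain ⟨l, -, hl⟩ := Finset.mem_biUnion.1 hx
      obtain ⟨h3, h4⟩ := (α l).2.2.2 x hl
      rcases lt_trichotomy l i with h | rfl | h
      · have h5 : t l.succ ≤ t i.castSucc := ht (Fin.succ_le_castSucc_iff.2 h)
        rw [le_antisymm (h4.trans h5) hx1]
        exact (α i).2.1
      · exact hl
      · have h5 : t i.succ ≤ t l.castSucc := ht (Fin.succ_le_castSucc_iff.2 h)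
        rw [le_antisymm hx2 (h5.trans h3)]
        exact (α i).2.2.1
  change g α ∈ U
  rw [← hfg _ α h1]
  exact hγ₀ _ Finset.subset_union_left

end Nets

/-! ### The limit process -/

section LimitProcess

variable {B : Type*} [Ring B] [StarRing B] [Bialgebra ℂ B]
variable {C : Type*} [Ring C] [StarRing C] [Bialgebra ℂ C] [StarModule ℂ C] [StarBialgebra C]
variable {D : Type*} [NormedAddCommGroup D] [InnerProductSpace ℂ D]
variable {Ω : D} {j : ℝ≥0 → ℝ≥0 → B →⋆ₐ[ℂ] La D} {ψ : B →ₗ[ℂ] ℂ} {κ : C →⋆ₐ[ℂ] B}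

/-- A representation `π` of the algebra of nets on a subspace of the completion of `D`, for which
`π(T) Ω` is the limit of `T_γ Ω` and which is generated by the vector `Ω`. -/
structure IsLimitRep (hj : IsLevyProcess Ω j) (κ : C →⋆ₐ[ℂ] B)
    (Dk : Submodule ℂ (UniformSpace.Completion D)) (hΩ : (Ω : UniformSpace.Completion D) ∈ Dk)
    (π : NetAlg hj κ →⋆ₐ[ℂ] La Dk) : Prop where
  tendsto : ∀ T, Tendsto (fun γ => (((netEval hj κ γ T).1 Ω : D) : UniformSpace.Completion D)) atTop
    (𝓝 ((π T).1 ⟨Ω, hΩ⟩ : Dk))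
  cyclic : ∀ ξ : Dk, ∃ T, (π T).1 ⟨Ω, hΩ⟩ = ξ

/-- The limit vectors exist, and the representation is the one of the GNS construction. -/
theorem exists_isLimitRep (hj : IsLevyProcess Ω j) (hψ : HasGenerator Ω j ψ) (κ : C →⋆ₐ[ℂ] B)
    (hκ : ∀ c, Coalgebra.counit (R := ℂ) (κ c) = Coalgebra.counit (R := ℂ) c) :
    ∃ Dk hΩ π, IsLimitRep hj κ Dk hΩ π := by
  choose w hw using fun T => exists_tendsto_completion (cauchySeq_netEval hj hψ κ hκ T)
  let v : NetAlg hj κ →ₗ[ℂ] UniformSpace.Completion D :=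
    { toFun := w
      map_add' := fun T T' => tendsto_nhds_unique (hw (T + T')) 
        (((hw T).add (hw T')).congr fun γ => by
          rw [map_add]
          exact (UniformSpace.Completion.coe_add _ _).symm)
      map_smul' := fun r T => tendsto_nhds_unique (hw (r • T)) 
        (((hw T).const_smul r).congr fun γ => by
          rw [map_smul]
          exact (UniformSpace.Completion.coe_smul _ _).symm) }
  have hinner : ∀ x y, Tendsto (fun γ => vacuum Ω (netEval hj κ γ (star x * y))) atTop
      (𝓝 (inner ℂ (v x) (v y))) := fun x y => by
    refine ((hw x).inner (𝕜 := ℂ) (hw y)).congr fun γ => ?_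
    rw [UniformSpace.Completion.inner_coe, map_mul, netEval_star, vacuum_star_mul]
  obtain ⟨π, hπ⟩ := exists_starHom_range v fun x y z => tendsto_nhds_unique (hinner _ _) (by
    simpa only [star_mul, mul_assoc] using hinner y (star x * z))
  have h1 : v 1 = Ω := tendsto_nhds_unique (hw 1) (by
    simp only [map_one]
    exact tendsto_const_nhds)
  have hΩ : (Ω : UniformSpace.Completion D) ∈ LinearMap.range v := ⟨1, h1⟩
  have h2 : (⟨Ω, hΩ⟩ : LinearMap.range v) = v.rangeRestrict 1 := Subtype.ext h1.symm
  refine ⟨LinearMap.range v, hΩ, π, fun T => ?_, fun ξ => ?_⟩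
  · rw [h2, hπ, mul_one]
    exact hw T
  · obtain ⟨T, hT⟩ := v.surjective_rangeRestrict ξ
    exact ⟨T, by rw [h2, hπ, mul_one, hT]⟩

/-- The process on `C` given by a representation of the algebra of nets. -/
def limitProcess {hj : IsLevyProcess Ω j} {E : Type*} [NormedAddCommGroup E]
    [InnerProductSpace ℂ E] (π : NetAlg hj κ →⋆ₐ[ℂ] La E) (s t : ℝ≥0) : C →⋆ₐ[ℂ] La E :=
  π.comp (netAlgebraHom hj κ s t)

lemma limitProcess_apply {hj : IsLevyProcess Ω j} {E : Type*} [NormedAddCommGroup E]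
    [InnerProductSpace ℂ E] (π : NetAlg hj κ →⋆ₐ[ℂ] La E) (s t : ℝ≥0) (c : C) :
    limitProcess π s t c = π (netAlgebraHom hj κ s t c) := rfl

lemma timeProd_eq_of_comp {hj : IsLevyProcess Ω j} {E : Type*} [NormedAddCommGroup E]
    [InnerProductSpace ℂ E] (π : NetAlg hj κ →⋆ₐ[ℂ] La E) {k : ℝ≥0 → ℝ≥0 → C →⋆ₐ[ℂ] La E}
    (hk : ∀ s t c, k s t c = π (netAlgebraHom hj κ s t c)) {n : ℕ} (t : Fin (n + 1) → ℝ≥0)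
    (c : Fin n → C) :
    timeProd (fun u v => lin (k u v)) t c =
      π (List.ofFn fun i : Fin n => netAlgebraHom hj κ (t i.castSucc) (t i.succ) (c i)).prod := by
  rw [map_list_prod, List.map_ofFn, timeProd]
  simp only [lin_apply, hk]
  rfl

lemma netAlgebraHom_self (hj : IsLevyProcess Ω j) (κ : C →⋆ₐ[ℂ] B) (s : ℝ≥0) (c : C) :
    netAlgebraHom hj κ s s c = algebraMap ℂ _ (Coalgebra.counit (R := ℂ) c) :=
  netAlgebra_ext fun γ => by
    rw [netEval_netAlgebraHom, AlgHom.commutes]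
    exact LinearMap.congr_fun (toConv_injective (toConv_refined_self (transFamily j κ) γ s)) c

lemma commute_netAlgebraHom (hj : IsLevyProcess Ω j) {s t s' t' : ℝ≥0} (hst : s ≤ t) (hst' : s' ≤ t')
    (hd : Disjoint (Set.Ioc s t) (Set.Ioc s' t')) (c c' : C) :
    Commute (netAlgebraHom hj κ s t c) (netAlgebraHom hj κ s' t' c') := by
  have hle : ∀ {s t s' t' : ℝ≥0}, s ≤ t → s' ≤ t' → t ≤ s' → ∀ c c' : C,
      Commute (netAlgebraHom hj κ s t c) (netAlgebraHom hj κ s' t' c') := by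
    intro s t s' t' hst hst' hts c c'
    refine netAlgebra_ext fun γ => ?_
    rw [map_mul, map_mul, netEval_netAlgebraHom, netEval_netAlgebraHom]
    exact hj.commute_of_mem hts ((isLocal_transFamily j κ).refined hj γ hst c)
      ((isLocal_transFamily j κ).refined hj γ hst' c')
  rw [Set.Ioc_disjoint_Ioc] at hd
  -- for an empty interval the increment is a scalar
  rcases hst.eq_or_lt with rfl | h1
  · rw [netAlgebraHom_self]
    exact Algebra.commutes _ _
  rcases hst'.eq_or_lt with rfl | h2
  · rw [netAlgebraHom_self]
    exact (Algebra.commutes _ _).symm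
  rcases le_total t t' with h3 | h3
  · rw [min_eq_left h3] at hd
    exact hle hst hst' ((le_max_iff.1 hd).resolve_left (not_le.2 h1)) c c'
  · rw [min_eq_right h3] at hd
    exact (hle hst' hst ((le_max_iff.1 hd).resolve_right (not_le.2 h2)) c' c).symm

lemma isIndependentFamily_netAlgebraHom (hj : IsLevyProcess Ω j) (κ : C →⋆ₐ[ℂ] B) :
    IsIndependentFamily fun s t => lin (netAlgebraHom hj κ s t) where
  map_one {s t} _ := map_one (netAlgebraHom hj κ s t)
  map_mul {s t} _ x y := map_mul (netAlgebraHom hj κ s t) x y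
  commute h1 h2 h3 c c' := commute_netAlgebraHom hj h1 h3 (disjoint_Ioc_of_le h2) c c'

namespace IsLimitRep

variable {hj : IsLevyProcess Ω j} {Dk : Submodule ℂ (UniformSpace.Completion D)}
  {hΩ : (Ω : UniformSpace.Completion D) ∈ Dk} {π : NetAlg hj κ →⋆ₐ[ℂ] La Dk}

lemma tendsto_vacuum (h : IsLimitRep hj κ Dk hΩ π) (T : NetAlg hj κ) :
    Tendsto (fun γ => vacuum Ω (netEval hj κ γ T)) atTop
      (𝓝 (vacuum (⟨Ω, hΩ⟩ : Dk) (π T))) := by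
  refine ((tendsto_const_nhds (x := (Ω : UniformSpace.Completion D))).inner (𝕜 := ℂ)
    (h.tendsto T)).congr fun γ => ?_
  rw [UniformSpace.Completion.inner_coe]
  rfl

/-- The representation depends only on the tails of the nets. -/
lemma congr (h : IsLimitRep hj κ Dk hΩ π) {T T' : NetAlg hj κ}
    (hT : ∀ᶠ γ in atTop, netEval hj κ γ T = netEval hj κ γ T') : π T = π T' := by
  refine Subtype.ext (LinearMap.ext fun ξ => ?_)
  obtain ⟨S, rfl⟩ := h.cyclic ξ
  rw [← La.mul_apply, ← La.mul_apply, ← map_mul, ← map_mul]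
  refine Subtype.ext (tendsto_nhds_unique (h.tendsto (T * S)) ((h.tendsto (T' * S)).congr' ?_))
  filter_upwards [hT] with γ hγ
  rw [map_mul, map_mul, hγ]

lemma tendsto_distr (h : IsLimitRep hj κ Dk hΩ π) (s t : ℝ≥0) (c : C) :
    Tendsto (fun γ => vacuum Ω (refined (transFamily j κ) γ s t c)) atTop
      (𝓝 (distr (⟨Ω, hΩ⟩ : Dk) (limitProcess π) s t c)) := by
  refine (h.tendsto_vacuum (netAlgebraHom hj κ s t c)).congr fun γ => ?_
  rw [netEval_netAlgebraHom]

lemma distr_eq (h : IsLimitRep hj κ Dk hΩ π) (hψ : HasGenerator Ω j ψ)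
    (hκ : ∀ c, Coalgebra.counit (R := ℂ) (κ c) = Coalgebra.counit (R := ℂ) c) {s t : ℝ≥0}
    (hst : s ≤ t) : distr (⟨Ω, hΩ⟩ : Dk) (limitProcess π) s t = convExp (ψ ∘ₗ lin κ) (t - s) := by
  ext c
  obtain ⟨r, -, hr⟩ := exists_vacuum_refined_bound hj hψ κ hκ t c
  refine tendsto_nhds_unique (h.tendsto_distr s t c) (tendsto_iff_norm_sub_tendsto_zero.2 ?_)
  refine squeeze_zero (fun _ => norm_nonneg _) (fun γ => hr γ s t hst le_rfl) ?_
  simpa using (tendsto_sum_sq_steps hst).const_mul r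

lemma hasGenerator (h : IsLimitRep hj κ Dk hΩ π) (hψ : HasGenerator Ω j ψ)
    (hκ : ∀ c, Coalgebra.counit (R := ℂ) (κ c) = Coalgebra.counit (R := ℂ) c) :
    HasGenerator (⟨Ω, hΩ⟩ : Dk) (limitProcess π) (ψ ∘ₗ lin κ) := fun t c => by
  rw [h.distr_eq hψ hκ zero_le, NNReal.coe_zero, sub_zero]
  exact hasSum_convExp _ _ c

/-- The limit process is a Lévy process. -/
theorem levy (h : IsLimitRep hj κ Dk hΩ π) (hψ : HasGenerator Ω j ψ)
    (hκ : ∀ c, Coalgebra.counit (R := ℂ) (κ c) = Coalgebra.counit (R := ℂ) c) :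
    IsLevyProcess (⟨Ω, hΩ⟩ : Dk) (limitProcess π) where
  norm_vacuum := by
    change ‖(Ω : UniformSpace.Completion D)‖ = 1
    rw [UniformSpace.Completion.norm_coe, hj.norm_vacuum]
  factorizes n s t c hst hd := by
    have h1 : (List.ofFn fun i => limitProcess π (s i) (t i) (c i)).prod =
        π (List.ofFn fun i => netAlgebraHom hj κ (s i) (t i) (c i)).prod := by
      rw [map_list_prod, List.map_ofFn]
      rfl
    rw [h1]
    refine tendsto_nhds_unique (h.tendsto_vacuum _)
      ((tendsto_finsetProd _ fun i _ => h.tendsto_distr (s i) (t i) (c i)).congr fun γ => ?_)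
    have h2 := hj.vacuum_prod_of_mem
      (List.ofFn fun i => (s i, t i, refined (transFamily j κ) γ (s i) (t i) (c i)))
      (by
        intro p hp
        obtain ⟨i, rfl⟩ := (List.mem_ofFn' _ _).1 hp
        exact (isLocal_transFamily j κ).refined hj γ (hst i) (c i))
      (by
        rw [List.map_ofFn, List.pairwise_ofFn]
        exact fun i l hil => hd hil.ne)
    rw [List.map_ofFn, List.map_ofFn, List.prod_ofFn] at h2
    rw [map_list_prod, List.map_ofFn]
    simp only [Function.comp_def, netEval_netAlgebraHom] at h2 ⊢
    exact h2.symm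
  commutes s t s' t' hst hst' hd c c' := (commute_netAlgebraHom hj hst hst' hd c c').map π
  stationary s t hst := by
    rw [h.distr_eq hψ hκ hst, h.distr_eq hψ hκ zero_le, NNReal.coe_sub hst, NNReal.coe_zero,
      sub_zero]
  continuous c := by
    simp only [h.distr_eq hψ hκ zero_le, NNReal.coe_zero, sub_zero]
    exact tendsto_convExp_zero _ c
  increments r s t hrs hst := by
    refine (toConv_comp_convMul π.toAlgHom (toConv (lin (netAlgebraHom hj κ r s)))
      (toConv (lin (netAlgebraHom hj κ s t)))).symm.trans ?_
    exact WithConv.ext (LinearMap.ext fun c => h.congr (eventually_increments hj κ hrs hst c))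
  diagonal t c := by
    rw [limitProcess_apply, netAlgebraHom_self, AlgHomClass.commutes π]

lemma exists_timeSpan (h : IsLimitRep hj κ Dk hΩ π) (ξ : Dk) :
    ∃ e, ∃ T ∈ timeSpan (fun s t => lin (netAlgebraHom hj κ s t)) 0 e, (π T).1 ⟨Ω, hΩ⟩ = ξ := by
  obtain ⟨T, rfl⟩ := h.cyclic ξ
  obtain ⟨e, T', hT', hev⟩ := exists_timeSpan_eventuallyEq hj κ T
  exact ⟨e, T', hT', by rw [h.congr hev]⟩

lemma isCyclic (h : IsLimitRep hj κ Dk hΩ π) :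
    IsCyclicProcess (⟨Ω, hΩ⟩ : Dk) (limitProcess π) := fun ξ => by
  obtain ⟨e, T, hT, rfl⟩ := h.exists_timeSpan ξ
  refine ⟨π T, mem_processAlgebra_iff.2 ⟨e, ?_⟩, rfl⟩
  have h1 := Submodule.mem_map_of_mem (f := π.toAlgHom.toLinearMap) hT
  rw [map_timeSpan] at h1
  exact h1

lemma le_transformSpace (h : IsLimitRep hj κ Dk hΩ π) : Dk ≤ transformSpace Ω j κ := by
  intro ξ hξ
  obtain ⟨e, T, hT, h1⟩ := h.exists_timeSpan ⟨ξ, hξ⟩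
  have h2 := h.tendsto T
  rw [h1] at h2
  exact (Submodule.isClosed_topologicalClosure _).mem_of_tendsto h2
    (Eventually.of_forall fun γ => coe_mem_transformSpace (netEval_mem hj κ hT γ))

/-- The limit process is the transform of `j`. -/
theorem isTransform (h : IsLimitRep hj κ Dk hΩ π) (hψ : HasGenerator Ω j ψ)
    (hκ : ∀ c, Coalgebra.counit (R := ℂ) (κ c) = Coalgebra.counit (R := ℂ) c) :
    IsTransform Ω j κ Dk hΩ (limitProcess π) where
  levy := h.levy hψ hκ
  cyclic := h.isCyclic
  limit s t c hst := by
    have h1 : ∀ (γ : Finset ℝ≥0) (α : IntervalPartition s t), restr γ s t = α.1 →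
        netEval hj κ γ (netAlgebraHom hj κ s t c) = transProd j κ α c := fun γ α hα => by
      rw [netEval_netAlgebraHom, refined, hα]
      rfl
    have h2 := h.tendsto (netAlgebraHom hj κ s t c)
    rw [← limitProcess_apply] at h2
    exact tendsto_intervalPartition hst h2 fun γ α hα => by rw [h1 γ α hα]
  limit_prod n t c ht := by
    have h2 : ∀ (γ : Finset ℝ≥0)
        (α : (i : Fin n) → IntervalPartition (t i.castSucc) (t i.succ)),
        (∀ i, restr γ (t i.castSucc) (t i.succ) = (α i).1) →
        netEval hj κ γ (List.ofFn fun i : Fin n =>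
          netAlgebraHom hj κ (t i.castSucc) (t i.succ) (c i)).prod =
        (List.ofFn fun i => transProd j κ (α i) (c i)).prod := fun γ α hα => by
      rw [map_list_prod, List.map_ofFn]
      simp only [Function.comp_def, netEval_netAlgebraHom, refined, hα]
      rfl
    have h3 := h.tendsto (List.ofFn fun i : Fin n =>
      netAlgebraHom hj κ (t i.castSucc) (t i.succ) (c i)).prod
    rw [← timeProd_eq_of_comp π (limitProcess_apply π)] at h3
    exact tendsto_pi_intervalPartition ht h3 fun γ α hα => by rw [h2 γ α hα]

end IsLimitRep

end LimitProcess

/-! ### Unitary equivalence and uniqueness -/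

section Equivalence

variable {C : Type*} [Ring C] [StarRing C] [Bialgebra ℂ C]
variable {D₁ : Type*} [NormedAddCommGroup D₁] [InnerProductSpace ℂ D₁]
variable {D₂ : Type*} [NormedAddCommGroup D₂] [InnerProductSpace ℂ D₂]
variable {Ω₁ : D₁} {Ω₂ : D₂} {k₁ : ℝ≥0 → ℝ≥0 → C →⋆ₐ[ℂ] La D₁} {k₂ : ℝ≥0 → ℝ≥0 → C →⋆ₐ[ℂ] La D₂}

/-- The family of the pairs of increments of two processes. -/
def pairFamily (k₁ : ℝ≥0 → ℝ≥0 → C →⋆ₐ[ℂ] La D₁) (k₂ : ℝ≥0 → ℝ≥0 → C →⋆ₐ[ℂ] La D₂)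
    (s t : ℝ≥0) : C →ₗ[ℂ] La D₁ × La D₂ := (lin (k₁ s t)).prod (lin (k₂ s t))

lemma isFlow_pairFamily (h₁ : IsLevyProcess Ω₁ k₁) (h₂ : IsLevyProcess Ω₂ k₂) :
    IsFlow (A := La D₁ × La D₂) (pairFamily k₁ k₂) where
  map_one h := Prod.ext (h₁.isFlow.map_one h) (h₂.isFlow.map_one h)
  map_mul h x y := Prod.ext (h₁.isFlow.map_mul h x y) (h₂.isFlow.map_mul h x y)
  commute hr hs ht c c' := Prod.ext (h₁.isFlow.commute hr hs ht c c') (h₂.isFlow.commute hr hs ht c c')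
  increments {r s t} hr hs := by
    have e1 := toConv_comp_convMul (AlgHom.fst ℂ (La D₁) (La D₂))
      (toConv (pairFamily k₁ k₂ r s)) (toConv (pairFamily k₁ k₂ s t))
    have e2 := toConv_comp_convMul (AlgHom.snd ℂ (La D₁) (La D₂))
      (toConv (pairFamily k₁ k₂ r s)) (toConv (pairFamily k₁ k₂ s t))
    have e3 := e1.trans (h₁.increments r s t hr hs)
    have e4 := e2.trans (h₂.increments r s t hr hs)
    exact WithConv.ext (LinearMap.ext fun c => Prod.ext
      (LinearMap.congr_fun (toConv_injective e3) c) (LinearMap.congr_fun (toConv_injective e4) c))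

lemma timeSpan_le_adjoin {C A : Type*} [AddCommGroup C] [Module ℂ C] [Ring A] [Algebra ℂ A]
    (F : ℝ≥0 → ℝ≥0 → C →ₗ[ℂ] A) (a e : ℝ≥0) :
    timeSpan F a e ≤ Subalgebra.toSubmodule
      (Algebra.adjoin ℂ {y | ∃ (s t : ℝ≥0) (c : C), s ≤ t ∧ y = F s t c}) := by
  refine Submodule.span_le.2 fun x hx => ?_
  replace hx : IsTimeOrdered F a e x := hx
  induction hx with
  | one h => exact one_mem (Algebra.adjoin ℂ _)
  | cons h c hx ih => exact mul_mem (S := Subalgebra ℂ A) (Algebra.subset_adjoin ⟨_, _, c, h, rfl⟩) ih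

/-- The vacuum expectations of time-ordered products are determined by the distributions. -/
lemma vacuum_fst_eq_snd (h₁ : IsLevyProcess Ω₁ k₁) (h₂ : IsLevyProcess Ω₂ k₂)
    (hd : ∀ s t, s ≤ t → distr Ω₁ k₁ s t = distr Ω₂ k₂ s t) {a e : ℝ≥0} {x : La D₁ × La D₂}
    (hx : x ∈ timeSpan (A := La D₁ × La D₂) (pairFamily k₁ k₂) a e) : vacuum Ω₁ x.1 = vacuum Ω₂ x.2 := by
  induction hx using Submodule.span_induction with
  | mem x hx =>
    replace hx : IsTimeOrdered _ a e x := hx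
    induction hx with
    | one h =>
      exact (vacuum_one h₁.norm_vacuum).trans (vacuum_one h₂.norm_vacuum).symm
    | @cons a b e x h c hx ih =>
      have m1 : x.1 ∈ timeSpan (fun s t => lin (k₁ s t)) b e :=
        (IsTimeOrdered.map (AlgHom.fst ℂ (La D₁) (La D₂)) hx).mem
      have m2 : x.2 ∈ timeSpan (fun s t => lin (k₂ s t)) b e :=
        (IsTimeOrdered.map (AlgHom.snd ℂ (La D₁) (La D₂)) hx).mem
      have e1 := h₁.vacuum_mul (apply_mem_timeSpan (F := fun s t => lin (k₁ s t)) h c) m1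
      have e2 := h₂.vacuum_mul (apply_mem_timeSpan (F := fun s t => lin (k₂ s t)) h c) m2
      refine e1.trans (Eq.trans ?_ e2.symm)
      rw [ih]
      exact congrArg (· * _) (LinearMap.congr_fun (hd a b h) c)
  | zero => exact (map_zero _).trans (map_zero _).symm
  | add x y _ _ hx hy =>
    rw [Prod.fst_add, Prod.snd_add, map_add, map_add, hx, hy]
  | smul r x _ hx => rw [Prod.smul_fst, Prod.smul_snd, map_smul, map_smul, hx]

/-- Cyclic Lévy processes with the same distributions are unitarily equivalent. -/
theorem exists_linearIsometryEquiv (h₁ : IsLevyProcess Ω₁ k₁) (h₂ : IsLevyProcess Ω₂ k₂)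
    (hc₁ : IsCyclicProcess Ω₁ k₁) (hc₂ : IsCyclicProcess Ω₂ k₂)
    (hd : ∀ s t, s ≤ t → distr Ω₁ k₁ s t = distr Ω₂ k₂ s t) :
    ∃ U : D₁ ≃ₗᵢ[ℂ] D₂, U Ω₁ = Ω₂ ∧
      ∀ s t, s ≤ t → ∀ c x, U ((k₁ s t c).1 x) = (k₂ s t c).1 (U x) := by
  have hF := isFlow_pairFamily h₁ h₂
  let S := Algebra.adjoin ℂ {y | ∃ (s t : ℝ≥0) (c : C), s ≤ t ∧ y = pairFamily k₁ k₂ s t c}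
  have hnorm : ∀ x ∈ S, ‖x.1.1 Ω₁‖ = ‖x.2.1 Ω₂‖ := fun x hx => by
    obtain ⟨e, he⟩ := hF.exists_mem_timeSpan_of_mem_adjoin hx
    have h3 := vacuum_fst_eq_snd h₁ h₂ hd (hF.mul_mem (hF.star_mem
      (fun {s t} _ c => Prod.ext (map_star (k₁ s t) c) (map_star (k₂ s t) c)) he) he)
    have h4 : inner ℂ (x.1.1 Ω₁) (x.1.1 Ω₁) = inner ℂ (x.2.1 Ω₂) (x.2.1 Ω₂) :=
      (vacuum_star_mul Ω₁ x.1 x.1).symm.trans (h3.trans (vacuum_star_mul Ω₂ x.2 x.2))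
    rw [inner_self_eq_norm_sq_to_K, inner_self_eq_norm_sq_to_K] at h4
    exact (pow_left_inj₀ (norm_nonneg _) (norm_nonneg _) two_ne_zero).1 (by exact_mod_cast h4)
  have hs₁ : ∀ ξ, ∃ x ∈ S, x.1.1 Ω₁ = ξ := fun ξ => by
    obtain ⟨T, hT, rfl⟩ := hc₁ ξ
    obtain ⟨e, he⟩ := mem_processAlgebra_iff.1 hT
    obtain ⟨x, hx, rfl⟩ := (map_timeSpan (A := La D₁ × La D₂) (pairFamily k₁ k₂)
      (AlgHom.fst ℂ (La D₁) (La D₂)) 0 e).ge he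
    exact ⟨x, timeSpan_le_adjoin _ _ _ hx, rfl⟩
  have hs₂ : ∀ ξ, ∃ x ∈ S, x.2.1 Ω₂ = ξ := fun ξ => by
    obtain ⟨T, hT, rfl⟩ := hc₂ ξ
    obtain ⟨e, he⟩ := mem_processAlgebra_iff.1 hT
    obtain ⟨x, hx, rfl⟩ := (map_timeSpan (A := La D₁ × La D₂) (pairFamily k₁ k₂)
      (AlgHom.snd ℂ (La D₁) (La D₂)) 0 e).ge he
    exact ⟨x, timeSpan_le_adjoin _ _ _ hx, rfl⟩
  -- the unitary is `x.1 Ω₁ ↦ x.2 Ω₂` for `x ∈ S`; `hnorm` shows that it is well defined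
  have huniq : ∀ x ∈ S, ∀ y ∈ S, x.1.1 Ω₁ = y.1.1 Ω₁ → x.2.1 Ω₂ = y.2.1 Ω₂ :=
    fun x hx y hy h => by
      have h3 := hnorm (x - y) (sub_mem hx hy)
      have h4 : ‖x.1.1 Ω₁ - y.1.1 Ω₁‖ = ‖x.2.1 Ω₂ - y.2.1 Ω₂‖ := h3
      rw [h, sub_self, norm_zero] at h4
      exact sub_eq_zero.1 (norm_eq_zero.1 h4.symm)
  choose X hX hXΩ using hs₁
  have hval : ∀ x ∈ S, (X (x.1.1 Ω₁)).2.1 Ω₂ = x.2.1 Ω₂ := fun x hx =>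
    huniq _ (hX _) x hx (hXΩ _)
  let V : D₁ →ₗᵢ[ℂ] D₂ :=
    { toFun := fun ξ => (X ξ).2.1 Ω₂
      map_add' := fun ξ η => huniq _ (hX _) (X ξ + X η) (add_mem (hX _) (hX _)) (by
        change _ = (X ξ).1.1 Ω₁ + (X η).1.1 Ω₁
        rw [hXΩ, hXΩ, hXΩ])
      map_smul' := fun r ξ => huniq _ (hX _) (r • X ξ) (Subalgebra.smul_mem S (hX _) r) (by
        change _ = r • (X ξ).1.1 Ω₁
        rw [hXΩ, hXΩ])
      norm_map' := fun ξ => by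
        change ‖(X ξ).2.1 Ω₂‖ = ‖ξ‖
        rw [← hnorm _ (hX ξ), hXΩ] }
  have hV : ∀ x ∈ S, V (x.1.1 Ω₁) = x.2.1 Ω₂ := hval
  refine ⟨LinearIsometryEquiv.ofSurjective V fun ξ => ?_, hV 1 (one_mem S),
    fun s t hst c ξ => ?_⟩
  · obtain ⟨x, hx, rfl⟩ := hs₂ ξ
    exact ⟨x.1.1 Ω₁, hV x hx⟩
  · change V ((k₁ s t c).1 ξ) = (k₂ s t c).1 (V ξ)
    have h3 := hV (pairFamily k₁ k₂ s t c * X ξ)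
      (mul_mem (Algebra.subset_adjoin ⟨s, t, c, hst, rfl⟩) (hX ξ))
    have h4 : V ((k₁ s t c).1 ((X ξ).1.1 Ω₁)) = (k₂ s t c).1 ((X ξ).2.1 Ω₂) := h3
    rwa [hXΩ] at h4

lemma map_timeProd {U : D₁ ≃ₗᵢ[ℂ] D₂} (hU : U Ω₁ = Ω₂)
    (hk : ∀ s t, s ≤ t → ∀ c x, U ((k₁ s t c).1 x) = (k₂ s t c).1 (U x)) {n : ℕ}
    {t : Fin (n + 1) → ℝ≥0} (ht : Monotone t) (c : Fin n → C) :
    U ((timeProd (D := D₁) (fun u v => lin (k₁ u v)) t c).1 Ω₁) =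
      (timeProd (D := D₂) (fun u v => lin (k₂ u v)) t c).1 Ω₂ := by
  induction n with
  | zero => exact hU
  | succ n ih =>
    have h1 := ih (t := fun i => t i.succ) (fun i k hik => ht (Fin.succ_le_succ_iff.2 hik))
      (fun i => c i.succ)
    rw [timeProd, timeProd, List.ofFn_succ, List.ofFn_succ, List.prod_cons, List.prod_cons,
      La.mul_apply, La.mul_apply]
    refine (hk _ _ (ht (Fin.zero_le _)) (c 0) _).trans ?_
    exact congrArg _ h1

section Transform

variable {B : Type*} [Ring B] [StarRing B] [Bialgebra ℂ B]
variable {D : Type*} [NormedAddCommGroup D] [InnerProductSpace ℂ D]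
variable {Ω : D} {j : ℝ≥0 → ℝ≥0 → B →⋆ₐ[ℂ] La D} {κ : C →⋆ₐ[ℂ] B}
  {Dk D' : Submodule ℂ (UniformSpace.Completion D)} {hΩ : (Ω : UniformSpace.Completion D) ∈ Dk}
  {hΩ' : (Ω : UniformSpace.Completion D) ∈ D'} {k : ℝ≥0 → ℝ≥0 → C →⋆ₐ[ℂ] La Dk}
  {k' : ℝ≥0 → ℝ≥0 → C →⋆ₐ[ℂ] La D'}

/-- The transform of a process is determined by its limit relations. -/
theorem IsTransform.unique (h : IsTransform Ω j κ Dk hΩ k) (h' : IsTransform Ω j κ D' hΩ' k') :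
    D' = Dk ∧ ∀ (s t : ℝ≥0), s ≤ t → ∀ (c : C) (x : Dk) (x' : D'),
      (x : UniformSpace.Completion D) = x' →
      ((k s t c).1 x : UniformSpace.Completion D) = (k' s t c).1 x' := by
  have hd : ∀ s t, s ≤ t → distr (⟨Ω, hΩ⟩ : Dk) k s t = distr (⟨Ω, hΩ'⟩ : D') k' s t := by
    intro s t hst
    ext c
    have := neBot_atTop_intervalPartition hst
    have h1 := tendsto_nhds_unique (h.limit s t c hst) (h'.limit s t c hst)
    exact congrArg (fun v : UniformSpace.Completion D => inner ℂ (Ω : UniformSpace.Completion D) v) h1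
  obtain ⟨U, hU, hk⟩ := exists_linearIsometryEquiv h.levy h'.levy h.cyclic h'.cyclic hd
  have hcoe : ∀ x : Dk, (U x : UniformSpace.Completion D) = x := fun x => by
    obtain ⟨T, hT, rfl⟩ := h.cyclic x
    induction hT using Submodule.span_induction with
    | mem T hT =>
      obtain ⟨n, t, c, ht, -, rfl⟩ := hT
      have := neBot_atTop_pi_intervalPartition ht
      rw [map_timeProd hU hk ht]
      exact tendsto_nhds_unique (h'.limit_prod n t c ht) (h.limit_prod n t c ht)
    | zero => exact congrArg Subtype.val (map_zero U)
    | add T S _ _ hT hS =>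
      refine (congrArg Subtype.val (map_add U _ _)).trans ?_
      exact congrArg₂ (· + ·) hT hS
    | smul r T _ hT =>
      refine (congrArg Subtype.val (map_smul U r _)).trans ?_
      exact congrArg (r • ·) hT
  refine ⟨le_antisymm (fun x hx => ?_) (fun x hx => ?_), fun s t hst c x x' hx => ?_⟩
  · have h1 := hcoe (U.symm ⟨x, hx⟩)
    rw [U.apply_symm_apply] at h1
    change x = _ at h1
    rw [h1]
    exact Subtype.prop _
  · have h1 := hcoe ⟨x, hx⟩
    change _ = x at h1
    rw [← h1]
    exact Subtype.prop _
  · have h1 : U x = x' := Subtype.ext ((hcoe x).trans hx)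
    rw [← hcoe, hk s t hst, h1]

end Transform

end Equivalence

/-! ### The projection of the induced tensor bialgebra -/

section Projection

/-- The canonical projection of the induced tensor bialgebra onto `B`. -/
def InducedTensor.toBialgebra (B : Type*) [Ring B] [Bialgebra ℂ B] :
    InducedTensor B →ₐc[ℂ] B :=
  BialgHom.ofAlgHom (InducedTensor.lift (augIdeal B).subtype)
    (InducedTensor.hom_ext fun b => by
      have h : Coalgebra.counit (R := ℂ) (b : B) = 0 := b.2
      have h' : Coalgebra.counit (R := ℂ) (InducedTensor.ι b) = (0 : ℂ) :=
        InducedTensor.lift_ι 0 b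
      simp [h, h'])
    (InducedTensor.hom_ext fun b => by
      have key : ∀ x : B ⊗[ℂ] B, Algebra.TensorProduct.map
          (InducedTensor.lift (augIdeal B).subtype) (InducedTensor.lift (augIdeal B).subtype)
          (TensorProduct.map InducedTensor.incl InducedTensor.incl x) = x := fun x => by
        have h1 : ∀ b : B, InducedTensor.lift (augIdeal B).subtype (InducedTensor.incl b) = b :=
          fun b => by
            conv_rhs => rw [InducedTensor.proj_decomp b]
            simp [InducedTensor.incl, Algebra.smul_def]
        induction x with
        | zero => simp
        | add x y hx hy => rw [map_add, map_add, hx, hy]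
        | tmul x y => simp [h1]
      have h2 := InducedTensor.comulHom_incl (b : B)
      rw [InducedTensor.incl_coe] at h2
      have h3 := key (Coalgebra.comul (R := ℂ) (b : B))
      rw [← h2] at h3
      refine h3.trans ?_
      simp)

variable {B : Type*} [Ring B] [Bialgebra ℂ B]

lemma InducedTensor.toBialgebra_ι (b : augIdeal B) :
    InducedTensor.toBialgebra B (InducedTensor.ι b) = b := InducedTensor.lift_ι _ b

lemma InducedTensor.toBialgebra_incl (b : B) :
    InducedTensor.toBialgebra B (InducedTensor.incl b) = b := by
  conv_rhs => rw [InducedTensor.proj_decomp b]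
  have h1 := map_one (InducedTensor.toBialgebra B)
  rw [InducedTensor.incl, LinearMap.add_apply, map_add, LinearMap.comp_apply, LinearMap.comp_apply,
    InducedTensor.toBialgebra_ι, Algebra.linearMap_apply, Algebra.algebraMap_eq_smul_one, map_smul,
    h1]

end Projection

section Section

variable {B : Type*} [Ring B] [StarRing B] [Bialgebra ℂ B] [StarModule ℂ B] [StarBialgebra B]
variable {C : Type*} [Ring C] [StarRing C] [Algebra ℂ C] [StarModule ℂ C]

/-- A surjective `*`-homomorphism has a linear section on `B₀` which preserves the involution: the
hermitian part of an arbitrary linear section. -/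
lemma exists_star_section {κ : C →⋆ₐ[ℂ] B} (hs : Function.Surjective κ) :
    ∃ ν : augIdeal B →ₗ[ℂ] C, (∀ b, ν (star b) = star (ν b)) ∧ ∀ b, κ (ν b) = b := by
  obtain ⟨σ, hσ⟩ := (lin κ).exists_rightInverse_of_surjective (LinearMap.range_eq_top.2 hs)
  have hσ' : ∀ b, κ (σ b) = b := fun b => LinearMap.congr_fun hσ b
  have h2 : star (2⁻¹ : ℂ) = 2⁻¹ := by simp
  let ν : augIdeal B →ₗ[ℂ] C :=
    { toFun := fun b => (2⁻¹ : ℂ) • (σ b + star (σ (star (b : B))))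
      map_add' := fun x y => by
        rw [Submodule.coe_add, star_add, map_add, map_add, star_add, ← smul_add]
        congr 1
        abel
      map_smul' := fun r x => by
        rw [Submodule.coe_smul, star_smul, map_smul, map_smul, star_smul, star_star, ← smul_add,
          smul_comm]
        rfl }
  refine ⟨ν, fun b => ?_, fun b => ?_⟩
  · change (2⁻¹ : ℂ) • (σ (star (b : B)) + star (σ (star (star (b : B))))) =
      star ((2⁻¹ : ℂ) • (σ b + star (σ (star (b : B)))))
    rw [star_smul, h2, star_add, star_star, star_star, add_comm]
  · change κ ((2⁻¹ : ℂ) • (σ b + star (σ (star (b : B))))) = b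
    rw [map_smul, map_add, map_star, hσ', hσ', star_star, ← two_smul ℂ, smul_smul]
    norm_num

/-- `κ ∘ 𝓣(ν)` is the canonical projection, if `ν` is a section of `κ`. -/
lemma comp_starLift {κ : C →⋆ₐ[ℂ] B} {ν : augIdeal B →ₗ[ℂ] C}
    (hν : ∀ b, ν (star b) = star (ν b)) (hκν : ∀ b, κ (ν b) = b) (x : InducedTensor B) :
    κ (InducedTensor.starLift ν hν x) = InducedTensor.toBialgebra B x := by
  have h : κ.toAlgHom.comp (InducedTensor.lift ν) = InducedTensor.lift (augIdeal B).subtype :=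
    InducedTensor.hom_ext fun b => by
      rw [AlgHom.comp_apply, InducedTensor.lift_ι, InducedTensor.lift_ι]
      exact hκν b
  exact DFunLike.congr_fun h x

end Section

/-! ### Convergence of the reverse transformation -/

/-- A net converges to `v` if it does so in norm and in the inner product with `v`. -/
lemma tendsto_of_tendsto_inner {ι H : Type*} [NormedAddCommGroup H] [InnerProductSpace ℂ H]
    {l : Filter ι} {u : ι → H} {v : H}
    (h₁ : Tendsto (fun i => inner ℂ (u i) (u i)) l (𝓝 (inner ℂ v v)))
    (h₂ : Tendsto (fun i => inner ℂ v (u i)) l (𝓝 (inner ℂ v v))) : Tendsto u l (𝓝 v) := by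
  rw [tendsto_iff_norm_sub_tendsto_zero]
  have h3 := ((Complex.continuous_re.tendsto _).comp h₁).sub
    (((Complex.continuous_re.tendsto _).comp h₂).const_mul 2)
  have h4 : Tendsto (fun i => ‖u i - v‖ ^ 2) l (𝓝 0) := by
    have h5 := h3.add_const (Complex.re (inner ℂ v v))
    convert h5 using 2 with i
    · rw [norm_sub_rev, @norm_sub_sq ℂ, norm_sq_eq_re_inner (𝕜 := ℂ),
        norm_sq_eq_re_inner (𝕜 := ℂ) (u i)]
      simp only [Function.comp_apply, RCLike.re_eq_complex_re]
      ring
    · ring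
  have h5 := h4.sqrt
  simpa [Real.sqrt_sq] using h5

lemma map_stepConv {C A A' : Type*} [AddCommGroup C] [Module ℂ C] [Coalgebra ℂ C] [Ring A]
    [Algebra ℂ A] [Ring A'] [Algebra ℂ A'] (π : A →ₐ[ℂ] A') (F : ℝ≥0 → ℝ≥0 → C →ₗ[ℂ] A)
    (α : Finset ℝ≥0) (x : C) :
    π (stepConv F α x) = stepConv (fun u v => π.toLinearMap ∘ₗ F u v) α x := by
  have h := toConv_comp_list_prod π ((steps α).map fun p => toConv (F p.1 p.2))
  rw [List.map_map] at h
  exact LinearMap.congr_fun (toConv_injective h) x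

section Reverse

variable {B : Type*} [Ring B] [StarRing B] [Bialgebra ℂ B]
variable {C : Type*} [Ring C] [StarRing C] [Bialgebra ℂ C]
variable {X : Type*} [Ring X] [StarRing X] [Bialgebra ℂ X]
variable {D : Type*} [NormedAddCommGroup D] [InnerProductSpace ℂ D]
variable {Ω : D} {j : ℝ≥0 → ℝ≥0 → B →⋆ₐ[ℂ] La D} {ψ : B →ₗ[ℂ] ℂ} {κ : C →⋆ₐ[ℂ] B}

/-- If `κ ∘ κ'` is a morphism `p` of bialgebras, then the vacuum expectations of
`j_{s,t}(b)` times the products of the `Θ ∘ κ'` are close to those of `j_{s,t}(b) j_{s,t}(p(x))`. -/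
lemma exists_vacuum_pairing_stepConv_bound (hj : IsLevyProcess Ω j) (hψ : HasGenerator Ω j ψ)
    (hκ : ∀ c, Coalgebra.counit (R := ℂ) (κ c) = Coalgebra.counit (R := ℂ) c)
    {κ' : X →⋆ₐ[ℂ] C} {p : X →ₐc[ℂ] B} (hp : ∀ x, κ (κ' x) = p x) (T : ℝ≥0) (b : B) (x : X) :
    ∃ r : ℝ, 0 ≤ r ∧ ∀ (γ : Finset ℝ≥0) (s t : ℝ≥0) (α : Finset ℝ≥0), IsPartition s t α → t ≤ T →
      ‖vacuum Ω (j s t b *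
          stepConv (fun u v => refined (transFamily j κ) γ u v ∘ₗ lin κ') α x) -
        convExp ψ (t - s) (b * p x)‖ ≤
        r * ((steps α).map fun p => ((p.2 : ℝ) - p.1) ^ 2).sum := by
  let i : B ⊗[ℂ] X →ₗ[ℂ] B ⊗[ℂ] C := TensorProduct.map LinearMap.id (lin κ')
  have hκ' : ∀ x, Coalgebra.counit (R := ℂ) (κ' x) = Coalgebra.counit (R := ℂ) x := fun x => by
    rw [← hκ, hp]
    exact CoalgHomClass.counit_comp_apply p x
  have hi : ∀ z, Coalgebra.counit (R := ℂ) (i z) = Coalgebra.counit (R := ℂ) z := fun z => by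
    induction z with
    | zero => simp
    | add z w hz hw => simp only [map_add, hz, hw]
    | tmul b c => simp [i, hκ']
  let q : B ⊗[ℂ] X →ₗc[ℂ] B := (Bialgebra.mulCoalgHom ℂ B).comp
    (Coalgebra.TensorProduct.map (CoalgHom.id ℂ B) (p : X →ₗc[ℂ] B))
  have hq : ∀ z, pairing LinearMap.id (lin κ) (i z) = q z := fun z => by
    induction z with
    | zero => simp
    | add z w hz hw => simp only [map_add, hz, hw]
    | tmul b x =>
      change b * κ (κ' x) = b * p x
      rw [hp]
  choose r hr0 hr using fun z => exists_vacuum_pairing_bound hj hψ κ hκ T (i z)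
  obtain ⟨c, hc, h⟩ := exists_stepConv_bound (ψ ∘ₗ q.toLinearMap) r T (b ⊗ₜ x)
  refine ⟨c, hc, fun γ s t α hα ht => ?_⟩
  let G : ℝ≥0 → ℝ≥0 → X →ₗ[ℂ] La D := fun u v => refined (transFamily j κ) γ u v ∘ₗ lin κ'
  have hG : IsLocal j G := fun u v huv x => (isLocal_transFamily j κ).refined hj γ huv (κ' x)
  have h1 := h (fun u v => vacuum Ω ∘ₗ pairing (lin (j u v)) (G u v)) s t α hα ht
    fun u v huv hv z => by
      have h2 := hr z γ u v huv hv
      rw [hi, hq] at h2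
      have h3 : pairing (lin (j u v)) (G u v) z =
          pairing (lin (j u v)) (refined (transFamily j κ) γ u v) (i z) := by
        clear * -
        induction z with
        | zero => simp
        | add z w hz hw => simp only [map_add, hz, hw]
        | tmul b c => rfl
      rw [LinearMap.comp_apply, h3]
      exact h2
  rw [← ((isLocal_self j).pairing hj hG).vacuum_stepConv hj hα,
    ← (isLocal_self j).pairing_stepConv hj hG hα, hj.stepConv_eq hα, convExp_comp] at h1
  exact h1

end Reverse

namespace IsLimitRep

variable {B : Type*} [Ring B] [StarRing B] [Bialgebra ℂ B]
variable {C : Type*} [Ring C] [StarRing C] [Bialgebra ℂ C] [StarModule ℂ C] [StarBialgebra C]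
variable {X : Type*} [Ring X] [StarRing X] [Bialgebra ℂ X] [StarModule ℂ X] [StarBialgebra X]
variable {D : Type*} [NormedAddCommGroup D] [InnerProductSpace ℂ D]
variable {Ω : D} {j : ℝ≥0 → ℝ≥0 → B →⋆ₐ[ℂ] La D} {ψ : B →ₗ[ℂ] ℂ} {κ : C →⋆ₐ[ℂ] B}
  {hj : IsLevyProcess Ω j} {Dk : Submodule ℂ (UniformSpace.Completion D)}
  {hΩ : (Ω : UniformSpace.Completion D) ∈ Dk} {π : NetAlg hj κ →⋆ₐ[ℂ] La Dk}
  {κ' : X →⋆ₐ[ℂ] C} {p : X →ₐc[ℂ] B}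

lemma tendsto_inner (h : IsLimitRep hj κ Dk hΩ π) (x : La D) (T : NetAlg hj κ) :
    Tendsto (fun γ => vacuum Ω (star x * netEval hj κ γ T)) atTop
      (𝓝 (inner ℂ ((x.1 Ω : D) : UniformSpace.Completion D)
        ((π T).1 ⟨Ω, hΩ⟩ : UniformSpace.Completion D))) := by
  refine ((tendsto_const_nhds (x := ((x.1 Ω : D) : UniformSpace.Completion D))).inner (𝕜 := ℂ)
    (h.tendsto T)).congr fun γ => ?_
  rw [UniformSpace.Completion.inner_coe, vacuum_star_mul]

/-- The convolution products of `k ∘ κ'`, where `κ ∘ κ'` is a morphism of bialgebras, approximate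
`j` at the vacuum. -/
theorem tendsto_stepConv (h : IsLimitRep hj κ Dk hΩ π) (hψ : HasGenerator Ω j ψ)
    (hκ : ∀ c, Coalgebra.counit (R := ℂ) (κ c) = Coalgebra.counit (R := ℂ) c)
    (hp : ∀ x, κ (κ' x) = p x) (x : X) {s t : ℝ≥0} (hst : s ≤ t) :
    Tendsto (fun α : IntervalPartition s t =>
      ((π (stepConv (fun u v => lin (netAlgebraHom hj κ u v) ∘ₗ lin κ') α.1 x)).1 ⟨Ω, hΩ⟩ :
        UniformSpace.Completion D)) atTop (𝓝 ((j s t (p x)).1 Ω : D)) := by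
  have hκ' : ∀ x, Coalgebra.counit (R := ℂ) (κ' x) = Coalgebra.counit (R := ℂ) x := fun x => by
    rw [← hκ, hp]
    exact CoalgHomClass.counit_comp_apply p x
  have hsum := tendsto_intervalPartition hst (tendsto_sum_sq_steps hst)
    (g := fun α => ((steps α.1).map fun p => ((p.2 : ℝ) - p.1) ^ 2).sum)
    (fun γ α hα => by rw [hα])
  have hk := h.levy hψ hκ
  have hπ : ∀ α : IntervalPartition s t, ∀ x,
      π (stepConv (fun u v => lin (netAlgebraHom hj κ u v) ∘ₗ lin κ') α.1 x) =
        refinedHom hk κ' α.1 s t x := fun α x => by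
    rw [refinedHom_apply, refined, α.isPartition.restr_eq]
    exact map_stepConv π.toAlgHom _ _ _
  have hps : star (p x) = p (star x) := by rw [← hp, ← hp, map_star, map_star]
  have hv : inner ℂ (((j s t (p x)).1 Ω : D) : UniformSpace.Completion D)
      (((j s t (p x)).1 Ω : D) : UniformSpace.Completion D) =
      convExp ψ (t - s) (p (star x) * p x) := by
    rw [UniformSpace.Completion.inner_coe, ← vacuum_star_mul, ← map_star, ← map_mul,
      ← hj.distr_eq hψ hst, hps]
    rfl
  -- both the squared norms and the inner products with `j_{s,t}(p(x)) Ω` tend to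
  -- `e_⋆^{(t-s)ψ}(p(x)* p(x)) = ‖j_{s,t}(p(x)) Ω‖²`
  refine tendsto_of_tendsto_inner ?_ ?_
  · rw [hv]
    obtain ⟨r, -, hr⟩ := exists_vacuum_refined_bound hk (h.hasGenerator hψ hκ) κ' hκ' t (star x * x)
    refine tendsto_iff_norm_sub_tendsto_zero.2 (squeeze_zero (fun _ => norm_nonneg _)
      (fun α => ?_) (by simpa using hsum.const_mul r))
    have h1 := hr α.1 s t hst le_rfl
    have h2 : (ψ ∘ₗ lin κ) ∘ₗ lin κ' = ψ ∘ₗ (p : X →ₗc[ℂ] B).toLinearMap :=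
      LinearMap.ext fun x => congrArg ψ (hp x)
    have h3 : (p : X →ₗc[ℂ] B) (star x * x) = p (star x) * p x := map_mul p _ _
    rw [α.isPartition.restr_eq, h2, convExp_comp, ← refinedHom_apply hk, map_mul (refinedHom _ _ _ _ _),
      map_star, vacuum_star_mul, ← hπ, h3] at h1
    exact h1
  · rw [hv]
    obtain ⟨r, -, hr⟩ := exists_vacuum_pairing_stepConv_bound hj hψ hκ hp t (p (star x)) x
    refine tendsto_iff_norm_sub_tendsto_zero.2 (squeeze_zero (fun _ => norm_nonneg _)
      (fun α => ?_) (by simpa using hsum.const_mul r))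
    have h1 := h.tendsto_inner (j s t (p x))
      (stepConv (fun u v => lin (netAlgebraHom hj κ u v) ∘ₗ lin κ') α.1 x)
    refine le_of_tendsto (h1.sub_const _).norm (Eventually.of_forall fun γ => ?_)
    have h2 := hr γ s t α.1 α.isPartition le_rfl
    have h3 : netEval hj κ γ (stepConv (fun u v => lin (netAlgebraHom hj κ u v) ∘ₗ lin κ') α.1 x) =
        stepConv (fun u v => refined (transFamily j κ) γ u v ∘ₗ lin κ') α.1 x := by
      rw [map_stepConv]
      congr 2
      funext u v
      exact LinearMap.ext fun x => netEval_netAlgebraHom hj κ γ u v (κ' x)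
    rw [h3, ← map_star, hps]
    exact h2

/-- The error of an approximation of `x y Ω` is controlled by the errors for `x Ω` and `y Ω`, as
vectors over consecutive intervals multiply like elementary tensors. -/
lemma norm_sub_le (h : IsLimitRep hj κ Dk hΩ π) {a b e : ℝ≥0} {S T : NetAlg hj κ} {x y : La D}
    (hS : S ∈ timeSpan (fun s t => lin (netAlgebraHom hj κ s t)) a b)
    (hT : T ∈ timeSpan (fun s t => lin (netAlgebraHom hj κ s t)) b e)
    (hx : x ∈ timeSpan (fun s t => lin (j s t)) a b)
    (hy : y ∈ timeSpan (fun s t => lin (j s t)) b e) :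
    ‖((π (S * T)).1 ⟨Ω, hΩ⟩ : UniformSpace.Completion D) - (((x * y).1 Ω : D) :)‖ ≤
      ‖((π S).1 ⟨Ω, hΩ⟩ : UniformSpace.Completion D)‖ *
        ‖((π T).1 ⟨Ω, hΩ⟩ : UniformSpace.Completion D) - ((y.1 Ω : D) :)‖ +
      ‖((π S).1 ⟨Ω, hΩ⟩ : UniformSpace.Completion D) - ((x.1 Ω : D) :)‖ * ‖y.1 Ω‖ := by
  refine le_of_tendsto_of_tendsto ((h.tendsto (S * T)).sub_const _).norm
    (((h.tendsto S).norm.mul ((h.tendsto T).sub_const _).norm).add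
      (((h.tendsto S).sub_const _).norm.mul_const _)) (Eventually.of_forall fun γ => ?_)
  simp only [← UniformSpace.Completion.coe_sub, UniformSpace.Completion.norm_coe]
  have hS' := timeSpan_transFamily_le j κ _ _ (netEval_mem hj κ hS γ)
  have hT' := timeSpan_transFamily_le j κ _ _ (netEval_mem hj κ hT γ)
  have h1 := hj.norm_mul hS' (sub_mem hT' hy)
  have h2 := hj.norm_mul (sub_mem hS' hx) hy
  have h3 : netEval hj κ γ (S * T) - x * y = netEval hj κ γ S * (netEval hj κ γ T - y) +
      (netEval hj κ γ S - x) * y := by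
    rw [map_mul, mul_sub, sub_mul]
    abel
  have h4 : (netEval hj κ γ (S * T)).1 Ω - (x * y).1 Ω =
      (netEval hj κ γ S * (netEval hj κ γ T - y)).1 Ω + ((netEval hj κ γ S - x) * y).1 Ω :=
    congrArg (fun z : La D => z.1 Ω) h3
  rw [h4]
  exact (norm_add_le _ _).trans_eq (congrArg₂ (· + ·) h1 h2)

/-- If `κ ∘ κ'` is a surjective morphism of bialgebras, then all vectors generated by `j` from the
vacuum are approximated by the limit vectors. -/
theorem exists_norm_sub_lt (h : IsLimitRep hj κ Dk hΩ π) (hψ : HasGenerator Ω j ψ)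
    (hκ : ∀ c, Coalgebra.counit (R := ℂ) (κ c) = Coalgebra.counit (R := ℂ) c)
    (hp : ∀ x, κ (κ' x) = p x) (hs : Function.Surjective p) {a e : ℝ≥0} {y : La D}
    (hy : IsTimeOrdered (fun s t => lin (j s t)) a e y) :
    ∀ ε > 0, ∃ S ∈ timeSpan (fun s t => lin (netAlgebraHom hj κ s t)) a e,
      ‖((π S).1 ⟨Ω, hΩ⟩ : UniformSpace.Completion D) - ((y.1 Ω : D) :)‖ < ε := by
  induction hy with
  | one hae =>
    refine fun ε hε => ⟨1, one_mem_timeSpan hae, ?_⟩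
    rw [map_one]
    change ‖(Ω : UniformSpace.Completion D) - (Ω : UniformSpace.Completion D)‖ < ε
    rwa [sub_self, norm_zero]
  | @cons a b e y hab c hy ih =>
    intro ε hε
    obtain ⟨x, rfl⟩ := hs c
    have hlim := h.tendsto_stepConv hψ hκ hp x hab
    have := neBot_atTop_intervalPartition hab
    set w : UniformSpace.Completion D := (((j a b (p x)).1 Ω : D) : UniformSpace.Completion D) with hw
    obtain ⟨T, hT, hTε⟩ := ih (ε / (2 * (‖w‖ + 1))) (by positivity)
    have hδ : 0 < min 1 (ε / (2 * (‖y.1 Ω‖ + 1))) := by positivity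
    obtain ⟨α, hα⟩ := (hlim.eventually (Metric.ball_mem_nhds _ hδ)).exists
    have hS := α.isPartition.stepConv_mem (isIndependentFamily_netAlgebraHom hj κ)
      (f := fun u v => lin (netAlgebraHom hj κ u v) ∘ₗ lin κ')
      (fun u v huv x => apply_mem_timeSpan
        (F := fun u v => lin (netAlgebraHom hj κ u v)) huv (κ' x)) x
    set S := stepConv (fun u v => lin (netAlgebraHom hj κ u v) ∘ₗ lin κ') α.1 x
    rw [dist_eq_norm, lt_min_iff] at hα
    refine ⟨S * T, (isIndependentFamily_netAlgebraHom hj κ).concat_mem hS hT, ?_⟩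
    refine (h.norm_sub_le hS hT (apply_mem_timeSpan (F := fun s t => lin (j s t)) hab (p x))
      hy.mem).trans_lt ?_
    have h1 : ‖((π S).1 ⟨Ω, hΩ⟩ : UniformSpace.Completion D)‖ ≤ ‖w‖ + 1 := by
      have := norm_sub_norm_le ((π S).1 ⟨Ω, hΩ⟩ : UniformSpace.Completion D) w
      linarith [hα.1]
    have h2 : ‖((π S).1 ⟨Ω, hΩ⟩ : UniformSpace.Completion D)‖ *
        ‖((π T).1 ⟨Ω, hΩ⟩ : UniformSpace.Completion D) - ((y.1 Ω : D) :)‖ < ε / 2 := by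
      refine (mul_le_mul_of_nonneg_right h1 (norm_nonneg _)).trans_lt ?_
      rw [lt_div_iff₀ (by positivity)] at hTε
      linarith
    have h3 : ‖((π S).1 ⟨Ω, hΩ⟩ : UniformSpace.Completion D) - w‖ * ‖y.1 Ω‖ ≤ ε / 2 := by
      have h4 := hα.2
      rw [lt_div_iff₀ (by positivity)] at h4
      nlinarith [norm_nonneg (((π S).1 ⟨Ω, hΩ⟩ : UniformSpace.Completion D) - w)]
    exact (add_lt_add_of_lt_of_le h2 h3).trans_eq (add_halves ε)

end IsLimitRep

/-! ### Density -/

section Density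

variable {B : Type*} [Ring B] [StarRing B] [Bialgebra ℂ B]
variable {C : Type*} [Ring C] [StarRing C] [Bialgebra ℂ C]
variable {D : Type*} [NormedAddCommGroup D] [InnerProductSpace ℂ D]
variable {Ω : D} {j : ℝ≥0 → ℝ≥0 → B →⋆ₐ[ℂ] La D} {κ : C →⋆ₐ[ℂ] B}

lemma eq_top_of_forall_coe_mem {P : Submodule ℂ (UniformSpace.Completion D)}
    (hP : IsClosed (P : Set (UniformSpace.Completion D)))
    (h : ∀ x : D, (x : UniformSpace.Completion D) ∈ P) : P = ⊤ :=
  Submodule.eq_top_iff'.2 fun v => UniformSpace.Completion.induction_on v hP h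

lemma transformSpace_eq_top (hcyc : IsCyclicProcess Ω j) (hs : Function.Surjective κ) :
    transformSpace Ω j κ = ⊤ := by
  refine eq_top_of_forall_coe_mem (Submodule.isClosed_topologicalClosure _) fun x => ?_
  obtain ⟨T, hT, rfl⟩ := hcyc x
  obtain ⟨e, he⟩ := mem_processAlgebra_iff.1 hT
  refine coe_mem_transformSpace (a := 0) (e := e) (Submodule.span_mono (fun T hT => ?_) he)
  replace hT : IsTimeOrdered _ 0 e T := hT
  generalize (0 : ℝ≥0) = a at hT ⊢
  clear * - hs hT
  induction hT with
  | one h => exact .one h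
  | cons h b hx ih =>
    obtain ⟨c, rfl⟩ := hs b
    exact .cons (F := transFamily j κ) h c ih

/-- If `κ ∘ κ'` is a surjective morphism of bialgebras, then `Dk` is dense. -/
lemma IsLimitRep.topologicalClosure_eq_top [StarModule ℂ C] [StarBialgebra C]
    {X : Type*} [Ring X] [StarRing X] [Bialgebra ℂ X] [StarModule ℂ X] [StarBialgebra X]
    {ψ : B →ₗ[ℂ] ℂ}
    {hj : IsLevyProcess Ω j} {Dk : Submodule ℂ (UniformSpace.Completion D)}
    {hΩ : (Ω : UniformSpace.Completion D) ∈ Dk} {π : NetAlg hj κ →⋆ₐ[ℂ] La Dk}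
    {κ' : X →⋆ₐ[ℂ] C} {p : X →ₐc[ℂ] B}
    (h : IsLimitRep hj κ Dk hΩ π) (hcyc : IsCyclicProcess Ω j) (hψ : HasGenerator Ω j ψ)
    (hκ : ∀ c, Coalgebra.counit (R := ℂ) (κ c) = Coalgebra.counit (R := ℂ) c)
    (hp : ∀ x, κ (κ' x) = p x) (hs : Function.Surjective p) : Dk.topologicalClosure = ⊤ := by
  refine eq_top_of_forall_coe_mem (Submodule.isClosed_topologicalClosure _) fun x => ?_
  obtain ⟨T, hT, rfl⟩ := hcyc x
  obtain ⟨e, he⟩ := mem_processAlgebra_iff.1 hT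
  clear hT
  induction he using Submodule.span_induction with
  | mem T hT =>
    refine Metric.mem_closure_iff.2 fun ε hε => ?_
    obtain ⟨S, -, hS⟩ := h.exists_norm_sub_lt hψ hκ hp hs hT ε hε
    exact ⟨_, Subtype.prop ((π S).1 ⟨Ω, hΩ⟩), by rwa [dist_comm, dist_eq_norm]⟩
  | zero => exact zero_mem _
  | add T S _ _ hT hS =>
    have := add_mem hT hS
    rwa [← UniformSpace.Completion.coe_add] at this
  | smul r T _ hT =>
    have := Submodule.smul_mem _ r hT
    rwa [← UniformSpace.Completion.coe_smul] at this

end Density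

end QLevy

end

theorem theorem3p5
    {B : Type*} [Ring B] [StarRing B] [Bialgebra ℂ B] [StarModule ℂ B] [StarBialgebra B]
    {C : Type*} [Ring C] [StarRing C] [Bialgebra ℂ C] [StarModule ℂ C] [StarBialgebra C]
    {D : Type*} [NormedAddCommGroup D] [InnerProductSpace ℂ D]
    (Ω : D) (ψ : B →ₗ[ℂ] ℂ) (j : ℝ≥0 → ℝ≥0 → B →⋆ₐ[ℂ] La D)
    (hj : IsLevyProcess Ω j) (hcyc : IsCyclicProcess Ω j) (hgen : HasGenerator Ω j ψ)
    (κ : C →⋆ₐ[ℂ] B)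
    (hκ : ∀ c : C, Coalgebra.counit (R := ℂ) (κ c) = Coalgebra.counit (R := ℂ) c) :
    -- the net of infinitesimal convolution products converges in norm, in `H_k`
    (∀ (c : C) (s t : ℝ≥0), s ≤ t →
      ∃ v ∈ transformSpace Ω j κ,
        Tendsto (fun α : IntervalPartition s t =>
            (((transProd j κ α c).1 Ω : D) : UniformSpace.Completion D)) atTop (𝓝 v)) ∧
    -- the limits define a cyclic Lévy process `k` with generator `ψ ∘ κ` over `Dk ⊆ H_k`
    ∃ (Dk : Submodule ℂ (UniformSpace.Completion D))
      (hΩ : (Ω : UniformSpace.Completion D) ∈ Dk) (k : ℝ≥0 → ℝ≥0 → C →⋆ₐ[ℂ] La Dk),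
      IsTransform Ω j κ Dk hΩ k ∧
      Dk ≤ transformSpace Ω j κ ∧
      HasGenerator (⟨Ω, hΩ⟩ : Dk) k (ψ ∘ₗ lin κ) ∧
      -- the limits determine `Dk` and `k`
      (∀ (D' : Submodule ℂ (UniformSpace.Completion D))
        (hΩ' : (Ω : UniformSpace.Completion D) ∈ D') (k' : ℝ≥0 → ℝ≥0 → C →⋆ₐ[ℂ] La D'),
        IsTransform Ω j κ D' hΩ' k' →
        D' = Dk ∧ ∀ (s t : ℝ≥0), s ≤ t → ∀ (c : C) (x : Dk) (x' : D'),
          (x : UniformSpace.Completion D) = x' →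
          ((k s t c).1 x : UniformSpace.Completion D) = (k' s t c).1 x') ∧
      -- every cyclic Lévy process on `C` with generator `ψ ∘ κ` is unitarily equivalent to `k`
      (∀ (E : Type*) [NormedAddCommGroup E] [InnerProductSpace ℂ E] (Ω' : E)
        (k' : ℝ≥0 → ℝ≥0 → C →⋆ₐ[ℂ] La E),
        IsLevyProcess Ω' k' → IsCyclicProcess Ω' k' → HasGenerator Ω' k' (ψ ∘ₗ lin κ) →
        ∃ U : Dk ≃ₗᵢ[ℂ] E, U ⟨Ω, hΩ⟩ = Ω' ∧
          ∀ (s t : ℝ≥0), s ≤ t → ∀ (c : C) (x : Dk), U ((k s t c).1 x) = (k' s t c).1 (U x)) ∧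
      -- the reverse transformation, for surjective `κ`
      (Function.Surjective κ →
        -- `κ` has linear `*`-preserving sections on `B₀` (their values lie in `ker δ_C` as `δ_B ∘ κ = δ_C`)
        (∃ ν : augIdeal B →ₗ[ℂ] C, (∀ b, ν (star b) = star (ν b)) ∧ ∀ b, κ (ν b) = b) ∧
        -- the reverse products converge to `j`
        (∀ (ν : augIdeal B →ₗ[ℂ] C) (hν : ∀ b, ν (star b) = star (ν b)), (∀ b, κ (ν b) = b) →
          ∀ (b : B) (s t : ℝ≥0), s ≤ t →
            Tendsto (fun α : IntervalPartition s t =>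
                (((transProd k (InducedTensor.starLift ν hν) α (InducedTensor.incl b)).1
                  ⟨Ω, hΩ⟩ : Dk) : UniformSpace.Completion D))
              atTop (𝓝 ((j s t b).1 Ω : D))) ∧
        -- `H_k` is all of the closure of `D`, and `Dk` is dense in it
        transformSpace Ω j κ = ⊤ ∧ Dk.topologicalClosure = ⊤) := by
  obtain ⟨Dk, hΩ, π, h⟩ := exists_isLimitRep hj hgen κ hκ
  have htr := h.isTransform hgen hκ
  refine ⟨fun c s t hst => ⟨_, h.le_transformSpace (Subtype.prop _), htr.limit s t c hst⟩,
    Dk, hΩ, limitProcess π, htr, h.le_transformSpace, h.hasGenerator hgen hκ,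
    fun D' hΩ' k' h' => htr.unique h', fun E _ _ Ω' k' hk' hc' hg' => ?_, fun hs => ?_⟩
  · refine exists_linearIsometryEquiv htr.levy hk' htr.cyclic hc' fun s t hst => ?_
    rw [h.distr_eq hgen hκ hst, hk'.distr_eq hg' hst]
  · obtain ⟨ν, hν, hκν⟩ := exists_star_section hs
    refine ⟨⟨ν, hν, hκν⟩, fun ν hν hκν b s t hst => ?_, transformSpace_eq_top hcyc hs,
      h.topologicalClosure_eq_top hcyc hgen hκ (comp_starLift hν hκν)
        fun b => ⟨_, InducedTensor.toBialgebra_incl b⟩⟩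
    have h1 := h.tendsto_stepConv hgen hκ (comp_starLift hν hκν) (InducedTensor.incl b) hst
    rw [InducedTensor.toBialgebra_incl] at h1
    refine h1.congr fun α => ?_
    have h2 : π (stepConv (fun u v => lin (netAlgebraHom hj κ u v) ∘ₗ
        lin (InducedTensor.starLift ν hν)) α.1 (InducedTensor.incl b)) =
        transProd (limitProcess π) (InducedTensor.starLift ν hν) α (InducedTensor.incl b) :=
      map_stepConv π.toAlgHom _ α.1 _
    rw [h2]
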